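/- Let $k$ be an algebraically closed field of characteristic $0$, let $X$ be a smooth affine variety over $k$ with coordinate ring $\mathcal O=\mathcal O_X(X)$ (a smooth finitely generated commutative $k$-algebra), and let $\mathcal D\subset \mathrm{End}_k(\mathcal O)$ be the ring of differential operators: $\mathcal D=\bigcup_i F_i$ with $F_{-1}=0$ and $F_i=\{P : [P,a]\in F_{i-1}\text{ for all }a\in\mathcal O\}$. Let $\mathtt{DG}\mathcal D\mathtt M$ be the category of non-negatively graded chain complexes of left $\mathcal D$-modules. For $\mathcal D$-modules $M,N$, the module $M\otimes_{\mathcal O}N$ is a $\mathcal D$-module, on which vector fields $\theta$ act by $\theta(m\otimes n)=\theta m\otimes n+m\otimes\theta n$. Equip $\mathtt{DG}\mathcal D\mathtt M$ with the resulting tensor product of complexes, $(K\otimes L)_n=\bigoplus_{p+q=n}K_p\otimes_{\mathcal O}L_q$, $d(x\otimes y)=dx\otimes y+(-1)^{p}x\otimes dy$ for $x\in K_p$, with unit $\mathcal O$ concentrated in degree $0$ and symmetry $x\otimes y\mapsto(-1)^{pq}y\otimes x$ for $x\in K_p$, $y\in L_q$. Then the following hold. 1. $\mathtt{DG}\mathcal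 D\mathtt M$ has all small limits and colimits and is a model category, with functorial factorizations, in which the weak equivalences are the quasi-isomorphisms, the fibrations are the chain maps that are surjective in all positive degrees, and the cofibrations are the injective chain maps whose cokernel is, in each degree, a projective $\mathcal D$-module. 2. The symmetric monoidal structure is closed, and with the model structure of 1. it makes $\mathtt{DG}\mathcal D\mathtt M$ a symmetric monoidal model category, i.e.: (MMC1) for any two cofibrations $f:T\to U$ and $g:V\to W$ the pushout product $f\,\Box\, g: (U\otimes V)\amalg_{T\otimes V}(T\otimes W)\to U\otimes W$ is a cofibration, and it is a weak equivalence if $f$ or $g$ is one; (MMC2) if $Q\to\mathcal O$ is a trivial fibration $q$ with $Q$ cofibrant, then $q\otimes\mathrm{id}_C:Q\otimes C\to\mathcal O\otimes C$ is a weak equivalence for every cofibrant $C$. 3. If $f$ is a quasi-isomorphism and $M$ is cofibrant, then $f\otimes\mathrm{id}_M$ is a quasi-isomorphism. -/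

import Mathlib

universe w v u

noncomputable section

namespace DMod

open CategoryTheory Limits MonoidalCategory TensorProduct

set_option linter.unusedSectionVars false

section Operators

variable (k : Type v) (O : Type u) [Field k] [CommRing O] [Algebra k O]

/-- The `k`-linear operator of multiplication by `a` on `O`. -/
def mulOp (a : O) : Module.End k O := Algebra.lmul k O a

@[simp]
theorem mulOp_apply (a f : O) : mulOp k O a f = a * f := rfl

/-- `orderLT k O n` is the `O`-module of `k`-linear differential operators on `O` of order `< n`
(that is, of order `≤ n - 1`): only the zero operator has order `< 0`, and `P` has order `< n + 1`
iff all the commutators `[P, a]` with `a ∈ O` have order `< n`. -/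
def orderLT : ℕ → Submodule O (Module.End k O)
  | 0 => ⊥
  | n + 1 =>
    { carrier := {P | ∀ a : O, P * mulOp k O a - mulOp k O a * P ∈ orderLT n}
      zero_mem' := fun a => by simp
      add_mem' := fun {P Q} hP hQ a => by
        have : (P + Q) * mulOp k O a - mulOp k O a * (P + Q) =
          (P * mulOp k O a - mulOp k O a * P) + (Q * mulOp k O a - mulOp k O a * Q) := by
          noncomm_ring
        rw [this]
        exact add_mem (hP a) (hQ a)
      smul_mem' := fun c P hP a => by
        have : (c • P) * mulOp k O a - mulOp k O a * (c • P) =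
          c • (P * mulOp k O a - mulOp k O a * P) := by
          ext f
          simp
          ring_nf
        rw [this]
        exact Submodule.smul_mem _ _ (hP a) }

variable {k O}

theorem mem_orderLT_succ {n : ℕ} {P : Module.End k O} :
    P ∈ orderLT k O (n + 1) ↔ ∀ a : O, P * mulOp k O a - mulOp k O a * P ∈ orderLT k O n :=
  Iff.rfl

theorem mulOp_mul (a : O) (P : Module.End k O) : mulOp k O a * P = a • P := by
  ext f; simp

theorem orderLT_le_succ (n : ℕ) : orderLT k O n ≤ orderLT k O (n + 1) := by
  induction n with
  | zero => exact bot_le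
  | succ n ih => exact fun P hP a => ih (hP a)

theorem orderLT_mono : Monotone (orderLT k O) := monotone_nat_of_le_succ orderLT_le_succ

theorem mul_mem_orderLT (m n : ℕ) {P Q : Module.End k O} (hP : P ∈ orderLT k O (m + 1))
    (hQ : Q ∈ orderLT k O (n + 1)) : P * Q ∈ orderLT k O (m + n + 1) := by
  suffices H : ∀ (N m n : ℕ), m + n = N → ∀ P ∈ orderLT k O m, ∀ Q ∈ orderLT k O n,
      P * Q ∈ orderLT k O (m + n - 1) by
    have := H _ (m + 1) (n + 1) rfl P hP Q hQ
    rwa [show m + 1 + (n + 1) - 1 = m + n + 1 by omega] at this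
  intro N
  induction N with
  | zero =>
    intro m n h P hP Q hQ
    obtain rfl : m = 0 := by omega
    obtain rfl : P = 0 := by simpa [orderLT] using hP
    simp
  | succ N ih =>
    intro m n h P hP Q hQ
    rcases m with _ | m
    · obtain rfl : P = 0 := by simpa [orderLT] using hP
      simp
    rcases n with _ | n
    · obtain rfl : Q = 0 := by simpa [orderLT] using hQ
      simp
    rw [show m + 1 + (n + 1) - 1 = m + n + 1 by omega]
    intro a
    have e : P * Q * mulOp k O a - mulOp k O a * (P * Q) =
        P * (Q * mulOp k O a - mulOp k O a * Q) + (P * mulOp k O a - mulOp k O a * P) * Q := by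
      simp only [mul_sub, sub_mul, mul_assoc]
      abel
    rw [e]
    refine add_mem ?_ ?_
    · have := ih (m + 1) n (by omega) P hP _ (hQ a)
      rwa [show m + 1 + n - 1 = m + n by omega] at this
    · have := ih m (n + 1) (by omega) _ (hP a) Q hQ
      rwa [show m + (n + 1) - 1 = m + n by omega] at this

theorem mulOp_mem_orderLT (a : O) : mulOp k O a ∈ orderLT k O 1 := by
  intro b
  have : mulOp k O a * mulOp k O b - mulOp k O b * mulOp k O a = 0 := by
    ext f; simp; ring
  rw [this]
  exact zero_mem _

theorem derivation_mem_orderLT (θ : Derivation k O O) :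
    (θ : O →ₗ[k] O) ∈ orderLT k O 2 := by
  intro a
  have : (θ : Module.End k O) * mulOp k O a - mulOp k O a * (θ : O →ₗ[k] O) = mulOp k O (θ a) := by
    ext f; simp; ring
  rw [this]
  exact mulOp_mem_orderLT _

variable (k O)

/-- The ring `D` of `k`-linear differential operators (of all finite orders) on `O`. -/
def DiffOp : Subring (Module.End k O) where
  carrier := {P | ∃ n, P ∈ orderLT k O n}
  mul_mem' := by
    rintro P Q ⟨m, hP⟩ ⟨n, hQ⟩
    exact ⟨_, mul_mem_orderLT m n (orderLT_le_succ _ hP) (orderLT_le_succ _ hQ)⟩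
  one_mem' := ⟨1, by
    have : (1 : Module.End k O) = mulOp k O 1 := by ext; simp
    rw [this]
    exact mulOp_mem_orderLT 1⟩
  add_mem' := by
    rintro P Q ⟨m, hP⟩ ⟨n, hQ⟩
    exact ⟨max m n, add_mem (orderLT_mono (le_max_left _ _) hP)
      (orderLT_mono (le_max_right _ _) hQ)⟩
  zero_mem' := ⟨0, zero_mem _⟩
  neg_mem' := by
    rintro P ⟨n, hP⟩
    exact ⟨n, neg_mem hP⟩

/-- The inclusion `O → D` of functions as multiplication operators. -/
def ofFun : O →+* DiffOp k O where
  toFun a := ⟨mulOp k O a, 1, mulOp_mem_orderLT a⟩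
  map_one' := by ext; simp
  map_mul' a b := by ext; simp [mul_assoc]
  map_zero' := by ext; simp
  map_add' a b := by ext; simp [add_mul]

variable {k O} in
/-- The inclusion of vector fields in `D`. -/
def ofDer (θ : Derivation k O O) : DiffOp k O := ⟨(θ : O →ₗ[k] O), 2, derivation_mem_orderLT θ⟩

end Operators

section Coordinates

variable (k : Type v) (O : Type u) [Field k] [CommRing O] [Algebra k O]

/-- A finite dual basis for the module of differentials: functions `x i` and vector fields `∂ i`
with `da = ∑ i, ∂ i (a) • d(x i)`. -/
theorem exists_coords [Algebra.Smooth k O] :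
    ∃ (S : Finset O) (p : O → Derivation k O O), ∀ a : O,
      KaehlerDifferential.D k O a = ∑ x ∈ S, p x a • KaehlerDifferential.D k O x := by
  classical
  have hsurj : Function.Surjective
      (Finsupp.linearCombination O (fun x : O => KaehlerDifferential.D k O x)) := by
    rw [← LinearMap.range_eq_top, Finsupp.range_linearCombination]
    exact KaehlerDifferential.span_range_derivation k O
  obtain ⟨s, hs⟩ := Module.projective_lifting_property _
    (LinearMap.id : Ω[O⁄k] →ₗ[O] Ω[O⁄k]) hsurj
  obtain ⟨T, hT⟩ := (Module.Finite.fg_top : (⊤ : Submodule O Ω[O⁄k]).FG)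
  refine ⟨T.biUnion fun g => (s g).support,
    fun x => ((Finsupp.lapply x).comp s).compDer (KaehlerDifferential.D k O), fun a => ?_⟩
  have hsupp : ∀ w, s w ∈ Finsupp.supported O O
      (↑(T.biUnion fun g => (s g).support) : Set O) := by
    intro w
    have hw : w ∈ Submodule.span O (T : Set Ω[O⁄k]) := hT ▸ Submodule.mem_top
    have : Submodule.span O (T : Set Ω[O⁄k]) ≤ (Finsupp.supported O O
      (↑(T.biUnion fun g => (s g).support) : Set O)).comap s := by
      rw [Submodule.span_le]
      intro g hg
      simp only [Submodule.comap_coe, Set.mem_preimage, SetLike.mem_coe]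
      rw [Finsupp.mem_supported]
      intro x hx
      simp only [Finset.coe_biUnion, Set.mem_iUnion]
      exact ⟨g, hg, hx⟩
    exact this hw
  have h1 := LinearMap.congr_fun hs (KaehlerDifferential.D k O a)
  simp only [LinearMap.comp_apply, LinearMap.id_apply] at h1
  rw [Finsupp.linearCombination_apply, Finsupp.sum_of_support_subset _
    (s := T.biUnion fun g => (s g).support)] at h1
  · exact h1.symm
  · have := hsupp (KaehlerDifferential.D k O a)
    rw [Finsupp.mem_supported] at this
    exact_mod_cast this
  · simp

variable {k O}

theorem derivation_eq_sum {S : Finset O} {p : O → Derivation k O O}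
    (h : ∀ a : O, KaehlerDifferential.D k O a = ∑ x ∈ S, p x a • KaehlerDifferential.D k O x)
    {M : Type*} [AddCommGroup M] [Module k M] [Module O M] [IsScalarTower k O M]
    (δ : Derivation k O M) (a : O) : δ a = ∑ x ∈ S, p x a • δ x := by
  have := congrArg δ.liftKaehlerDifferential (h a)
  simpa using this

/-- The Euler identity in the order filtration: the symbol of order `n` is homogeneous. -/
theorem euler_orderLT {S : Finset O} {p : O → Derivation k O O}
    (h : ∀ a : O, KaehlerDifferential.D k O a = ∑ x ∈ S, p x a • KaehlerDifferential.D k O x)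
    (n : ℕ) : ∀ P ∈ orderLT k O (n + 1),
      (∑ x ∈ S, (P * mulOp k O x - mulOp k O x * P) * (p x : O →ₗ[k] O)) - n • P ∈
        orderLT k O n := by
  induction n with
  | zero =>
    intro P hP
    have : ∀ a, P * mulOp k O a - mulOp k O a * P = 0 := fun a => by simpa [orderLT] using hP a
    simp [this]
  | succ n ih =>
    intro P hP a
    -- the map `f ↦ [P, f]` is a derivation modulo operators of lower order
    let δ : Derivation k O (Module.End k O ⧸ orderLT k O n) :=
      Derivation.mk'
        { toFun := fun f => Submodule.Quotient.mk (P * mulOp k O f - mulOp k O f * P)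
          map_add' := fun f g => by
            rw [← Submodule.Quotient.mk_add]
            congr 1
            ext t
            simp [add_mul]
            ring
          map_smul' := fun c f => by
            rw [RingHom.id_apply, ← algebraMap_smul O c, ← Submodule.Quotient.mk_smul]
            congr 1
            ext t
            simp only [LinearMap.sub_apply, Module.End.mul_apply, mulOp_apply,
              LinearMap.smul_apply, smul_mul_assoc, map_smul, algebraMap_smul, smul_sub] }
        (fun f g => by
          simp only [LinearMap.coe_mk, AddHom.coe_mk]
          rw [← Submodule.Quotient.mk_smul, ← Submodule.Quotient.mk_smul,
            ← Submodule.Quotient.mk_add, Submodule.Quotient.eq]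
          have hc := hP f g
          convert hc using 1
          ext t
          simp [mul_sub]
          ring_nf)
    have hδ := derivation_eq_sum h δ a
    have hmem : (P * mulOp k O a - mulOp k O a * P) -
        ∑ x ∈ S, p x a • (P * mulOp k O x - mulOp k O x * P) ∈ orderLT k O n := by
      rw [← Submodule.Quotient.eq]
      have e : (Submodule.Quotient.mk (∑ x ∈ S, p x a • (P * mulOp k O x - mulOp k O x * P)) :
          Module.End k O ⧸ orderLT k O n) = ∑ x ∈ S, p x a • δ x := by
        rw [← Submodule.mkQ_apply, map_sum]
        rfl
      rw [e, ← hδ]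
      rfl
    have hcomm : ∑ x ∈ S, ((P * mulOp k O x - mulOp k O x * P) * mulOp k O (p x a) -
        p x a • (P * mulOp k O x - mulOp k O x * P)) ∈ orderLT k O n := by
      refine Submodule.sum_mem _ fun x _ => ?_
      have := hP x (p x a)
      rwa [mulOp_mul] at this
    have hI := ih _ (hP a)
    have key : ((∑ x ∈ S, (P * mulOp k O x - mulOp k O x * P) * (p x : O →ₗ[k] O)) -
          (n + 1) • P) * mulOp k O a - mulOp k O a *
          ((∑ x ∈ S, (P * mulOp k O x - mulOp k O x * P) * (p x : O →ₗ[k] O)) - (n + 1) • P) =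
        ((∑ x ∈ S, ((P * mulOp k O a - mulOp k O a * P) * mulOp k O x -
            mulOp k O x * (P * mulOp k O a - mulOp k O a * P)) * (p x : O →ₗ[k] O)) -
          n • (P * mulOp k O a - mulOp k O a * P)) +
        (∑ x ∈ S, ((P * mulOp k O x - mulOp k O x * P) * mulOp k O (p x a) -
          p x a • (P * mulOp k O x - mulOp k O x * P))) -
        ((P * mulOp k O a - mulOp k O a * P) -
          ∑ x ∈ S, p x a • (P * mulOp k O x - mulOp k O x * P)) := by
      have e : ∀ x, (P * mulOp k O x - mulOp k O x * P) * (p x : O →ₗ[k] O) * mulOp k O a -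
          mulOp k O a * ((P * mulOp k O x - mulOp k O x * P) * (p x : O →ₗ[k] O)) =
          ((P * mulOp k O a - mulOp k O a * P) * mulOp k O x -
            mulOp k O x * (P * mulOp k O a - mulOp k O a * P)) * (p x : O →ₗ[k] O) +
          (P * mulOp k O x - mulOp k O x * P) * mulOp k O (p x a) := by
        intro x
        ext t
        simp [mul_add, mul_sub, mul_comm, mul_left_comm]
        ring_nf
      have e2 := Finset.sum_congr (rfl : S = S) fun x _ => e x
      rw [Finset.sum_add_distrib, Finset.sum_sub_distrib, ← Finset.sum_mul, ← Finset.mul_sum] at e2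
      rw [Finset.sum_sub_distrib, sub_mul, mul_sub, smul_mul_assoc, mul_smul_comm, add_smul,
        add_smul, one_smul, one_smul, smul_sub]
      rw [← sub_eq_zero] at e2 ⊢
      refine Eq.trans ?_ e2
      abel
    rw [key]
    exact sub_mem (add_mem hI hcomm) hmem

end Coordinates

section Extension

variable (k : Type v) (O : Type u) [Field k] [CommRing O] [Algebra k O]

variable {k O} in
theorem ofDer_mul_ofFun (θ : Derivation k O O) (a : O) :
    ofDer θ * ofFun k O a = ofFun k O a * ofDer θ + ofFun k O (θ a) := by
  ext t
  simp [ofDer, ofFun, mul_comm]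

variable {k O} in
theorem ofDer_add (θ η : Derivation k O O) : ofDer (θ + η) = ofDer θ + ofDer η := by
  ext t
  simp [ofDer]

variable {k O} in
theorem ofDer_smul (a : O) (θ : Derivation k O O) :
    ofDer (a • θ) = ofFun k O a * ofDer θ := by
  ext t
  simp [ofDer, ofFun]

variable {k O} in
theorem ofDer_lie (θ η : Derivation k O O) :
    ofDer ⁅θ, η⁆ = ofDer θ * ofDer η - ofDer η * ofDer θ := by
  refine Subtype.ext (LinearMap.ext fun t => ?_)
  exact Derivation.commutator_apply t

/-- On a smooth `O` in characteristic zero, differential operators are generated by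
functions and vector fields. -/
theorem diffOp_induction [CharZero k] [Algebra.Smooth k O] {motive : DiffOp k O → Prop}
    (hf : ∀ a, motive (ofFun k O a)) (hd : ∀ θ, motive (ofDer θ))
    (hadd : ∀ P Q, motive P → motive Q → motive (P + Q))
    (hmul : ∀ P Q, motive P → motive Q → motive (P * Q)) (P : DiffOp k O) : motive P := by
  obtain ⟨S, p, h⟩ := exists_coords k O
  have hsum : ∀ (T : Finset O) (F : O → DiffOp k O), (∀ x, motive (F x)) →
      motive (∑ x ∈ T, F x) := by
    classical
    intro T F hF
    induction T using Finset.induction_on with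
    | empty => simpa using hf 0
    | insert a T ha ih => rw [Finset.sum_insert ha]; exact hadd _ _ (hF a) ih
  have hneg : ∀ P, motive P → motive (-P) := fun P hP => by
    have e : -P = ofFun k O (-1) * P := by
      ext t
      simp [ofFun]
    rw [e]
    exact hmul _ _ (hf (-1)) hP
  suffices H : ∀ (n : ℕ) (P : DiffOp k O), (P : Module.End k O) ∈ orderLT k O n → motive P by
    obtain ⟨n, hn⟩ := P.2
    exact H n P hn
  intro n
  induction n with
  | zero =>
    intro P hP
    obtain rfl : P = 0 := Subtype.ext (by simpa [orderLT] using hP)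
    simpa using hf 0
  | succ n ih =>
    intro P hP
    have hE := euler_orderLT h n _ hP
    set C : O → DiffOp k O := fun x => P * ofFun k O x - ofFun k O x * P with hC
    have hE' : (((∑ x ∈ S, C x * ofDer (p x)) - n • P : DiffOp k O) : Module.End k O) ∈
        orderLT k O n := by
      simpa [hC, ofDer, ofFun] using hE
    have h1 : motive (∑ x ∈ S, C x * ofDer (p x)) :=
      hsum _ _ fun x => hmul _ _ (ih _ (hP x)) (hd _)
    have h2 : motive (n • P) := by
      have e : n • P = (∑ x ∈ S, C x * ofDer (p x)) +
          -((∑ x ∈ S, C x * ofDer (p x)) - n • P) := by abel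
      rw [e]
      exact hadd _ _ h1 (hneg _ (ih _ hE'))
    rcases Nat.eq_zero_or_pos n with rfl | hn
    · have hP0 : ∀ a, (P : Module.End k O) * mulOp k O a = mulOp k O a * P := fun a => by
        have := hP a
        simpa [orderLT, sub_eq_zero] using this
      have : P = ofFun k O ((P : Module.End k O) 1) := by
        ext a
        have := LinearMap.congr_fun (hP0 a) 1
        simp only [Module.End.mul_apply, mulOp_apply, mul_one] at this
        simp [ofFun, this, mul_comm]
      rw [this]
      exact hf _
    · have := hmul _ _ (hf (algebraMap k O (n : k)⁻¹)) h2
      have e : ofFun k O (algebraMap k O (n : k)⁻¹) * n • P = P := by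
        have hn' : (n : k) ≠ 0 := by exact_mod_cast hn.ne'
        rw [nsmul_eq_mul, ← mul_assoc, ← map_natCast (ofFun k O) n, ← map_mul,
          ← map_natCast (algebraMap k O) n, ← map_mul, inv_mul_cancel₀ hn', map_one, map_one,
          one_mul]
      rwa [e] at this

/-- A flat connection on an `O`-module `V`: an action of vector fields on `V` which is
`O`-linear in the vector field, satisfies the Leibniz rule and is compatible with brackets. -/
structure FlatConnection (V : Type w) [AddCommGroup V] [Module O V] where
  nabla : Derivation k O O → V →+ V
  nabla_add : ∀ θ η v, nabla (θ + η) v = nabla θ v + nabla η v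
  nabla_smul : ∀ (a : O) θ v, nabla (a • θ) v = a • nabla θ v
  leibniz : ∀ θ (a : O) v, nabla θ (a • v) = θ a • v + a • nabla θ v
  nabla_lie : ∀ θ η v, nabla ⁅θ, η⁆ v = nabla θ (nabla η v) - nabla η (nabla θ v)

namespace FlatConnection

variable {k O} {V : Type w} [AddCommGroup V] [Module O V] (c : FlatConnection k O V)

/-- Pairs of an operator on functions and an operator on `V`. -/
abbrev Pairs (k : Type v) (O : Type u) [Field k] [CommRing O] [Algebra k O]
    (V : Type w) [AddCommGroup V] [Module O V] :=
  Module.End k O × AddMonoid.End V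

variable (k V) in
/-- The pair given by multiplication by a function. -/
def pairFun : O →+* Pairs k O V :=
  ((DiffOp k O).subtype.comp (ofFun k O)).prod
    (Module.toAddMonoidEnd O V)

/-- The pair given by a vector field. -/
def pairDer (θ : Derivation k O O) : Pairs k O V := ((θ : O →ₗ[k] O), c.nabla θ)

theorem pairDer_mul_pairFun (θ : Derivation k O O) (a : O) :
    c.pairDer θ * pairFun k V a = pairFun k V a * c.pairDer θ + pairFun k V (θ a) := by
  refine Prod.ext ?_ ?_
  · exact congrArg Subtype.val (ofDer_mul_ofFun θ a)
  · ext v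
    refine (c.leibniz θ a v).trans ?_
    rw [add_comm]
    rfl

theorem pairDer_add (θ η : Derivation k O O) :
    c.pairDer (θ + η) = c.pairDer θ + c.pairDer η := by
  refine Prod.ext ?_ ?_
  · exact congrArg Subtype.val (ofDer_add θ η)
  · ext v
    exact c.nabla_add θ η v

theorem pairDer_smul (a : O) (θ : Derivation k O O) :
    c.pairDer (a • θ) = pairFun k V a * c.pairDer θ := by
  refine Prod.ext ?_ ?_
  · exact congrArg Subtype.val (ofDer_smul a θ)
  · ext v
    exact c.nabla_smul a θ v

theorem pairDer_lie (θ η : Derivation k O O) :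
    c.pairDer ⁅θ, η⁆ = c.pairDer θ * c.pairDer η - c.pairDer η * c.pairDer θ := by
  refine Prod.ext ?_ ?_
  · exact congrArg Subtype.val (ofDer_lie θ η)
  · ext v
    exact c.nabla_lie θ η v

theorem pairDer_sum (S : Finset O) (f : O → O) (p : O → Derivation k O O) :
    c.pairDer (∑ x ∈ S, f x • p x) = ∑ x ∈ S, pairFun k V (f x) * c.pairDer (p x) := by
  classical
  induction S using Finset.induction_on with
  | empty =>
    have := c.pairDer_smul 0 0
    simpa using this
  | insert a T ha ih => rw [Finset.sum_insert ha, Finset.sum_insert ha, pairDer_add,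
      pairDer_smul, ih]

/-- Pairs generated by functions and at most `n - 1` vector fields. -/
def filt : ℕ → AddSubgroup (Pairs k O V)
  | 0 => ⊥
  | n + 1 => AddSubgroup.closure
      (Set.range (pairFun k V) ∪ {t | ∃ s ∈ filt n, ∃ θ, t = s * c.pairDer θ})

theorem pairFun_mem (n : ℕ) (a : O) : pairFun k V a ∈ c.filt (n + 1) :=
  AddSubgroup.subset_closure (Or.inl ⟨a, rfl⟩)

theorem mul_pairDer_mem {n : ℕ} {s : Pairs k O V} (hs : s ∈ c.filt n) (θ : Derivation k O O) :
    s * c.pairDer θ ∈ c.filt (n + 1) :=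
  AddSubgroup.subset_closure (Or.inr ⟨s, hs, θ, rfl⟩)

theorem filt_succ_le {n : ℕ} {A : AddSubgroup (Pairs k O V)} (h1 : ∀ a, pairFun k V a ∈ A)
    (h2 : ∀ s ∈ c.filt n, ∀ θ, s * c.pairDer θ ∈ A) : c.filt (n + 1) ≤ A := by
  refine (AddSubgroup.closure_le A).2 ?_
  rintro _ (⟨a, rfl⟩ | ⟨s, hs, θ, rfl⟩)
  exacts [h1 a, h2 s hs θ]

theorem filt_le_succ (n : ℕ) : c.filt n ≤ c.filt (n + 1) := by
  induction n with
  | zero => exact bot_le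
  | succ n ih =>
    exact c.filt_succ_le (c.pairFun_mem _) fun s hs θ => c.mul_pairDer_mem (ih hs) θ

theorem filt_mono : Monotone c.filt := monotone_nat_of_le_succ c.filt_le_succ

theorem pairFun_mul_mem (b : O) (n : ℕ) : ∀ s ∈ c.filt n, pairFun k V b * s ∈ c.filt n := by
  induction n with
  | zero =>
    intro s hs
    obtain rfl : s = 0 := hs
    simp
  | succ n ih =>
    refine c.filt_succ_le (A := (c.filt (n + 1)).comap (AddMonoidHom.mulLeft (pairFun k V b)))
      (fun a => ?_) (fun s hs θ => ?_)
    · rw [AddSubgroup.mem_comap, AddMonoidHom.coe_mulLeft]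
      rw [← map_mul]
      exact c.pairFun_mem _ _
    · rw [AddSubgroup.mem_comap, AddMonoidHom.coe_mulLeft]
      rw [← mul_assoc]
      exact c.mul_pairDer_mem (ih s hs) θ

/-- The commutator with a function, as an additive map. -/
def comm (a : O) : Pairs k O V →+ Pairs k O V :=
  AddMonoidHom.mulRight (pairFun k V a) - AddMonoidHom.mulLeft (pairFun k V a)

theorem comm_apply (a : O) (s : Pairs k O V) :
    comm a s = s * pairFun k V a - pairFun k V a * s := rfl

theorem comm_mul_pairDer (a : O) (s : Pairs k O V) (θ : Derivation k O O) :
    comm a (s * c.pairDer θ) = s * pairFun k V (θ a) + comm a s * c.pairDer θ := by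
  simp only [comm_apply, mul_assoc, pairDer_mul_pairFun, mul_add, sub_mul]
  abel

theorem comm_pairFun (a b : O) : comm a (pairFun k V b) = 0 := by
  rw [comm_apply, ← map_mul, ← map_mul, mul_comm, sub_self]

theorem comm_mem (a : O) (n : ℕ) : ∀ s ∈ c.filt (n + 1), comm a s ∈ c.filt n := by
  induction n generalizing a with
  | zero =>
    refine c.filt_succ_le (A := (c.filt 0).comap (comm a)) (fun b => ?_) (fun s hs θ => ?_)
    · rw [AddSubgroup.mem_comap]
      rw [comm_pairFun]
      exact zero_mem _
    · obtain rfl : s = 0 := hs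
      simp
  | succ n ih =>
    refine c.filt_succ_le (A := (c.filt (n + 1)).comap (comm a)) (fun b => ?_) (fun s hs θ => ?_)
    · rw [AddSubgroup.mem_comap]
      rw [comm_pairFun]
      exact zero_mem _
    · rw [AddSubgroup.mem_comap]
      rw [comm_mul_pairDer]
      refine add_mem ?_ (c.mul_pairDer_mem (ih a s hs) θ)
      have e : s * pairFun k V (θ a) = comm (θ a) s + pairFun k V (θ a) * s := by
        rw [comm_apply]
        abel
      rw [e]
      exact add_mem (c.filt_le_succ _ (ih _ s hs)) (c.pairFun_mul_mem _ _ s hs)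

theorem mul_pairFun_mem (b : O) (n : ℕ) : ∀ s ∈ c.filt n, s * pairFun k V b ∈ c.filt n := by
  intro s hs
  have e : s * pairFun k V b = comm b s + pairFun k V b * s := by
    rw [comm_apply]
    abel
  rw [e]
  refine add_mem ?_ (c.pairFun_mul_mem _ _ s hs)
  rcases n with _ | n
  · obtain rfl : s = 0 := hs
    simp
  · exact c.filt_le_succ _ (c.comm_mem b n s hs)

theorem mul_mem_filt {m : ℕ} {s : Pairs k O V} (hs : s ∈ c.filt m) (n : ℕ) :
    ∀ t ∈ c.filt n, s * t ∈ c.filt (m + n) := by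
  induction n with
  | zero =>
    intro t ht
    obtain rfl : t = 0 := ht
    simp
  | succ n ih =>
    refine c.filt_succ_le (A := (c.filt (m + n + 1)).comap (AddMonoidHom.mulLeft s))
      (fun a => ?_) (fun t ht θ => ?_)
    · exact c.filt_mono (show m ≤ m + n + 1 by omega) (c.mul_pairFun_mem a m s hs)
    · rw [AddSubgroup.mem_comap, AddMonoidHom.coe_mulLeft]
      rw [← mul_assoc]
      exact c.mul_pairDer_mem (ih t ht) θ

/-- The Euler operator attached to coordinates, minus `n`. -/
def euler (S : Finset O) (p : O → Derivation k O O) (n : ℕ) : Pairs k O V →+ Pairs k O V :=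
  (∑ x ∈ S, (AddMonoidHom.mulRight (c.pairDer (p x))).comp (comm x)) - n • AddMonoidHom.id _

theorem euler_apply (S : Finset O) (p : O → Derivation k O O) (n : ℕ) (s : Pairs k O V) :
    c.euler S p n s = (∑ x ∈ S, comm x s * c.pairDer (p x)) - n • s := by
  simp [euler]

theorem euler_mem {S : Finset O} {p : O → Derivation k O O}
    (h : ∀ a : O, KaehlerDifferential.D k O a = ∑ x ∈ S, p x a • KaehlerDifferential.D k O x)
    (n : ℕ) : ∀ s ∈ c.filt (n + 1), c.euler S p n s ∈ c.filt n := by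
  induction n with
  | zero =>
    refine c.filt_succ_le (A := (c.filt 0).comap (c.euler S p 0)) (fun b => ?_) (fun s hs θ => ?_)
    · rw [AddSubgroup.mem_comap]
      simp [euler_apply, comm_pairFun]
    · obtain rfl : s = 0 := hs
      simp
  | succ n ih =>
    refine c.filt_succ_le (A := (c.filt (n + 1)).comap (c.euler S p (n + 1)))
      (fun b => ?_) (fun s hs θ => ?_)
    · rw [AddSubgroup.mem_comap]
      simp only [euler_apply, comm_pairFun, zero_mul, Finset.sum_const_zero, zero_sub]
      exact neg_mem (nsmul_mem (c.pairFun_mem _ _) _)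
    · rw [AddSubgroup.mem_comap]
      have hθ : θ = ∑ x ∈ S, θ x • p x := by
        ext a
        have h1 := derivation_eq_sum h θ a
        have h2 := congrFun (map_sum (Derivation.coeFnAddMonoidHom (R := k) (A := O) (M := O))
          (fun x => θ x • p x) S) a
        rw [Finset.sum_apply] at h2
        refine h1.trans (Eq.trans ?_ h2.symm)
        exact Finset.sum_congr rfl fun x _ => mul_comm _ _
      have e1 : ∑ x ∈ S, s * (pairFun k V (θ x) * c.pairDer (p x)) = s * c.pairDer θ := by
        conv_rhs => rw [hθ, pairDer_sum, Finset.mul_sum]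
      have e : c.euler S p (n + 1) (s * c.pairDer θ) = c.euler S p n s * c.pairDer θ +
          ∑ x ∈ S, comm x s * c.pairDer ⁅θ, p x⁆ := by
        rw [euler_apply, euler_apply]
        simp only [comm_mul_pairDer, add_mul, Finset.sum_add_distrib, pairDer_lie, mul_sub,
          Finset.sum_sub_distrib, e1, sub_mul, Finset.sum_mul, mul_assoc, add_smul, one_smul,
          smul_mul_assoc]
        abel
      rw [e]
      exact add_mem (c.mul_pairDer_mem (ih s hs) θ)
        (sum_mem fun x _ => c.mul_pairDer_mem (c.comm_mem x n s hs) _)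

variable [CharZero k] [Algebra.Smooth k O]

theorem eq_zero_of_fst (n : ℕ) : ∀ s ∈ c.filt n, s.1 = 0 → s = 0 := by
  obtain ⟨S, p, h⟩ := exists_coords k O
  induction n with
  | zero => exact fun s hs _ => hs
  | succ n ih =>
    intro s hs hs1
    have hc : ∀ x, comm x s = 0 := fun x => by
      refine ih _ (c.comm_mem x n s hs) ?_
      simp [comm_apply, hs1]
    have hE := c.euler_mem h n s hs
    rw [euler_apply] at hE
    simp only [hc, zero_mul, Finset.sum_const_zero, zero_sub] at hE
    have hns : n • s = 0 := ih _ (by simpa using neg_mem hE) (by simp [hs1])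
    rcases Nat.eq_zero_or_pos n with rfl | hn
    · have : c.filt 1 ≤ (pairFun k V (O := O)).toAddMonoidHom.range := by
        refine c.filt_succ_le (fun a => ⟨a, rfl⟩) (fun t ht θ => ?_)
        obtain rfl : t = 0 := ht
        simp
      obtain ⟨b, rfl⟩ := this hs
      have hb := LinearMap.congr_fun hs1 1
      have hb' : b = 0 := by simpa [pairFun, ofFun] using hb
      simp [hb']
    · have e : pairFun k V (algebraMap k O (n : k)⁻¹) * n • s = s := by
        have hn' : (n : k) ≠ 0 := by exact_mod_cast hn.ne'
        rw [nsmul_eq_mul, ← mul_assoc, ← map_natCast (pairFun k V) n, ← map_mul,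
          ← map_natCast (algebraMap k O) n, ← map_mul, inv_mul_cancel₀ hn', map_one, map_one,
          one_mul]
      rw [← e, hns, mul_zero]

theorem exists_lift (P : DiffOp k O) : ∃ s : Pairs k O V, (∃ n, s ∈ c.filt n) ∧ s.1 = P := by
  refine diffOp_induction k O (motive := fun P => ∃ s : Pairs k O V,
    (∃ n, s ∈ c.filt n) ∧ s.1 = P) (fun a => ?_) (fun θ => ?_) ?_ ?_ P
  · exact ⟨pairFun k V a, ⟨1, c.pairFun_mem 0 a⟩, rfl⟩
  · exact ⟨pairFun k V 1 * c.pairDer θ, ⟨2, c.mul_pairDer_mem (c.pairFun_mem 0 1) θ⟩, by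
      simp [pairDer, ofDer]⟩
  · rintro P Q ⟨s, ⟨m, hs⟩, hsP⟩ ⟨t, ⟨n, ht⟩, htQ⟩
    exact ⟨s + t, ⟨max m n, add_mem (c.filt_mono (le_max_left _ _) hs)
      (c.filt_mono (le_max_right _ _) ht)⟩, by simp [hsP, htQ]⟩
  · rintro P Q ⟨s, ⟨m, hs⟩, hsP⟩ ⟨t, ⟨n, ht⟩, htQ⟩
    exact ⟨s * t, ⟨m + n, c.mul_mem_filt hs n t ht⟩, by simp [hsP, htQ]⟩

/-- The operator on `V` by which a differential operator acts. -/
def actFun (P : DiffOp k O) : AddMonoid.End V := (c.exists_lift P).choose.2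

theorem actFun_eq {P : DiffOp k O} {s : Pairs k O V} {n : ℕ} (hs : s ∈ c.filt n) (hP : s.1 = P) :
    c.actFun P = s.2 := by
  obtain ⟨⟨m, hm⟩, h⟩ := (c.exists_lift P).choose_spec
  have := c.eq_zero_of_fst (max m n) _ (sub_mem (c.filt_mono (le_max_left _ _) hm)
    (c.filt_mono (le_max_right _ _) hs)) (by simp [h, hP])
  rw [sub_eq_zero] at this
  exact congrArg Prod.snd this

/-- The action of the ring `D` on an `O`-module with a flat connection: it is the unique one for
which functions act by scalar multiplication and vector fields act through the connection. -/
def act : DiffOp k O →+* AddMonoid.End V where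
  toFun := c.actFun
  map_one' := c.actFun_eq (s := pairFun k V 1) (c.pairFun_mem 0 1) (by simp) |>.trans (by simp)
  map_zero' := c.actFun_eq (zero_mem (c.filt 0)) (by simp)
  map_add' P Q := by
    obtain ⟨s, ⟨m, hs⟩, hsP⟩ := c.exists_lift P
    obtain ⟨t, ⟨n, ht⟩, htQ⟩ := c.exists_lift Q
    rw [c.actFun_eq hs hsP, c.actFun_eq ht htQ,
      c.actFun_eq (add_mem (c.filt_mono (le_max_left m n) hs) (c.filt_mono (le_max_right m n) ht))
        (P := P + Q) (by simp [hsP, htQ])]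
    rfl
  map_mul' P Q := by
    obtain ⟨s, ⟨m, hs⟩, hsP⟩ := c.exists_lift P
    obtain ⟨t, ⟨n, ht⟩, htQ⟩ := c.exists_lift Q
    rw [c.actFun_eq hs hsP, c.actFun_eq ht htQ,
      c.actFun_eq (c.mul_mem_filt hs n t ht) (P := P * Q) (by simp [hsP, htQ])]
    rfl

theorem act_ofFun (a : O) (v : V) : c.act (ofFun k O a) v = a • v :=
  DFunLike.congr_fun (c.actFun_eq (s := pairFun k V a) (c.pairFun_mem 0 a) rfl) v

theorem act_ofDer (θ : Derivation k O O) (v : V) : c.act (ofDer θ) v = c.nabla θ v :=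
  DFunLike.congr_fun ((c.actFun_eq (s := pairFun k V 1 * c.pairDer θ)
    (c.mul_pairDer_mem (c.pairFun_mem 0 1) θ) (by simp [pairDer, ofDer])).trans
      (by simp only [map_one, one_mul]; rfl)) v

end FlatConnection

end Extension

namespace FlatConnection

variable {k : Type v} {O : Type u} [Field k] [CommRing O] [Algebra k O]
variable {V W : Type u} [AddCommGroup V] [Module O V] [AddCommGroup W] [Module O W]

/-- The Leibniz action of a vector field on a tensor product over `O`:
`θ (v ⊗ w) = θ v ⊗ w + v ⊗ θ w`. -/
def tensorNabla (c : FlatConnection k O V) (d : FlatConnection k O W) (θ : Derivation k O O) :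
    V ⊗[O] W →+ V ⊗[O] W :=
  TensorProduct.liftAddHom
    (AddMonoidHom.mk' (fun v => AddMonoidHom.mk' (fun w => c.nabla θ v ⊗ₜ[O] w + v ⊗ₜ d.nabla θ w)
        (fun w w' => by simp only [map_add, tmul_add]; abel))
      (fun v v' => by
        ext w
        simp only [AddMonoidHom.mk'_apply, AddMonoidHom.add_apply, map_add, add_tmul]
        abel))
    (fun a v w => by
      simp only [AddMonoidHom.mk'_apply, c.leibniz, d.leibniz, add_tmul, tmul_add, smul_tmul]
      abel)

theorem tensorNabla_tmul (c : FlatConnection k O V) (d : FlatConnection k O W)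
    (θ : Derivation k O O) (v : V) (w : W) :
    tensorNabla c d θ (v ⊗ₜ w) = c.nabla θ v ⊗ₜ[O] w + v ⊗ₜ d.nabla θ w := rfl

/-- The tensor product over `O` of two flat connections. -/
def tensor (c : FlatConnection k O V) (d : FlatConnection k O W) :
    FlatConnection k O (V ⊗[O] W) where
  nabla := tensorNabla c d
  nabla_add θ η x := by
    induction x with
    | zero => simp
    | tmul v w =>
      simp only [tensorNabla_tmul, nabla_add, add_tmul, tmul_add]
      abel
    | add x y hx hy =>
      simp only [map_add, hx, hy]
      abel
  nabla_smul a θ x := by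
    induction x with
    | zero => simp
    | tmul v w => simp only [tensorNabla_tmul, nabla_smul, smul_add, smul_tmul', tmul_smul]
    | add x y hx hy => simp only [map_add, hx, hy, smul_add]
  leibniz θ a x := by
    induction x with
    | zero => simp
    | tmul v w =>
      simp only [smul_tmul', tensorNabla_tmul, leibniz, add_tmul, smul_add, add_assoc]
    | add x y hx hy =>
      simp only [map_add, hx, hy, smul_add]
      abel
  nabla_lie θ η x := by
    induction x with
    | zero => simp
    | tmul v w =>
      simp only [tensorNabla_tmul, nabla_lie, sub_tmul, tmul_sub, map_add]
      abel
    | add x y hx hy =>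
      simp only [map_add, hx, hy]
      abel

end FlatConnection

section Category

variable (k : Type v) (O : Type u) [Field k] [CommRing O] [Algebra k O]

/-- The category of (left) modules over the ring `D` of differential operators. -/
abbrev DModCat := ModuleCat.{u} (DiffOp k O)

/-- The underlying `O`-module of a `D`-module. -/
abbrev toO : DModCat k O ⥤ ModuleCat.{u} O := ModuleCat.restrictScalars (ofFun k O)

variable {k O}

/-- The flat connection underlying a `D`-module: vector fields are elements of `D`. -/
def conn (M : DModCat k O) : FlatConnection k O ((toO k O).obj M) where
  nabla θ := DistribSMul.toAddMonoidHom M (ofDer θ)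
  nabla_add θ η (m : M) := by
    change ofDer (θ + η) • m = ofDer θ • m + ofDer η • m
    rw [ofDer_add, add_smul]
  nabla_smul a θ (m : M) := by
    change ofDer (a • θ) • m = ofFun k O a • ofDer θ • m
    rw [ofDer_smul, mul_smul]
  leibniz θ a (m : M) := by
    change ofDer θ • ofFun k O a • m = ofFun k O (θ a) • m + ofFun k O a • ofDer θ • m
    rw [← mul_smul, ofDer_mul_ofFun, add_smul, mul_smul, add_comm]
  nabla_lie θ η (m : M) := by
    change ofDer ⁅θ, η⁆ • m = ofDer θ • ofDer η • m - ofDer η • ofDer θ • m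
    rw [ofDer_lie, sub_smul, mul_smul, mul_smul]

variable [CharZero k] [Algebra.Smooth k O]

/-- An `O`-linear map between `D`-modules that commutes with vector fields is `D`-linear. -/
def homMk {M N : DModCat k O} (f : (toO k O).obj M ⟶ (toO k O).obj N)
    (hf : ∀ θ m, f ((conn M).nabla θ m) = (conn N).nabla θ (f m)) : M ⟶ N :=
  ModuleCat.ofHom
    { toFun := fun m : M => (f m : N)
      map_add' := fun m m' => f.hom.map_add m m'
      map_smul' := fun P => by
        refine diffOp_induction k O (motive := fun P => ∀ m : M, (f (P • m : M) : N) =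
          P • (f m : N)) (fun a m => f.hom.map_smul a m) (fun θ m => hf θ m) ?_ ?_ P
        · intro P Q hP hQ m
          rw [add_smul, add_smul, ← hP, ← hQ]
          exact f.hom.map_add _ _
        · intro P Q hP hQ m
          rw [mul_smul, mul_smul, hP, hQ] }

theorem toO_map_homMk {M N : DModCat k O} (f : (toO k O).obj M ⟶ (toO k O).obj N)
    (hf : ∀ θ m, f ((conn M).nabla θ m) = (conn N).nabla θ (f m)) :
    (toO k O).map (homMk f hf) = f := rfl

/-- An `O`-linear isomorphism between `D`-modules that commutes with vector fields
is an isomorphism of `D`-modules. -/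
def isoMk {M N : DModCat k O} (e : (toO k O).obj M ≅ (toO k O).obj N)
    (he : ∀ θ m, e.hom ((conn M).nabla θ m) = (conn N).nabla θ (e.hom m)) : M ≅ N where
  hom := homMk e.hom he
  inv := homMk e.inv fun θ n => by
    have := he θ (e.inv n)
    have h1 : e.hom (e.inv n) = n := by simp
    rw [h1] at this
    rw [← this]
    simp
  hom_inv_id := (toO k O).map_injective (by
    rw [Functor.map_comp, toO_map_homMk, toO_map_homMk, e.hom_inv_id, CategoryTheory.Functor.map_id])
  inv_hom_id := (toO k O).map_injective (by
    rw [Functor.map_comp, toO_map_homMk, toO_map_homMk, e.inv_hom_id, CategoryTheory.Functor.map_id])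

/-- The carrier of the tensor product of `D`-modules: the tensor product over `O`. -/
def TensorCarrier (M N : DModCat k O) : Type u := (toO k O).obj M ⊗[O] (toO k O).obj N

instance (M N : DModCat k O) : AddCommGroup (TensorCarrier M N) :=
  inferInstanceAs (AddCommGroup ((toO k O).obj M ⊗[O] (toO k O).obj N))

/-- `D` acts on `M ⊗_O N`: functions act by scalar multiplication
and vector fields act by the Leibniz rule. -/
@[reducible]
def tensorModule (M N : DModCat k O) :
    Module (DiffOp k O) ((toO k O).obj M ⊗[O] (toO k O).obj N) :=
  Module.compHom _ ((conn M).tensor (conn N)).act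

instance (M N : DModCat k O) : Module (DiffOp k O) (TensorCarrier M N) := tensorModule M N

/-- The tensor product over `O` of two `D`-modules. -/
def tensorDMod (M N : DModCat k O) : DModCat k O := ModuleCat.of _ (TensorCarrier M N)

/-- The `O`-module underlying the tensor product of `D`-modules is the tensor product of the
underlying `O`-modules. -/
def muEquiv (M N : DModCat k O) :
    ((toO k O).obj M ⊗[O] (toO k O).obj N) ≃ₗ[O] (toO k O).obj (tensorDMod M N) where
  toFun x := x
  invFun x := x
  left_inv _ := rfl
  right_inv _ := rfl
  map_add' _ _ := rfl
  map_smul' a x := (((conn M).tensor (conn N)).act_ofFun a x).symm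

/-- The isomorphism of `O`-modules `muEquiv`. -/
def muIso (M N : DModCat k O) :
    MonoidalCategoryStruct.tensorObj ((toO k O).obj M) ((toO k O).obj N) ≅
      (toO k O).obj (tensorDMod M N) :=
  (muEquiv M N).toModuleIso

/-- The `D`-module `O`, with the tautological action of differential operators. -/
def unitDMod : DModCat k O := ModuleCat.of _ O

/-- The `O`-module underlying the `D`-module `O` is `O`. -/
def epsEquiv : O ≃ₗ[O] (toO k O).obj (unitDMod (k := k) (O := O)) where
  toFun x := x
  invFun x := x
  left_inv _ := rfl
  right_inv _ := rfl
  map_add' _ _ := rfl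
  map_smul' _ _ := rfl

/-- The isomorphism of `O`-modules `epsEquiv`. -/
def epsIso : 𝟙_ (ModuleCat.{u} O) ≅ (toO k O).obj (unitDMod (k := k) (O := O)) :=
  epsEquiv.toModuleIso

theorem muIso_tmul_nabla (M N : DModCat k O) (θ : Derivation k O O) (m : (toO k O).obj M)
    (n : (toO k O).obj N) :
    (conn (tensorDMod M N)).nabla θ ((muIso M N).hom (m ⊗ₜ[O] n)) =
      (muIso M N).hom ((conn M).nabla θ m ⊗ₜ[O] n) +
        (muIso M N).hom (m ⊗ₜ[O] (conn N).nabla θ n) :=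
  ((conn M).tensor (conn N)).act_ofDer θ (m ⊗ₜ[O] n)

end Category

section Monoidal

variable {k : Type v} {O : Type u} [Field k] [CommRing O] [Algebra k O]

theorem conn_map {M N : DModCat k O} (f : M ⟶ N) (θ : Derivation k O O) (m : (toO k O).obj M) :
    (toO k O).map f ((conn M).nabla θ m) = (conn N).nabla θ ((toO k O).map f m) :=
  f.hom.map_smul (ofDer θ) m

variable [CharZero k] [Algebra.Smooth k O]

theorem muIso_induction {M N : DModCat k O} {motive : (toO k O).obj (tensorDMod M N) → Prop}
    (h : ∀ m n, motive ((muIso M N).hom (m ⊗ₜ[O] n)))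
    (hadd : ∀ x y, motive x → motive y → motive (x + y)) (x) : motive x := by
  have key : ∀ y : (toO k O).obj M ⊗[O] (toO k O).obj N, motive ((muIso M N).hom y) := by
    intro y
    induction y with
    | zero =>
      have := h 0 0
      rwa [zero_tmul] at this
    | tmul m n => exact h m n
    | add x y hx hy =>
      have := hadd _ _ hx hy
      rwa [← map_add] at this
  exact key ((muIso M N).inv x)

/-- The tensor product of morphisms of `D`-modules. -/
def tensorHomDMod {M N M' N' : DModCat k O} (f : M ⟶ N) (g : M' ⟶ N') :
    tensorDMod M M' ⟶ tensorDMod N N' :=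
  homMk ((muIso M M').inv ≫ MonoidalCategoryStruct.tensorHom ((toO k O).map f) ((toO k O).map g) ≫
      (muIso N N').hom) (fun θ x => by
    induction x using muIso_induction with
    | h m n =>
      rw [muIso_tmul_nabla]
      change (muIso N N').hom ((toO k O).map f ((conn M).nabla θ m) ⊗ₜ[O] (toO k O).map g n) +
        (muIso N N').hom ((toO k O).map f m ⊗ₜ[O] (toO k O).map g ((conn M').nabla θ n)) =
        (conn _).nabla θ ((muIso N N').hom ((toO k O).map f m ⊗ₜ[O] (toO k O).map g n))
      rw [muIso_tmul_nabla, conn_map, conn_map]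
    | hadd x y hx hy => simp only [map_add, hx, hy])

theorem toO_map_tensorHomDMod {M N M' N' : DModCat k O} (f : M ⟶ N) (g : M' ⟶ N') :
    (toO k O).map (tensorHomDMod f g) = (muIso M M').inv ≫
      MonoidalCategoryStruct.tensorHom ((toO k O).map f) ((toO k O).map g) ≫ (muIso N N').hom :=
  rfl

/-- The associativity isomorphism `(M ⊗ N) ⊗ P ≅ M ⊗ (N ⊗ P)`. -/
def assocDMod (M N P : DModCat k O) :
    tensorDMod (tensorDMod M N) P ≅ tensorDMod M (tensorDMod N P) :=
  isoMk (((muIso _ _).symm ≪≫ ((muIso _ _).symm ⊗ᵢ .refl _))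
        ≪≫ α_ ((toO k O).obj M) ((toO k O).obj N) ((toO k O).obj P)
        ≪≫ ((.refl _ ⊗ᵢ muIso _ _) ≪≫ muIso _ _)) (fun θ x => by
    induction x using muIso_induction with
    | h y p =>
      induction y using muIso_induction with
      | h m n =>
        rw [muIso_tmul_nabla, muIso_tmul_nabla, add_tmul, map_add, map_add, map_add]
        change (muIso _ _).hom ((conn M).nabla θ m ⊗ₜ[O] (muIso _ _).hom (n ⊗ₜ[O] p)) +
          (muIso _ _).hom (m ⊗ₜ[O] (muIso _ _).hom ((conn N).nabla θ n ⊗ₜ[O] p)) +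
          (muIso _ _).hom (m ⊗ₜ[O] (muIso _ _).hom (n ⊗ₜ[O] (conn P).nabla θ p)) =
          (conn _).nabla θ ((muIso M (tensorDMod N P)).hom (m ⊗ₜ[O] (muIso N P).hom (n ⊗ₜ[O] p)))
        rw [muIso_tmul_nabla, muIso_tmul_nabla, tmul_add, map_add, add_assoc]
      | hadd x y hx hy => simp only [add_tmul, map_add, hx, hy]
    | hadd x y hx hy => simp only [map_add, hx, hy])

/-- The left unit isomorphism `O ⊗ M ≅ M`. -/
def leftUnitorDMod (M : DModCat k O) : tensorDMod unitDMod M ≅ M :=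
  isoMk (((muIso _ _).symm ≪≫ (epsIso.symm ⊗ᵢ .refl _)) ≪≫ λ_ ((toO k O).obj M)) (fun θ x => by
    induction x using muIso_induction with
    | h a m =>
      rw [muIso_tmul_nabla, map_add]
      exact ((conn M).leibniz θ a m).symm
    | hadd x y hx hy => simp only [map_add, hx, hy])

/-- The right unit isomorphism `M ⊗ O ≅ M`. -/
def rightUnitorDMod (M : DModCat k O) : tensorDMod M unitDMod ≅ M :=
  isoMk (((muIso _ _).symm ≪≫ (.refl _ ⊗ᵢ epsIso.symm)) ≪≫ ρ_ ((toO k O).obj M)) (fun θ x => by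
    induction x using muIso_induction with
    | h m a =>
      rw [muIso_tmul_nabla, map_add, add_comm]
      exact ((conn M).leibniz θ a m).symm
    | hadd x y hx hy => simp only [map_add, hx, hy])

/-- The symmetry `M ⊗ N ≅ N ⊗ M`. -/
def braidingDMod (M N : DModCat k O) : tensorDMod M N ≅ tensorDMod N M :=
  isoMk ((muIso _ _).symm ≪≫ β_ ((toO k O).obj M) ((toO k O).obj N) ≪≫ muIso _ _) (fun θ x => by
    induction x using muIso_induction with
    | h m n =>
      rw [muIso_tmul_nabla, map_add, add_comm]
      exact (muIso_tmul_nabla N M θ n m).symm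
    | hadd x y hx hy => simp only [map_add, hx, hy])

instance : MonoidalCategoryStruct (DModCat k O) where
  tensorObj := tensorDMod
  whiskerLeft M _ _ f := tensorHomDMod (𝟙 M) f
  whiskerRight f N := tensorHomDMod f (𝟙 N)
  tensorHom f g := tensorHomDMod f g
  tensorUnit := unitDMod
  associator := assocDMod
  leftUnitor := leftUnitorDMod
  rightUnitor := rightUnitorDMod

/-- The forgetful functor to `O`-modules is compatible with tensor products. -/
def inducingData : Monoidal.InducingFunctorData (toO k O) where
  μIso := muIso
  whiskerLeft_eq M _ _ f := (toO_map_tensorHomDMod (𝟙 M) f).trans (by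
    rw [CategoryTheory.Functor.map_id, id_tensorHom])
  whiskerRight_eq f N := (toO_map_tensorHomDMod f (𝟙 N)).trans (by
    rw [CategoryTheory.Functor.map_id, tensorHom_id])
  tensorHom_eq _ _ := rfl
  εIso := epsIso
  associator_eq _ _ _ := rfl
  leftUnitor_eq _ := rfl
  rightUnitor_eq _ := rfl

/-- The monoidal category `(DM, ⊗_O, O)`. -/
instance : MonoidalCategory (DModCat k O) := Monoidal.induced (toO k O) inducingData

instance : (toO k O).Monoidal := Monoidal.fromInducedMonoidal (toO k O) inducingData

instance : BraidedCategory (DModCat k O) :=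
  BraidedCategory.ofFaithful (toO k O) braidingDMod (fun M N => by
    change (muIso M N).hom ≫ (muIso M N).inv ≫ (β_ _ _).hom ≫ (muIso N M).hom =
      (β_ _ _).hom ≫ (muIso N M).hom
    rw [Iso.hom_inv_id_assoc])

instance : SymmetricCategory (DModCat k O) where
  symmetry M N := (toO k O).map_injective (by
    rw [Functor.map_comp, CategoryTheory.Functor.map_id]
    change ((muIso M N).inv ≫ (β_ _ _).hom ≫ (muIso N M).hom) ≫
      (muIso N M).inv ≫ (β_ _ _).hom ≫ (muIso M N).hom = 𝟙 _
    simp)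

instance : MonoidalPreadditive (DModCat k O) :=
  monoidalPreadditive_of_faithful (toO k O)


end Monoidal

section Koszul

variable {C : Type u} [Category.{v} C] [MonoidalCategory C] [Preadditive C]
  [MonoidalPreadditive C] [HasZeroObject C] [HasFiniteCoproducts C] [SymmetricCategory C]

open GradedObject.Monoidal

/-- The Koszul sign `(-1) ^ (p q)`. -/
def sgn (p q : ℕ) : ℤˣ := (-1) ^ (p * q)

theorem sgn_symm (p q : ℕ) : sgn q p = sgn p q := by rw [sgn, sgn, mul_comm]

theorem sgn_mul_self (p q : ℕ) : sgn p q * sgn p q = 1 := Int.units_mul_self _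

theorem sgn_add_right (p q r : ℕ) : sgn p (q + r) = sgn p q * sgn p r := by
  rw [sgn, mul_add, pow_add]; rfl

theorem sgn_add_left (p q r : ℕ) : sgn (p + q) r = sgn p r * sgn q r := by
  rw [sgn, add_mul, pow_add]; rfl

variable (X Y Z : GradedObject ℕ C)

/-- The symmetry of the tensor product of graded objects, with the Koszul sign. -/
def gradedBraidingHom : GradedObject.Monoidal.tensorObj X Y ⟶ GradedObject.Monoidal.tensorObj Y X :=
  fun n => tensorObjDesc (fun p q h => sgn p q • ((β_ (X p) (Y q)).hom ≫
    ιTensorObj Y X q p n ((add_comm q p).trans h)))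

theorem ι_gradedBraidingHom (p q n : ℕ) (h : p + q = n) :
    ιTensorObj X Y p q n h ≫ gradedBraidingHom X Y n = sgn p q • ((β_ (X p) (Y q)).hom ≫
    ιTensorObj Y X q p n ((add_comm q p).trans h)) :=
  ι_tensorObjDesc _ _ _ _

theorem gradedBraidingHom_symm : gradedBraidingHom X Y ≫ gradedBraidingHom Y X = 𝟙 _ := by
  funext n
  refine tensorObj_ext _ _ (fun p q h => ?_)
  change _ ≫ gradedBraidingHom X Y n ≫ gradedBraidingHom Y X n = _ ≫ 𝟙 _
  rw [← Category.assoc, ι_gradedBraidingHom, Linear.units_smul_comp, Category.assoc,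
    ι_gradedBraidingHom, Linear.comp_units_smul, smul_smul, sgn_symm, sgn_mul_self, one_smul,
    SymmetricCategory.symmetry_assoc]
  exact (Category.comp_id _).symm

theorem gradedBraiding_naturality {X X' Y Y' : GradedObject ℕ C} (f : X ⟶ X') (g : Y ⟶ Y') :
    GradedObject.Monoidal.tensorHom f g ≫ gradedBraidingHom X' Y' =
      gradedBraidingHom X Y ≫ GradedObject.Monoidal.tensorHom g f := by
  funext n
  refine tensorObj_ext _ _ (fun p q h => ?_)
  change _ ≫ GradedObject.Monoidal.tensorHom f g n ≫ gradedBraidingHom X' Y' n = 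
    _ ≫ gradedBraidingHom X Y n ≫ GradedObject.Monoidal.tensorHom g f n
  rw [ι_tensorHom_assoc, ι_gradedBraidingHom, ← Category.assoc (ιTensorObj X Y p q n h),
    ι_gradedBraidingHom, Linear.comp_units_smul, Linear.units_smul_comp, Category.assoc,
    ι_tensorHom, BraidedCategory.braiding_naturality_assoc]

theorem ι_gradedBraidingHom_assoc (p q n : ℕ) (h : p + q = n) {W : C}
    (f : GradedObject.Monoidal.tensorObj Y X n ⟶ W) :
    ιTensorObj X Y p q n h ≫ gradedBraidingHom X Y n ≫ f = sgn p q • ((β_ (X p) (Y q)).hom ≫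
    ιTensorObj Y X q p n ((add_comm q p).trans h) ≫ f) := by
  rw [← Category.assoc, ι_gradedBraidingHom, Linear.units_smul_comp, Category.assoc]

theorem whiskerLeft_units_smul (A : C) {B B' : C} (s : ℤˣ) (f : B ⟶ B') :
    A ◁ (s • f) = s • (A ◁ f) :=
  (tensorLeft A).map_units_smul s f

theorem units_smul_whiskerRight (A : C) {B B' : C} (s : ℤˣ) (f : B ⟶ B') :
    (s • f) ▷ A = s • (f ▷ A) :=
  (tensorRight A).map_units_smul s f

theorem ι_whiskerRight_gradedBraidingHom (p q r n m : ℕ) (h : m + r = n) (h' : p + q = m) {W : C}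
    (F : GradedObject.Monoidal.tensorObj (GradedObject.Monoidal.tensorObj Y X) Z n ⟶ W) :
    ιTensorObj X Y p q m h' ▷ Z r ≫ 
    ιTensorObj (GradedObject.Monoidal.tensorObj X Y) Z m r n h ≫
      GradedObject.Monoidal.whiskerRight (gradedBraidingHom X Y) Z n ≫ F =
    sgn p q • ((β_ (X p) (Y q)).hom ▷ Z r ≫ ιTensorObj Y X q p m ((add_comm q p).trans h') ▷ Z r ≫
     ιTensorObj (GradedObject.Monoidal.tensorObj Y X) Z m r n h ≫ F) := by
  have h1 := ι_tensorHom (gradedBraidingHom X Y) (𝟙 Z) m r n h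
  rw [← Category.assoc (ιTensorObj (GradedObject.Monoidal.tensorObj X Y) Z m r n h)]
  erw [h1]
  rw [Category.assoc, ← tensorHom_id, MonoidalCategory.tensorHom_comp_tensorHom_assoc, ι_gradedBraidingHom,
    GradedObject.categoryOfGradedObjects_id, Category.comp_id, tensorHom_id,
    units_smul_whiskerRight, Linear.units_smul_comp, comp_whiskerRight, Category.assoc]

theorem ι_whiskerLeft_gradedBraidingHom (p q r n m : ℕ) (h : r + m = n) (h' : p + q = m) :
    Z r ◁ ιTensorObj X Y p q m h' ≫ 
    ιTensorObj Z (GradedObject.Monoidal.tensorObj X Y) r m n h ≫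
      GradedObject.Monoidal.whiskerLeft Z (gradedBraidingHom X Y) n =
    sgn p q • (Z r ◁ (β_ (X p) (Y q)).hom ≫ Z r ◁ ιTensorObj Y X q p m ((add_comm q p).trans h') ≫
     ιTensorObj Z (GradedObject.Monoidal.tensorObj Y X) r m n h) := by
  have h1 := ι_tensorHom (𝟙 Z) (gradedBraidingHom X Y) r m n h
  erw [h1]
  rw [← id_tensorHom, MonoidalCategory.tensorHom_comp_tensorHom_assoc, ι_gradedBraidingHom,
    GradedObject.categoryOfGradedObjects_id, Category.comp_id, id_tensorHom,
    whiskerLeft_units_smul, Linear.units_smul_comp, MonoidalCategory.whiskerLeft_comp,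
    Category.assoc]

theorem gradedBraiding_hexagon :
    (GradedObject.Monoidal.associator X Y Z).hom ≫
      gradedBraidingHom X (GradedObject.Monoidal.tensorObj Y Z) ≫
        (GradedObject.Monoidal.associator Y Z X).hom =
      GradedObject.Monoidal.whiskerRight (gradedBraidingHom X Y) Z ≫
        (GradedObject.Monoidal.associator Y X Z).hom ≫
        GradedObject.Monoidal.whiskerLeft Y (gradedBraidingHom X Z) := by
  funext n
  refine tensorObj₃'_ext _ _ (fun i₁ i₂ i₃ h => ?_)
  change _ ≫ (GradedObject.Monoidal.associator X Y Z).hom n ≫ gradedBraidingHom X _ n ≫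
        (GradedObject.Monoidal.associator Y Z X).hom n =
      _ ≫ GradedObject.Monoidal.whiskerRight (gradedBraidingHom X Y) Z n ≫
        (GradedObject.Monoidal.associator Y X Z).hom n ≫
        GradedObject.Monoidal.whiskerLeft Y (gradedBraidingHom X Z) n
  rw [ιTensorObj₃'_associator_hom_assoc, ιTensorObj₃_eq X Y Z i₁ i₂ i₃ n h _ rfl,
    Category.assoc, ι_gradedBraidingHom_assoc, Linear.comp_units_smul, Linear.comp_units_smul,
    ← id_tensorHom,
    BraidedCategory.braiding_naturality_assoc,
    BraidedCategory.braiding_tensor_right_hom, Category.assoc, Category.assoc, Category.assoc,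
    Category.assoc, Iso.hom_inv_id_assoc, tensorHom_id,
    ← ιTensorObj₃'_eq_assoc Y Z X i₂ i₃ i₁ n (by rw [add_comm _ i₁, ← add_assoc, h]) _ rfl,
    ιTensorObj₃'_associator_hom, Iso.inv_hom_id_assoc, sgn_add_right]
  rw [ιTensorObj₃'_eq X Y Z i₁ i₂ i₃ n h _ rfl, Category.assoc, ι_whiskerRight_gradedBraidingHom,
    ← ιTensorObj₃'_eq_assoc Y X Z i₂ i₁ i₃ n
      (by rw [add_comm i₂ i₁, h]) (i₁ + i₂) (add_comm i₂ i₁),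
    ιTensorObj₃'_associator_hom_assoc,
    ιTensorObj₃_eq Y X Z i₂ i₁ i₃ n (by rw [add_comm i₂ i₁, h]) _ rfl, Category.assoc,
    ι_whiskerLeft_gradedBraidingHom, Linear.comp_units_smul, Linear.comp_units_smul, smul_smul,
    ← ιTensorObj₃_eq Y Z X i₂ i₃ i₁ n (by rw [add_comm _ i₁, ← add_assoc, h])
      (i₁ + i₃) (add_comm _ _)]

end Koszul

section KoszulComplex

variable {C : Type u} [Category.{v} C] [MonoidalCategory C] [Preadditive C]
  [MonoidalPreadditive C] [HasZeroObject C] [HasFiniteCoproducts C] [SymmetricCategory C]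

theorem sgn_succ_left (p q : ℕ) : sgn (p + 1) q = sgn p q * (-1) ^ q := by
  rw [sgn_add_left]; simp [sgn]

theorem sgn_succ_right (p q : ℕ) : sgn p (q + 1) = sgn p q * (-1) ^ p := by
  rw [sgn_add_right]; simp [sgn]

/-- The components of the symmetry of the tensor product of chain complexes. -/
def koszulX (K L : ChainComplex C ℕ) (n : ℕ) :
    (HomologicalComplex.tensorObj K L).X n ⟶ (HomologicalComplex.tensorObj L K).X n :=
  HomologicalComplex.mapBifunctorDesc (fun p q h => sgn p q • ((β_ (K.X p) (L.X q)).hom ≫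
    HomologicalComplex.ιTensorObj L K q p n ((add_comm q p).trans h)))

theorem koszulX_eq (K L : ChainComplex C ℕ) (n : ℕ) :
    koszulX K L n = gradedBraidingHom K.X L.X n := rfl

theorem ι_koszulX (K L : ChainComplex C ℕ) (p q n : ℕ) (h : p + q = n) :
    HomologicalComplex.ιTensorObj K L p q n h ≫ koszulX K L n
      = sgn p q • ((β_ (K.X p) (L.X q)).hom ≫
        HomologicalComplex.ιTensorObj L K q p n ((add_comm q p).trans h)) :=
  HomologicalComplex.ι_mapBifunctorDesc _ _ _ _

theorem koszul_d₁ (K L : ChainComplex C ℕ) (p q n : ℕ) (h : p + q = n + 1) :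
    HomologicalComplex.mapBifunctor.d₁ K L (curriedTensor C) (.down ℕ) p q n ≫ koszulX K L n =
      sgn p q • ((β_ (K.X p) (L.X q)).hom ≫
        HomologicalComplex.mapBifunctor.d₂ L K (curriedTensor C) (.down ℕ) q p n) := by
  cases p with
  | zero =>
    rw [HomologicalComplex.mapBifunctor.d₁_eq_zero, HomologicalComplex.mapBifunctor.d₂_eq_zero,
      zero_comp, comp_zero, smul_zero] <;> simp
  | succ p =>
    have h' : p + q = n := by omega
    rw [HomologicalComplex.mapBifunctor.d₁_eq K L (curriedTensor C) (.down ℕ)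
        (show (ComplexShape.down ℕ).Rel (p + 1) p from rfl) q n h',
      HomologicalComplex.mapBifunctor.d₂_eq L K (curriedTensor C) (.down ℕ) q
        (show (ComplexShape.down ℕ).Rel (p + 1) p from rfl) n ((add_comm q p).trans h')]
    change ((1 : ℤˣ) • (K.d (p + 1) p ▷ L.X q ≫ HomologicalComplex.ιTensorObj K L p q n h')) ≫ _ =
      sgn (p + 1) q • (_ ≫ ((-1 : ℤˣ) ^ q • (L.X q ◁ K.d (p + 1) p ≫
        HomologicalComplex.ιTensorObj L K q p n ((add_comm q p).trans h'))))
    rw [one_smul, Category.assoc, ι_koszulX, Linear.comp_units_smul, Linear.comp_units_smul,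
      smul_smul, sgn_succ_left, mul_assoc, Int.units_mul_self, mul_one,
      BraidedCategory.braiding_naturality_left_assoc]

theorem koszul_d₂ (K L : ChainComplex C ℕ) (p q n : ℕ) (h : p + q = n + 1) :
    HomologicalComplex.mapBifunctor.d₂ K L (curriedTensor C) (.down ℕ) p q n ≫ koszulX K L n =
      sgn p q • ((β_ (K.X p) (L.X q)).hom ≫
        HomologicalComplex.mapBifunctor.d₁ L K (curriedTensor C) (.down ℕ) q p n) := by
  cases q with
  | zero =>
    rw [HomologicalComplex.mapBifunctor.d₁_eq_zero, HomologicalComplex.mapBifunctor.d₂_eq_zero,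
      zero_comp, comp_zero, smul_zero] <;> simp
  | succ q =>
    have h' : p + q = n := by omega
    rw [HomologicalComplex.mapBifunctor.d₂_eq K L (curriedTensor C) (.down ℕ) p
        (show (ComplexShape.down ℕ).Rel (q + 1) q from rfl) n h',
      HomologicalComplex.mapBifunctor.d₁_eq L K (curriedTensor C) (.down ℕ)
        (show (ComplexShape.down ℕ).Rel (q + 1) q from rfl) p n ((add_comm q p).trans h')]
    change ((-1 : ℤˣ) ^ p • (K.X p ◁ L.d (q + 1) q ≫
        HomologicalComplex.ιTensorObj K L p q n h')) ≫ _ =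
      sgn p (q + 1) • (_ ≫ ((1 : ℤˣ) • (L.d (q + 1) q ▷ K.X p ≫
        HomologicalComplex.ιTensorObj L K q p n ((add_comm q p).trans h'))))
    rw [one_smul, Linear.units_smul_comp, Category.assoc, ι_koszulX, Linear.comp_units_smul,
      smul_smul, sgn_succ_right, mul_comm,
      BraidedCategory.braiding_naturality_right_assoc]

/-- The symmetry of the tensor product of chain complexes, given by the Koszul sign rule
`x ⊗ y ↦ (-1) ^ (p q) y ⊗ x` for `x` in degree `p` and `y` in degree `q`. -/
def koszulHom (K L : ChainComplex C ℕ) :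
    HomologicalComplex.tensorObj K L ⟶ HomologicalComplex.tensorObj L K where
  f n := koszulX K L n
  comm' := by
    rintro _ n rfl
    refine HomologicalComplex.mapBifunctor.hom_ext (fun p q h => ?_)
    have h' : p + q = n + 1 := h
    rw [HomologicalComplex.mapBifunctor.d_eq, HomologicalComplex.mapBifunctor.d_eq,
      Preadditive.add_comp, Preadditive.comp_add, Preadditive.comp_add, Preadditive.comp_add,
      HomologicalComplex.mapBifunctor.ι_D₁_assoc, HomologicalComplex.mapBifunctor.ι_D₂_assoc,
      koszul_d₁ K L p q n h', koszul_d₂ K L p q n h', ← Category.assoc, ← Category.assoc]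
    have e := ι_koszulX K L p q (n + 1) h'
    dsimp only [HomologicalComplex.ιTensorObj] at e
    rw [e, Linear.units_smul_comp, Linear.units_smul_comp, Category.assoc, Category.assoc,
      HomologicalComplex.mapBifunctor.ι_D₁, HomologicalComplex.mapBifunctor.ι_D₂, add_comm]

theorem koszulHom_symm (K L : ChainComplex C ℕ) : koszulHom K L ≫ koszulHom L K = 𝟙 _ := by
  ext n : 1
  exact congr_fun (gradedBraidingHom_symm K.X L.X) n

/-- The symmetry isomorphism of the tensor product of chain complexes. -/
def koszulIso (K L : ChainComplex C ℕ) :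
    HomologicalComplex.tensorObj K L ≅ HomologicalComplex.tensorObj L K where
  hom := koszulHom K L
  inv := koszulHom L K
  hom_inv_id := koszulHom_symm K L
  inv_hom_id := koszulHom_symm L K

theorem koszulHom_naturality {K K' L L' : ChainComplex C ℕ} (f : K ⟶ K') (g : L ⟶ L') :
    HomologicalComplex.tensorHom f g ≫ koszulHom K' L' =
      koszulHom K L ≫ HomologicalComplex.tensorHom g f := by
  ext n : 1
  exact congr_fun (gradedBraiding_naturality (X := K.X) (X' := K'.X) (Y := L.X) (Y' := L'.X)
    f.f g.f) n

theorem koszulHom_hexagon (K L M : ChainComplex C ℕ) :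
    (HomologicalComplex.associator K L M).hom ≫ koszulHom K (HomologicalComplex.tensorObj L M) ≫
      (HomologicalComplex.associator L M K).hom =
    HomologicalComplex.tensorHom (koszulHom K L) (𝟙 M) ≫
      (HomologicalComplex.associator L K M).hom ≫
        HomologicalComplex.tensorHom (𝟙 L) (koszulHom K M) := by
  ext n : 1
  exact congr_fun (gradedBraiding_hexagon K.X L.X M.X) n

/-- The tensor product of non-negatively graded chain complexes in an additive
monoidal category: `(K ⊗ L)_n = ⨁_{p + q = n} K_p ⊗ L_q` with differential
`d (x ⊗ y) = d x ⊗ y + (-1) ^ p x ⊗ d y`. -/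
abbrev chainMonoidal : MonoidalCategory (ChainComplex C ℕ) := inferInstance

/-- The symmetric monoidal category of non-negatively graded chain complexes in a symmetric
monoidal additive category. -/
abbrev chainSymmetric : SymmetricCategory (ChainComplex C ℕ) where
  braiding := koszulIso
  braiding_naturality_right K _ _ f := koszulHom_naturality (𝟙 K) f
  braiding_naturality_left f K := koszulHom_naturality f (𝟙 K)
  hexagon_forward := koszulHom_hexagon
  hexagon_reverse K L M := by
    have h := koszulHom_hexagon M K L
    change (α_ M K L).hom ≫ (koszulIso M (K ⊗ L)).hom ≫ (α_ K L M).hom =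
      (koszulIso M K).hom ▷ L ≫ (α_ K M L).hom ≫ K ◁ (koszulIso M L).hom at h
    change (α_ K L M).inv ≫ (koszulIso M (K ⊗ L)).inv ≫ (α_ M K L).inv =
      K ◁ (koszulIso M L).inv ≫ (α_ K M L).inv ≫ (koszulIso M K).inv ▷ L
    rw [← cancel_epi ((α_ M K L).hom ≫ (koszulIso M (K ⊗ L)).hom ≫ (α_ K L M).hom)]
    nth_rw 2 [h]
    simp
    rfl
  symmetry := koszulHom_symm

end KoszulComplex

section MonoidalModel

open HomotopicalAlgebra

/-- A model category (with all small limits and colimits and with functorial factorizations)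
which is also a symmetric monoidal category is a symmetric monoidal model category if the monoidal
structure is closed, if the tensor product is a Quillen bifunctor, and if tensoring a
cofibrant replacement of the unit with a cofibrant object gives a weak equivalence. -/
structure IsSymmetricMonoidalModelCategory (C : Type u) [Category.{v} C] [MonoidalCategory C]
    [SymmetricCategory C] [ModelCategory C] : Prop where
  hasLimits : HasLimits C
  hasColimits : HasColimits C
  functorialFactorization_cof_trivFib :
    (cofibrations C).HasFunctorialFactorization (trivialFibrations C)
  functorialFactorization_trivCof_fib :
    (trivialCofibrations C).HasFunctorialFactorization (fibrations C)
  closed : Nonempty (MonoidalClosed C)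
  /-- the pushout product of two cofibrations is a cofibration -/
  pushoutProduct_cofibration {T U V W : C} (f : T ⟶ U) (g : V ⟶ W)
    (hf : Cofibration f) (hg : Cofibration g) :
    Cofibration ((Arrow.pushoutProduct.obj (Arrow.mk f)).obj (Arrow.mk g)).hom
  /-- it is trivial if one of the two cofibrations is trivial -/
  pushoutProduct_weakEquivalence {T U V W : C} (f : T ⟶ U) (g : V ⟶ W)
    (hf : Cofibration f) (hg : Cofibration g) (h : WeakEquivalence f ∨ WeakEquivalence g) :
    WeakEquivalence ((Arrow.pushoutProduct.obj (Arrow.mk f)).obj (Arrow.mk g)).hom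
  /-- the unit axiom -/
  unit_weakEquivalence {Q : C} (q : Q ⟶ 𝟙_ C) (hQ : IsCofibrant Q)
    (hq : Fibration q) (hq' : WeakEquivalence q) (X : C) (hX : IsCofibrant X) :
    WeakEquivalence (q ▷ X)

end MonoidalModel

section DG

variable (k : Type v) (O : Type u) [Field k] [CommRing O] [Algebra k O]

/-- Non-negatively graded chain complexes of `D`-modules. -/
abbrev DGDM := ChainComplex (DModCat k O) ℕ

/-- The quasi-isomorphisms. -/
def quasiIsos : MorphismProperty (DGDM k O) := fun _ _ f => QuasiIso f

/-- The chain maps that are surjective in all positive degrees. -/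
def projFibrations : MorphismProperty (DGDM k O) := fun _ _ f => ∀ n, 0 < n → Epi (f.f n)

/-- The injective chain maps whose cokernel is projective over `D` in each degree. -/
def projCofibrations : MorphismProperty (DGDM k O) :=
  fun _ _ f => ∀ n, Mono (f.f n) ∧ Projective (cokernel (f.f n))

variable [CharZero k] [Algebra.Smooth k O]

instance : MonoidalCategory (DGDM k O) := chainMonoidal

instance : SymmetricCategory (DGDM k O) := chainSymmetric

end DG

end DMod

end

open CategoryTheory Limits MonoidalCategory HomotopicalAlgebra DMod

noncomputable section

/-! The model structure is the projective one and needs only a Grothendieck abelian category with a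
projective separator `G`. A map is a trivial fibration iff it solves every boundary-of-disk problem
with projective values, equivalently iff its degree-zero component and its matching maps `X_{n+1} ⟶
Y_{n+1} ×_{Y_n} Z_n(X)` lift all maps from projectives. Lifting against such maps can be done degree
by degree, and it amounts to lifting each component against epimorphisms, that is, to degreewise
injectivity with projective cokernel (`llp_fibs_inf_qis`). Adding contractible disks on projective
covers turns any map into a fibration, and the retract argument then identifies the maps lifting
against all fibrations (`llp_fibs`). Spheres and disks on `G` generate both classes, and the small
object argument gives the factorizations.

For the tensor product, a trivial cofibration is a retract of the inclusion of a summand with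
contractible complement, so it stays a quasi-isomorphism after tensoring with anything; the pushout
product is then treated by two-out-of-three. The pushout product is a cofibration because degreewise
it is governed by the tensor product of two projective cokernels. Closedness comes from preservation
of colimits. Tensoring with a degreewise flat complex preserves all quasi-isomorphisms by dimension
shifting (`quasiIso_whiskerRight`), which contains the unit axiom.

Two facts about `D` make this applicable. First, `D` is projective over `O`: the Euler identity,
with characteristic zero, splits each graded piece of the order filtration off finitely many copies
of the preceding one (`projective_grPiece_succ`). Hence projective `D`-modules are projective, thus
flat, over `O`. Second, the tensor product of projective `D`-modules `P` and `Q` is projective: maps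
from `P ⊗ Q` to `N` correspond to maps from `P` to the `D`-module of `O`-linear maps `Q → N`, and
this is exact in `N` for epimorphisms since `Q` is projective over `O`. -/

namespace DMod

set_option linter.unusedSectionVars false

/-! ### Lifting against epimorphisms in an abelian category -/

section DegreewiseLifting

open ZeroObject

variable {C : Type u} [Category.{v} C] [Abelian C]

/-- In an abelian category, a morphism has the left lifting property with respect to all
epimorphisms iff it is a monomorphism with projective cokernel. -/
theorem llp_epimorphisms_iff {A B : C} (i : A ⟶ B) :
    (MorphismProperty.epimorphisms C).llp i ↔ Mono i ∧ Projective (cokernel i) := by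
  constructor
  · intro h
    have hi : Mono i := by
      -- A lift of `𝟙 A` against `A ⟶ 0` is a retraction of `i`.
      have : Epi (0 : A ⟶ (0 : C)) := (isZero_zero C).epi _
      have := h (0 : A ⟶ (0 : C)) this
      have sq : CommSq (𝟙 A) i (0 : A ⟶ (0 : C)) 0 := ⟨by simp⟩
      exact mono_of_mono_fac sq.fac_left
    refine ⟨hi, ⟨fun {E X} f e he => ?_⟩⟩
    have := h e he
    -- With zero on top, the lift kills `A` and so descends to the cokernel.
    have sq : CommSq (0 : A ⟶ E) i e (cokernel.π i ≫ f) := ⟨by simp⟩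
    refine ⟨cokernel.desc i sq.lift sq.fac_left, ?_⟩
    rw [← cancel_epi (cokernel.π i), cokernel.π_desc_assoc, sq.fac_right]
  · rintro ⟨hi, hP⟩ X Y p (hp : Epi p)
    let S := ShortComplex.mk i (cokernel.π i) (cokernel.condition i)
    have hS : S.ShortExact := { exact := ShortComplex.exact_cokernel i }
    have : Projective S.X₃ := hP
    let σ := hS.splittingOfProjective
    have f_r : i ≫ σ.r = 𝟙 A := σ.f_r
    have hid : σ.r ≫ i + cokernel.π i ≫ σ.s = 𝟙 B := σ.id
    -- In the splitting of `B` into `A` and the cokernel, the lift is `t` on `A` and a lift of `b`,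
    -- found by projectivity, on the complement.
    refine ⟨fun {t b} sq => ⟨⟨⟨σ.r ≫ t + cokernel.π i ≫
      Projective.factorThru (P := cokernel i) (σ.s ≫ b) p, ?_, ?_⟩⟩⟩⟩
    · rw [Preadditive.comp_add, reassoc_of% f_r, cokernel.condition_assoc, zero_comp, add_zero]
    · rw [Preadditive.add_comp, Category.assoc, Category.assoc, Projective.factorThru_comp, sq.w,
        ← Category.assoc, ← Category.assoc, ← Preadditive.add_comp, hid, Category.id_comp]

/-- Maps from `G` that factor through `f` die in the cokernel, and `G` detects whether the
projection to the cokernel is zero. This reduces lifting tests on all projectives to tests on one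
separator. -/
theorem epi_of_forall_lift_of_isSeparator {G : C} (hG : IsSeparator G) {X Y : C} (f : X ⟶ Y)
    (h : ∀ y : G ⟶ Y, ∃ x, x ≫ f = y) : Epi f := by
  refine Preadditive.epi_of_cokernel_zero ?_
  refine hG.def _ _ fun y => ?_
  obtain ⟨x, rfl⟩ := h y
  simp

end DegreewiseLifting

/-! ### Contractible complexes made of disks -/

section Disks

variable {C : Type u} [Category.{v} C] [Abelian C]

/-- The sum over all `n` of the complexes `G n = G n` concentrated in degrees `n` and `n - 1`;
it is contractible if `G 0` vanishes. -/
def disks (G : ℕ → C) : ChainComplex C ℕ :=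
  ChainComplex.of (fun n => G (n + 1) ⊞ G n) (fun _ => biprod.snd ≫ biprod.inl) (fun _ => by simp)

namespace disks

variable (G G' : ℕ → C)

/-- The first projection. -/
def fst (n : ℕ) : (disks G).X n ⟶ G (n + 1) := (biprod.fst : G (n + 1) ⊞ G n ⟶ _)

/-- The second projection. -/
def snd (n : ℕ) : (disks G).X n ⟶ G n := (biprod.snd : G (n + 1) ⊞ G n ⟶ _)

/-- The first inclusion. -/
def inl (n : ℕ) : G (n + 1) ⟶ (disks G).X n := (biprod.inl : _ ⟶ G (n + 1) ⊞ G n)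

/-- The second inclusion. -/
def inr (n : ℕ) : G n ⟶ (disks G).X n := (biprod.inr : _ ⟶ G (n + 1) ⊞ G n)

theorem inl_fst (n : ℕ) : inl G n ≫ fst G n = 𝟙 _ := biprod.inl_fst
theorem inr_snd (n : ℕ) : inr G n ≫ snd G n = 𝟙 _ := biprod.inr_snd
theorem inl_snd (n : ℕ) : inl G n ≫ snd G n = 0 := biprod.inl_snd
theorem inr_fst (n : ℕ) : inr G n ≫ fst G n = 0 := biprod.inr_fst
theorem total (n : ℕ) : fst G n ≫ inl G n + snd G n ≫ inr G n = 𝟙 _ := biprod.total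

theorem d_eq (n : ℕ) : (disks G).d (n + 1) n = snd G (n + 1) ≫ inl G n :=
  ChainComplex.of_d (fun n => G (n + 1) ⊞ G n) (fun _ => biprod.snd ≫ biprod.inl) n

variable {G G'}

theorem hom_ext_to {A : C} {n : ℕ} {f g : A ⟶ (disks G).X n} (h : f ≫ fst G n = g ≫ fst G n)
    (h' : f ≫ snd G n = g ≫ snd G n) : f = g := biprod.hom_ext _ _ h h'

theorem hom_ext_from {A : C} {n : ℕ} {f g : (disks G).X n ⟶ A} (h : inl G n ≫ f = inl G n ≫ g)
    (hr : inr G n ≫ f = inr G n ≫ g) : f = g := biprod.hom_ext' _ _ h hr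

/-- The components of the contraction of `disks G`. -/
def contraction (i j : ℕ) (h : (ComplexShape.down ℕ).Rel j i) : (disks G).X i ⟶ (disks G).X j :=
  fst G i ≫ inr G (i + 1) ≫ eqToHom (congrArg (disks G).X h)

theorem contraction_succ (i : ℕ) (h : (ComplexShape.down ℕ).Rel (i + 1) i) :
    contraction (G := G) i (i + 1) h = fst G i ≫ inr G (i + 1) := by
  simp [contraction]

theorem nullHomotopicMap'_contraction (hG : IsZero (G 0)) :
    Homotopy.nullHomotopicMap' (contraction (G := G)) = 𝟙 (disks G) := by
  ext n
  rcases n with _ | n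
  · rw [Homotopy.nullHomotopicMap'_f_of_not_rel_left (k₁ := 1)
      (show (ComplexShape.down ℕ).Rel 1 0 from rfl) (by simp), contraction_succ 0, d_eq,
      Category.assoc, reassoc_of% inr_snd]
    -- In degree `0` only one term of the homotopy formula survives, the projection onto `G 1`; the
    -- identity is recovered because `G 0` vanishes.
    refine Eq.trans ?_ (total G 0)
    rw [hG.eq_of_tgt (snd G 0) 0, zero_comp, add_zero]
  · rw [Homotopy.nullHomotopicMap'_f (k₂ := n + 2) (k₀ := n)
      (show (ComplexShape.down ℕ).Rel (n + 2) (n + 1) from rfl)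
      (show (ComplexShape.down ℕ).Rel (n + 1) n from rfl), contraction_succ n, contraction_succ (n + 1),
      d_eq, d_eq, Category.assoc, Category.assoc, reassoc_of% inr_snd, reassoc_of% inl_fst]
    exact (add_comm _ _).trans (total G (n + 1))

/-- The contraction of `disks G`. -/
def homotopy (hG : IsZero (G 0)) : Homotopy (𝟙 (disks G)) 0 :=
  (Homotopy.ofEq (nullHomotopicMap'_contraction hG).symm).trans
    (Homotopy.nullHomotopy' contraction)

theorem acyclic (hG : IsZero (G 0)) : (disks G).Acyclic := fun n => by
  rw [HomologicalComplex.exactAt_iff_isZero_homology, IsZero.iff_id_eq_zero,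
    ← HomologicalComplex.homologyMap_id, (homotopy hG).homologyMap_eq,
    HomologicalComplex.homologyMap_zero]

/-- Functoriality of `disks`. -/
def map (g : ∀ n, G n ⟶ G' n) : disks G ⟶ disks G' where
  f n := biprod.map (g (n + 1)) (g n)
  comm' := by
    rintro _ n rfl
    rw [d_eq, d_eq]
    refine hom_ext_from ?_ ?_
    · change biprod.inl ≫ biprod.map _ _ ≫ biprod.snd ≫ biprod.inl =
        biprod.inl ≫ (biprod.snd ≫ biprod.inl) ≫ biprod.map _ _
      simp
    · change biprod.inr ≫ biprod.map _ _ ≫ biprod.snd ≫ biprod.inl =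
        biprod.inr ≫ (biprod.snd ≫ biprod.inl) ≫ biprod.map _ _
      simp

theorem map_f_fst (g : ∀ n, G n ⟶ G' n) (n : ℕ) :
    (map g).f n ≫ fst G' n = fst G n ≫ g (n + 1) := biprod.map_fst _ _

theorem epi_map_f (g : ∀ n, G n ⟶ G' n) (hg : ∀ n, Epi (g n)) (n : ℕ) : Epi ((map g).f n) :=
  inferInstanceAs (Epi (biprod.map (g (n + 1)) (g n)))

/-- The map to `disks G` given by a family of maps `X.X n ⟶ G (n + 1)`. -/
def lift {X : ChainComplex C ℕ} (φ : ∀ n, X.X n ⟶ G (n + 1)) : X ⟶ disks G where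
  f
  | 0 => φ 0 ≫ inl G 0
  | n + 1 => φ (n + 1) ≫ inl G (n + 1) + X.d (n + 1) n ≫ φ n ≫ inr G (n + 1)
  comm' := by
    rintro _ n rfl
    rcases n with _ | n
    · simp [d_eq, reassoc_of% inl_snd, reassoc_of% inr_snd]
    · simp [d_eq, reassoc_of% inl_snd, reassoc_of% inr_snd]

theorem lift_f_fst {X : ChainComplex C ℕ} (φ : ∀ n, X.X n ⟶ G (n + 1)) (n : ℕ) :
    (lift φ).f n ≫ fst G n = φ n := by
  rcases n with _ | n
  · simp [lift, inl_fst]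
  · simp [lift, inl_fst, inr_fst]

/-- Compatibility with `d` forces the second component in degree `n + 1` to be the first component
in degree `n` precomposed with the differential of `X`. Together with `lift`, this makes `disks G`
cofree on the first components when `G 0` vanishes. -/
theorem hom_ext {X : ChainComplex C ℕ} (hG : IsZero (G 0)) {f g : X ⟶ disks G}
    (h : ∀ n, f.f n ≫ fst G n = g.f n ≫ fst G n) : f = g := by
  ext n
  refine hom_ext_to (h n) ?_
  rcases n with _ | n
  · exact hG.eq_of_tgt _ _
  · have h1 := f.comm (n + 1) n
    have h2 := g.comm (n + 1) n
    have h3 := h n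
    rw [d_eq] at h1 h2
    have h4 : X.d (n + 1) n ≫ f.f n ≫ fst G n = X.d (n + 1) n ≫ g.f n ≫ fst G n := by rw [h3]
    rw [← reassoc_of% h1, ← reassoc_of% h2, inl_fst, Category.comp_id] at h4
    exact h4

/-- The map from `disks G` to `L` given by a family of maps `G n ⟶ L.X n`. -/
def desc {L : ChainComplex C ℕ} (e : ∀ n, G n ⟶ L.X n) : disks G ⟶ L where
  f n := fst G n ≫ e (n + 1) ≫ L.d (n + 1) n + snd G n ≫ e n
  comm' := by
    rintro _ n rfl
    rw [d_eq]
    refine hom_ext_from ?_ ?_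
    · simp [reassoc_of% inl_snd]
    · simp [reassoc_of% inl_snd, reassoc_of% inr_snd, reassoc_of% inl_fst]

theorem inr_desc_f {L : ChainComplex C ℕ} (e : ∀ n, G n ⟶ L.X n) (n : ℕ) :
    inr G n ≫ (desc e).f n = e n := by
  simp [desc, reassoc_of% inr_snd, reassoc_of% inr_fst]

/-- The differential carries the second summand in degree `n + 1` onto the first summand in degree
`n`, so values on second summands determine a chain map. With `desc`, `disks G` is free on them. -/
theorem hom_ext' {L : ChainComplex C ℕ} {f g : disks G ⟶ L}
    (h : ∀ n, inr G n ≫ f.f n = inr G n ≫ g.f n) : f = g := by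
  ext n
  refine hom_ext_from ?_ (h n)
  have h1 := f.comm (n + 1) n
  have h2 := g.comm (n + 1) n
  rw [d_eq, Category.assoc] at h1 h2
  have h4 : inr G (n + 1) ≫ f.f (n + 1) ≫ L.d (n + 1) n =
      inr G (n + 1) ≫ g.f (n + 1) ≫ L.d (n + 1) n := by
    rw [reassoc_of% (h (n + 1))]
  rwa [h1, h2, reassoc_of% inr_snd, reassoc_of% inr_snd] at h4

/-- By freeness a lift may be chosen independently in each degree, with no compatibility to check.
Degree `0` asks for nothing because `G 0` vanishes, which is why surjectivity in positive degrees
suffices. -/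
theorem exists_lift (hG : IsZero (G 0)) [∀ n, Projective (G n)] {X Y : ChainComplex C ℕ}
    (p : X ⟶ Y) (hp : ∀ n, 0 < n → Epi (p.f n)) (ψ : disks G ⟶ Y) : ∃ φ, φ ≫ p = ψ := by
  have (n : ℕ) : ∃ e : G n ⟶ X.X n, e ≫ p.f n = inr G n ≫ ψ.f n := by
    rcases n with _ | n
    · exact ⟨0, hG.eq_of_src _ _⟩
    · have := hp (n + 1) (by simp)
      exact ⟨Projective.factorThru _ _, Projective.factorThru_comp _ _⟩
  choose e he using this
  exact ⟨desc e, hom_ext' fun n => by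
    rw [HomologicalComplex.comp_f, reassoc_of% inr_desc_f, he]⟩

end disks

end Disks

/-! ### Trivial fibrations as maps with a lifting property for points -/

section TrivialFibrations

variable {C : Type u} [Category.{v} C] [Abelian C]

/-- With truncated subtraction the formula also covers degree `0`, where `X.d 0 0 = 0`. Thus `x ≫
X.d n (n - 1) = 0` expresses that `x` is a cycle in every degree, vacuously in degree `0`. -/
theorem down_next (n : ℕ) : (ComplexShape.down ℕ).next n = n - 1 := by
  rcases n with _ | n
  · simp
  · simp

theorem down_prev (n : ℕ) : (ComplexShape.down ℕ).prev n = n + 1 := by simp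

variable {X Y : ChainComplex C ℕ} (p : X ⟶ Y)

/-- Every square from the boundary of an `n`-disk, with values in `P`, to `p` has a lift. -/
def LiftsPoints (P : C) : Prop :=
  (∀ y : P ⟶ Y.X 0, ∃ x, x ≫ p.f 0 = y) ∧
  ∀ (n : ℕ) (x : P ⟶ X.X n) (y : P ⟶ Y.X (n + 1)), x ≫ X.d n (n - 1) = 0 →
    x ≫ p.f n = y ≫ Y.d (n + 1) n → ∃ x', x' ≫ p.f (n + 1) = y ∧ x' ≫ X.d (n + 1) n = x

variable {p}

/-- A cycle is a disk with boundary zero, so the lifting problem is solved with boundary `0`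
upstairs. -/
theorem LiftsPoints.exists_cycle {P : C} (h : LiftsPoints p P) (n : ℕ) (y : P ⟶ Y.X n)
    (hy : y ≫ Y.d n (n - 1) = 0) : ∃ x, x ≫ p.f n = y ∧ x ≫ X.d n (n - 1) = 0 := by
  rcases n with _ | n
  · obtain ⟨x, hx⟩ := h.1 y
    exact ⟨x, hx, by rw [X.shape _ _ (by simp), comp_zero]⟩
  · obtain ⟨x, hx, hx'⟩ := h.2 n 0 y (by simp) (by simpa using hy.symm)
    exact ⟨x, hx, hx'⟩

/-- The boundary of `y` is a cycle and lifts to a cycle; this lift then serves as the prescribed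
boundary for a lift of `y`. -/
theorem LiftsPoints.exists_lift {P : C} (h : LiftsPoints p P) (n : ℕ) (y : P ⟶ Y.X n) :
    ∃ x, x ≫ p.f n = y := by
  rcases n with _ | n
  · exact h.1 y
  · obtain ⟨x, hx, hx'⟩ := h.exists_cycle n (y ≫ Y.d (n + 1) n) (by simp)
    obtain ⟨x', hx', _⟩ := h.2 n x y hx' hx
    exact ⟨x', hx'⟩

variable [EnoughProjectives C]

theorem epi_of_forall_projective {A B : C} (f : A ⟶ B)
    (h : ∀ (P : C) [Projective P] (y : P ⟶ B), ∃ x, x ≫ f = y) : Epi f := by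
  obtain ⟨x, hx⟩ := h _ (Projective.π B)
  exact epi_of_epi_fac hx

/-- Injectivity and surjectivity on homology may be checked after refining a generalized element
along an epimorphism. Refining to a projective makes the lifting property available: disks give
injectivity, cycles give surjectivity. -/
theorem quasiIso_of_liftsPoints (h : ∀ (P : C) [Projective P], LiftsPoints p P) : QuasiIso p where
  quasiIsoAt n := by
    rw [quasiIsoAt_iff_isIso_homologyMap]
    have : Mono (HomologicalComplex.homologyMap p n) := by
      rw [HomologicalComplex.mono_homologyMap_iff_up_to_refinements p (n + 1) n (n - 1)
        (down_prev n) (down_next n)]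
      intro A x hx y hy
      obtain ⟨x', -, hx'⟩ := (h (Projective.over A)).2 n (Projective.π A ≫ x) (Projective.π A ≫ y)
        (by rw [Category.assoc, hx, comp_zero]) (by rw [Category.assoc, hy, Category.assoc])
      exact ⟨_, Projective.π A, inferInstance, x', hx'.symm⟩
    have : Epi (HomologicalComplex.homologyMap p n) := by
      rw [HomologicalComplex.epi_homologyMap_iff_up_to_refinements p (n + 1) n (n - 1)
        (down_prev n) (down_next n)]
      intro A y hy
      obtain ⟨x, hx, hx'⟩ := (h (Projective.over A)).exists_cycle n (Projective.π A ≫ y)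
        (by rw [Category.assoc, hy, comp_zero])
      exact ⟨_, Projective.π A, inferInstance, x, hx', 0, by simp [hx]⟩
    exact isIso_of_mono_of_epi _

theorem liftsPoints_of_quasiIso [hq : QuasiIso p] (hp : ∀ n, 0 < n → Epi (p.f n)) (P : C)
    [Projective P] : LiftsPoints p P := by
  have hm (n : ℕ) := (HomologicalComplex.mono_homologyMap_iff_up_to_refinements p (n + 1) n (n - 1)
        (down_prev n) (down_next n)).1 inferInstance
  have he (n : ℕ) := (HomologicalComplex.epi_homologyMap_iff_up_to_refinements p (n + 1) n (n - 1)
        (down_prev n) (down_next n)).1 inferInstance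
  -- Cycles lift to cycles: surjectivity on homology lifts `y` up to a boundary `d w`, and `w`,
  -- being in positive degree, lifts through `p` and corrects the error. The section `s` of the
  -- refinement exists because `P` is projective.
  have key (n : ℕ) (y : P ⟶ Y.X n) (hy : y ≫ Y.d n (n - 1) = 0) :
      ∃ x : P ⟶ X.X n, x ≫ p.f n = y ∧ x ≫ X.d n (n - 1) = 0 := by
    obtain ⟨A, π, _, z, hz, w, hw⟩ := he n y hy
    have := hp (n + 1) (by simp)
    let s := Projective.factorThru (𝟙 P) π
    have hs : s ≫ π = 𝟙 P := Projective.factorThru_comp _ _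
    let w' := Projective.factorThru (s ≫ w) (p.f (n + 1))
    have hw' : w' ≫ p.f (n + 1) = s ≫ w := Projective.factorThru_comp _ _
    refine ⟨s ≫ z + w' ≫ X.d (n + 1) n, ?_, ?_⟩
    · rw [Preadditive.add_comp, Category.assoc, Category.assoc, ← p.comm, reassoc_of% hw',
        ← Preadditive.comp_add, ← hw, reassoc_of% hs]
    · rw [Preadditive.add_comp, Category.assoc, Category.assoc, hz, X.d_comp_d]
      simp
  refine ⟨fun y => ?_, fun n x y hx hxy => ?_⟩
  · obtain ⟨x, hx, -⟩ := key 0 y (by rw [Y.shape _ _ (by simp), comp_zero])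
    exact ⟨x, hx⟩
  · obtain ⟨A, π, _, x₁, hx₁⟩ := hm n x hx y hxy
    let s := Projective.factorThru (𝟙 P) π
    have hs : s ≫ π = 𝟙 P := Projective.factorThru_comp _ _
    have hx₂ : (s ≫ x₁) ≫ X.d (n + 1) n = x := by
      rw [Category.assoc, ← hx₁, reassoc_of% hs]
    -- The point `s ≫ x₁` has the right boundary but perhaps the wrong image; the discrepancy is a
    -- cycle, and subtracting a cycle that lifts it keeps the boundary.
    obtain ⟨z, hz, hz'⟩ := key (n + 1) ((s ≫ x₁) ≫ p.f (n + 1) - y) (by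
      rw [Preadditive.sub_comp, sub_eq_zero]
      change _ ≫ Y.d (n + 1) n = _ ≫ Y.d (n + 1) n
      rw [Category.assoc, p.comm, ← Category.assoc, hx₂, hxy])
    refine ⟨s ≫ x₁ - z, ?_, ?_⟩
    · rw [Preadditive.sub_comp, hz]
      abel
    · have hz'' : z ≫ X.d (n + 1) n = 0 := hz'
      rw [Preadditive.sub_comp, hz'', hx₂, sub_zero]

theorem quasiIso_and_epi_iff_liftsPoints :
    (QuasiIso p ∧ ∀ n, 0 < n → Epi (p.f n)) ↔ ∀ (P : C) [Projective P], LiftsPoints p P :=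
  ⟨fun ⟨_, h⟩ P _ => liftsPoints_of_quasiIso h P, fun h => ⟨quasiIso_of_liftsPoints h,
    fun n _ => epi_of_forall_projective _ fun P _ => (h P).exists_lift n⟩⟩

variable (p) in
/-- The relative matching map `X_{n+1} ⟶ Y_{n+1} ×_{Y_n} Z_n(X)`. -/
def matching (n : ℕ) : X.X (n + 1) ⟶ pullback (Y.d (n + 1) n) (X.iCycles n ≫ p.f n) :=
  pullback.lift (p.f (n + 1)) (X.toCycles (n + 1) n) (by simp)

theorem matching_fst (n : ℕ) : matching p n ≫ pullback.fst _ _ = p.f (n + 1) :=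
  pullback.lift_fst _ _ _

theorem matching_snd (n : ℕ) :
    matching p n ≫ pullback.snd _ _ ≫ X.iCycles n = X.d (n + 1) n := by
  rw [← Category.assoc]
  exact (pullback.lift_snd _ _ _ =≫ _).trans (X.toCycles_i _ _)

theorem pullback_cycles_hom_ext {A : C} {n : ℕ}
    {f g : A ⟶ pullback (Y.d (n + 1) n) (X.iCycles n ≫ p.f n)}
    (h : f ≫ pullback.fst _ _ = g ≫ pullback.fst _ _)
    (h' : f ≫ pullback.snd _ _ ≫ X.iCycles n = g ≫ pullback.snd _ _ ≫ X.iCycles n) : f = g := by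
  refine pullback.hom_ext h ?_
  rwa [← cancel_mono (X.iCycles n), Category.assoc, Category.assoc]

theorem exists_pullback_cycles_lift {A : C} {n : ℕ} (x : A ⟶ X.X n) (y : A ⟶ Y.X (n + 1))
    (hx : x ≫ X.d n (n - 1) = 0) (h : x ≫ p.f n = y ≫ Y.d (n + 1) n) :
    ∃ f : A ⟶ pullback (Y.d (n + 1) n) (X.iCycles n ≫ p.f n),
      f ≫ pullback.fst _ _ = y ∧ f ≫ pullback.snd _ _ ≫ X.iCycles n = x := by
  refine ⟨pullback.lift y (X.liftCycles x _ (down_next n) hx) (by simp [h]),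
    pullback.lift_fst _ _ _, ?_⟩
  rw [← Category.assoc]
  exact (pullback.lift_snd _ _ _ =≫ _).trans (X.liftCycles_i _ _ _ _)

/-- A boundary-of-disk problem is the same as a point of the target of the matching map, and a
solution is a preimage. In this form the condition concerns only surjectivity on points. -/
theorem liftsPoints_iff_exists_lift_matching (P : C) :
    LiftsPoints p P ↔ (∀ y : P ⟶ Y.X 0, ∃ x, x ≫ p.f 0 = y) ∧
      ∀ n (y : P ⟶ pullback (Y.d (n + 1) n) (X.iCycles n ≫ p.f n)),
        ∃ x, x ≫ matching p n = y := by
  refine and_congr_right fun _ => forall_congr' fun n => ⟨fun h y => ?_, fun h x y hx hxy => ?_⟩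
  · obtain ⟨x, hx, hx'⟩ := h (y ≫ pullback.snd _ _ ≫ X.iCycles n) (y ≫ pullback.fst _ _)
      (by simp) (by simp [pullback.condition])
    exact ⟨x, pullback_cycles_hom_ext (by rw [Category.assoc, matching_fst, hx])
      (by rw [Category.assoc, matching_snd, hx'])⟩
  · obtain ⟨f, hf, hf'⟩ := exists_pullback_cycles_lift x y hx hxy
    obtain ⟨x', rfl⟩ := h f
    rw [Category.assoc, matching_fst] at hf
    rw [Category.assoc, matching_snd] at hf'
    exact ⟨x', hf, hf'⟩

theorem epi_matching (h : ∀ (P : C) [Projective P], LiftsPoints p P) (n : ℕ) :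
    Epi (matching p n) :=
  epi_of_forall_projective _ fun P _ => ((liftsPoints_iff_exists_lift_matching P).1 (h P)).2 n

/-- Lifting points of a separator makes `p.f 0` and all matching maps epimorphisms, and epimorphisms
lift points of every projective. -/
theorem liftsPoints_of_isSeparator {G : C} (hG : IsSeparator G) (h : LiftsPoints p G) (P : C)
    [Projective P] : LiftsPoints p P := by
  rw [liftsPoints_iff_exists_lift_matching] at h ⊢
  have := epi_of_forall_lift_of_isSeparator hG _ h.1
  have := fun n => epi_of_forall_lift_of_isSeparator hG _ (h.2 n)
  exact ⟨fun y => ⟨_, Projective.factorThru_comp y (p.f 0)⟩,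
    fun n y => ⟨_, Projective.factorThru_comp y (matching p n)⟩⟩

/-- The lift is built by induction on the degree, each step being a degreewise lifting problem for
`i` against the matching map, which is an epimorphism. -/
theorem hasLiftingProperty_of_liftsPoints {A B : ChainComplex C ℕ} (i : A ⟶ B)
    (hi : ∀ n, (MorphismProperty.epimorphisms C).llp (i.f n))
    (hp : ∀ (P : C) [Projective P], LiftsPoints p P) : HasLiftingProperty i p where
  sq_hasLift {t b} sq := by
    have hw (n : ℕ) : t.f n ≫ p.f n = i.f n ≫ b.f n :=
      congrArg (fun φ => HomologicalComplex.Hom.f φ n) sq.w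
    -- The last condition says that the candidate sends boundaries of `B` to cycles of `X`; it is
    -- exactly what is needed to pose the problem in the next degree.
    let S (n : ℕ) := { h : B.X n ⟶ X.X n // i.f n ≫ h = t.f n ∧ h ≫ p.f n = b.f n ∧
      B.d (n + 1) n ≫ h ≫ X.d n (n - 1) = 0 }
    have base : Nonempty (S 0) := by
      have : Epi (p.f 0) := epi_of_forall_projective _ fun P _ => (hp P).1
      have := hi 0 (p.f 0) this
      have sq₀ : CommSq (t.f 0) (i.f 0) (p.f 0) (b.f 0) := ⟨hw 0⟩
      exact ⟨sq₀.lift, sq₀.fac_left, sq₀.fac_right, by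
        rw [X.shape _ _ (by simp), comp_zero, comp_zero]⟩
    have step (n : ℕ) (h : S n) :
        ∃ h' : S (n + 1), h'.1 ≫ X.d (n + 1) n = B.d (n + 1) n ≫ h.1 := by
      obtain ⟨h, h₁, h₂, h₃⟩ := h
      have := hi (n + 1) (matching p n) (epi_matching hp n)
      -- The prescribed boundary together with `b` in degree `n + 1` is a point of the target of the
      -- matching map; lifting it secures both the projection to `Y` and the chain map relation.
      obtain ⟨q, hq, hq'⟩ := exists_pullback_cycles_lift (p := p) (B.d (n + 1) n ≫ h)
        (b.f (n + 1)) (by rw [Category.assoc, h₃]) (by simp [h₂])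
      have sq' : CommSq (t.f (n + 1)) (i.f (n + 1)) (matching p n) q := ⟨by
        refine pullback_cycles_hom_ext ?_ ?_
        · rw [Category.assoc, Category.assoc, matching_fst, hq, hw]
        · rw [Category.assoc, Category.assoc, matching_snd, hq', i.comm_assoc, h₁, t.comm]⟩
      have e₁ : sq'.lift ≫ p.f (n + 1) = b.f (n + 1) := by
        rw [← matching_fst (p := p), ← Category.assoc, sq'.fac_right, hq]
      have e₂ : sq'.lift ≫ X.d (n + 1) n = B.d (n + 1) n ≫ h := by
        rw [← matching_snd (p := p), ← Category.assoc, sq'.fac_right, hq']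
      refine ⟨⟨sq'.lift, sq'.fac_left, e₁, ?_⟩, e₂⟩
      change _ ≫ _ ≫ X.d (n + 1) n = 0
      rw [e₂, B.d_comp_d_assoc, zero_comp]
    choose next hnext using step
    let F : ∀ n, S n := fun n => Nat.rec base.some next n
    have hF (n : ℕ) : (F (n + 1)).1 ≫ X.d (n + 1) n = B.d (n + 1) n ≫ (F n).1 := hnext n (F n)
    refine ⟨⟨⟨{ f := fun n => (F n).1, comm' := ?_ }, ?_, ?_⟩⟩⟩
    · rintro _ n rfl
      exact hF n
    · ext n
      exact (F n).2.1
    · ext n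
      exact (F n).2.2.1

/-- A morphism of chain complexes that has the left lifting property with respect to all
trivial fibrations has it degreewise with respect to all epimorphisms. -/
theorem llp_epimorphisms_of_forall_liftsPoints {A B : ChainComplex C ℕ} (i : A ⟶ B)
    (hi : ∀ {X Y : ChainComplex C ℕ} (p : X ⟶ Y),
      (∀ (P : C) [Projective P], LiftsPoints p P) → HasLiftingProperty i p) (n : ℕ) :
    (MorphismProperty.epimorphisms C).llp (i.f n) := by
  intro M N e (he : Epi e)
  -- An epimorphism `e` is turned into a trivial fibration between contractible complexes, with the
  -- same object in every positive index and zero in index `0`.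
  let G (M : C) : ℕ → C := fun m => Nat.casesOn m (⊥_ C) fun _ => M
  have hG (M : C) : IsZero (G M 0) := HasZeroObject.zeroIsInitial.isZero.of_iso
    (initialIsInitial.uniqueUpToIso HasZeroObject.zeroIsInitial)
  let g : ∀ m, G M m ⟶ G N m := fun m => match m with
    | 0 => 𝟙 _
    | _ + 1 => e
  have hg (m : ℕ) : Epi (g m) := by
    rcases m with _ | m
    · exact inferInstanceAs (Epi (𝟙 (⊥_ C)))
    · exact he
  have hep (n : ℕ) : Epi ((disks.map g).f n) := disks.epi_map_f g hg n
  have hp : ∀ (P : C) [Projective P], LiftsPoints (disks.map g) P :=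
    quasiIso_and_epi_iff_liftsPoints.1 ⟨⟨fun n => by
      rw [quasiIsoAt_iff_exactAt _ _ (disks.acyclic (hG M) n)]
      exact disks.acyclic (hG N) n⟩, fun n _ => hep n⟩
  have := hi _ hp
  refine ⟨fun {t b} sq => ?_⟩
  -- A map out of the degree `n` term is extended by zero to a family, which by cofreeness of
  -- `disks` is a chain map; the square for `e` thereby becomes a square of complexes.
  let ext {D : ChainComplex C ℕ} {Q : C} (φ : D.X n ⟶ Q) (m : ℕ) : D.X m ⟶ G Q (m + 1) :=
    if h : n = m then eqToHom (by rw [h]) ≫ φ else 0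
  have ext_self {D : ChainComplex C ℕ} {Q : C} (φ : D.X n ⟶ Q) : ext φ n = φ := by
    simp [ext]
  have sq' : CommSq (disks.lift (ext t)) i (disks.map g) (disks.lift (ext b)) := ⟨by
    refine disks.hom_ext (hG N) fun m => ?_
    rw [HomologicalComplex.comp_f, HomologicalComplex.comp_f, Category.assoc, Category.assoc,
      disks.map_f_fst, disks.lift_f_fst, reassoc_of% disks.lift_f_fst]
    by_cases h : n = m
    · subst h
      rw [ext_self, ext_self]
      exact sq.w
    · simp [ext, h]⟩
  refine ⟨⟨⟨sq'.lift.f n ≫ disks.fst _ n, ?_, ?_⟩⟩⟩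
  · rw [← Category.assoc, ← HomologicalComplex.comp_f, sq'.fac_left, disks.lift_f_fst, ext_self]
  · have h1 := congrArg (fun φ => HomologicalComplex.Hom.f φ n) sq'.fac_right
    rw [HomologicalComplex.comp_f] at h1
    have h2 := h1 =≫ disks.fst _ n
    rw [Category.assoc, disks.map_f_fst, disks.lift_f_fst, ext_self] at h2
    rw [Category.assoc]
    exact h2

end TrivialFibrations

/-! ### The small object argument in a Grothendieck category -/

section SmallObject

open MorphismProperty

/-- In a Grothendieck abelian category, every small family of monomorphisms permits the small
object argument. -/
theorem hasSmallObjectArgument_of_le_monomorphisms {C : Type u} [Category.{v} C] [Abelian C]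
    [IsGrothendieckAbelian.{w} C] (I : MorphismProperty C) [IsSmall.{w} I]
    (hI : I ≤ monomorphisms C) : HasSmallObjectArgument.{w} I := by
  have : Small.{w} (Σ f : I.toSet, Subobject f.1.left) := inferInstance
  -- `κ` exceeds the number of subobjects of every source in `I`, so that maps out of these sources
  -- commute with colimits of chains of monomorphisms of length `κ`.
  obtain ⟨κ, hκ', hκ⟩ := HasCardinalLT.exists_regular_cardinal.{w}
    (Σ f : I.toSet, Subobject f.1.left)
  have : Fact κ.IsRegular := ⟨hκ'⟩
  have : Nonempty κ.ord.ToType := by simpa using hκ'.ne_zero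
  have := WellFoundedLT.toOrderBot κ.ord.ToType
  exact ⟨κ, inferInstance, inferInstance,
    { preservesColimit {A B X Y} i hi f hf := by
        let hf' : (monomorphisms C).TransfiniteCompositionOfShape κ.ord.ToType f :=
          { toTransfiniteCompositionOfShape := hf.toTransfiniteCompositionOfShape
            map_mem j hj := by
              -- Each stage is a pushout of a coproduct of maps in `I`, hence a monomorphism.
              have := (hf.attachCells j hj).pushouts_coproducts
              simp only [ofHoms_homFamily] at this
              refine (?_ : _ ≤ monomorphisms C) _ this
              simp only [pushouts_le_iff, coproducts_le_iff]
              exact hI }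
        have (j j' : κ.ord.ToType) (φ : j ⟶ j') : Mono (hf'.F.map φ) := hf'.mem_map φ
        apply IsGrothendieckAbelian.preservesColimit_coyoneda_obj_of_mono (Y := hf'.F) (κ := κ)
        let m : I.toSet := ⟨Arrow.mk i, hi⟩
        exact hκ.of_injective (fun S : Subobject A => (⟨m, S⟩ : Σ f : I.toSet, Subobject f.1.left))
          fun S T h => eq_of_heq (Sigma.mk.inj h).2 }⟩

end SmallObject

/-! ### The projective model structure on chain complexes -/

section Model

open MorphismProperty

variable (C : Type u) [Category.{v} C] [Abelian C]

/-- The chain maps that are epimorphisms in all positive degrees. -/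
def fibs : MorphismProperty (ChainComplex C ℕ) := fun _ _ f => ∀ n, 0 < n → Epi (f.f n)

/-- The monomorphisms of chain complexes whose cokernel is degreewise projective. -/
def cofibs : MorphismProperty (ChainComplex C ℕ) :=
  fun _ _ f => ∀ n, Mono (f.f n) ∧ Projective (cokernel (f.f n))

/-- The quasi-isomorphisms of chain complexes. -/
abbrev qis : MorphismProperty (ChainComplex C ℕ) := HomologicalComplex.quasiIso C _

variable {C}

theorem cofibs_iff {A B : ChainComplex C ℕ} (i : A ⟶ B) :
    cofibs C i ↔ ∀ n, (epimorphisms C).llp (i.f n) :=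
  forall_congr' fun _ => (llp_epimorphisms_iff _).symm

variable [EnoughProjectives C]

theorem fibs_inf_qis_iff {X Y : ChainComplex C ℕ} (p : X ⟶ Y) :
    (fibs C ⊓ qis C) p ↔ ∀ (P : C) [Projective P], LiftsPoints p P := by
  rw [← quasiIso_and_epi_iff_liftsPoints]
  exact and_comm

/-- Through `cofibs_iff` both sides become lifting conditions: contractible disks extract the
degreewise condition from the global one, and the induction over degrees goes back. -/
theorem llp_fibs_inf_qis : (fibs C ⊓ qis C).llp = cofibs C := by
  ext A B i
  rw [cofibs_iff]
  refine ⟨fun h => llp_epimorphisms_of_forall_liftsPoints i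
    fun p hp => h p ((fibs_inf_qis_iff p).2 hp), fun h X Y p hp => ?_⟩
  exact hasLiftingProperty_of_liftsPoints i h ((fibs_inf_qis_iff p).1 hp)

/-! ### Trivial cofibrations by adding disks -/

section Factorization

open ZeroObject

variable (L : ChainComplex C ℕ)

/-- Projective objects covering the terms of `L` in positive degrees. -/
def covers : ℕ → C
  | 0 => 0
  | n + 1 => Projective.over (L.X (n + 1))

theorem isZero_covers : IsZero (covers L 0) := isZero_zero C

instance (n : ℕ) : Projective (covers L n) := by
  rcases n with _ | n
  · exact inferInstanceAs (Projective (0 : C))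
  · exact inferInstanceAs (Projective (Projective.over (L.X (n + 1))))

/-- The covering maps. -/
def coversπ (n : ℕ) : covers L n ⟶ L.X n := match n with
  | 0 => 0
  | n + 1 => Projective.π (L.X (n + 1))

/-- Adding disks on projective covers makes any map surjective in positive degrees. Nothing is
placed over degree `0`, where a fibration need not be surjective, and this keeps the added complex
contractible. -/
theorem fibs_desc_coversπ {T : ChainComplex C ℕ} (f : T ⟶ L) :
    fibs C (biprod.desc f (disks.desc (coversπ L))) := by
  rintro (_ | n) hn
  · simp at hn
  have : Epi (coversπ L (n + 1)) := inferInstanceAs (Epi (Projective.π (L.X (n + 1))))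
  have e : (disks.inr (covers L) (n + 1) ≫ (biprod.inr : _ ⟶ T ⊞ disks (covers L)).f (n + 1)) ≫
      (biprod.desc f (disks.desc (coversπ L))).f (n + 1) = coversπ L (n + 1) := by
    rw [Category.assoc, ← HomologicalComplex.comp_f, biprod.inr_desc, disks.inr_desc_f]
  exact epi_of_epi_fac e

end Factorization

/-- The inclusion of `T` in its direct sum with a contractible complex is a homotopy equivalence. -/
def homotopyEquivBiprod (T E : ChainComplex C ℕ) (h : Homotopy (𝟙 E) 0) :
    HomotopyEquiv T (T ⊞ E) where
  hom := biprod.inl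
  inv := biprod.fst
  homotopyHomInvId := Homotopy.ofEq (by simp)
  homotopyInvHomId :=
    (Homotopy.ofEq (by simp)).trans ((((Homotopy.refl (biprod.fst ≫ biprod.inl)).add
      ((h.symm.compLeft biprod.snd).compRight biprod.inr))).trans (Homotopy.ofEq (by simp)))

theorem biprod_inl_mem_llp_fibs (T : ChainComplex C ℕ) {G : ℕ → C} (hG : IsZero (G 0))
    [∀ n, Projective (G n)] : (fibs C).llp (biprod.inl : T ⟶ T ⊞ disks G) := by
  intro X Y p hp
  refine ⟨fun {t b} sq => ?_⟩
  obtain ⟨φ, hφ⟩ := disks.exists_lift hG p hp (biprod.inr ≫ b)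
  exact ⟨⟨⟨biprod.desc t φ, by simp, biprod.hom_ext' _ _ (by simp [sq.w]) (by simp [hφ])⟩⟩⟩

/-- Factor `i` as `j ≫ q`, with `j` the inclusion into a sum with contractible disks and `q` a
fibration. If `i` lifts against fibrations it is a retract of `j`, hence a quasi-isomorphism.
Conversely, if `i` is a quasi-isomorphism then so is `q`; a cofibration `i` lifts against it and is
again a retract of `j`, which lifts against fibrations. -/
theorem llp_fibs : (fibs C).llp = cofibs C ⊓ qis C := by
  ext A B i
  let j : A ⟶ A ⊞ disks (covers B) := biprod.inl
  let q := biprod.desc i (disks.desc (coversπ B))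
  have hj : QuasiIso j :=
    inferInstanceAs (QuasiIso (homotopyEquivBiprod A _ (disks.homotopy (isZero_covers B))).hom)
  have hjq : j ≫ q = i := biprod.inl_desc _ _
  have hq : fibs C q := fibs_desc_coversπ B i
  constructor
  · intro h
    refine ⟨?_, ?_⟩
    · rw [← llp_fibs_inf_qis]
      exact fun X Y p hp => h p hp.1
    · have := h q hq
      exact quasiIso_of_retractArrow (RetractArrow.ofLeftLiftingProperty hjq)
  · rintro ⟨h, h' : QuasiIso i⟩
    rw [← llp_fibs_inf_qis] at h
    have hq' : QuasiIso q := by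
      rw [← hjq] at h'
      exact quasiIso_of_comp_left j q
    have := h q ⟨hq, hq'⟩
    exact of_retract (RetractArrow.ofLeftLiftingProperty hjq)
      (biprod_inl_mem_llp_fibs A (isZero_covers B))

/-! ### Generating cofibrations from a projective separator -/

section Generators

open ZeroObject

variable (G : C)

theorem down_rel (n : ℕ) : (ComplexShape.down ℕ).Rel (n + 1) n := rfl

/-- The complex `G = G` in degrees `n + 1` and `n`. -/
abbrev disk (n : ℕ) : ChainComplex C ℕ := HomologicalComplex.double (𝟙 G) (down_rel n)

/-- The inclusion of the boundary of a disk. -/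
def sphereToDisk (n : ℕ) : (HomologicalComplex.single C (.down ℕ) n).obj G ⟶ disk G n :=
  HomologicalComplex.mkHomFromSingle
    (HomologicalComplex.doubleXIso₁ (𝟙 G) (down_rel n) (by simp)).inv (fun k _ => by
      rw [HomologicalComplex.double_d_eq_zero₀ _ _ _ _ (by simp), comp_zero])

/-- The generating cofibrations. -/
def genCofibs : MorphismProperty (ChainComplex C ℕ) :=
  ofHoms (fun _ : Unit => (0 : 0 ⟶ (HomologicalComplex.single C (.down ℕ) 0).obj G)) ⊔
    ofHoms (sphereToDisk G)

/-- The generating trivial cofibrations. -/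
def genTrivCofibs : MorphismProperty (ChainComplex C ℕ) :=
  ofHoms (fun n => (0 : 0 ⟶ disk G n))

variable {G} {X Y : ChainComplex C ℕ}

/-- The map from a disk given by a point. -/
def diskDesc {n : ℕ} (x : G ⟶ X.X (n + 1)) : disk G n ⟶ X :=
  HomologicalComplex.mkHomFromDouble (down_rel n) (by simp) x (x ≫ X.d (n + 1) n) (by simp)
    (by simp)

/-- The top component of a map from a disk. -/
def diskPt {n : ℕ} (φ : disk G n ⟶ X) : G ⟶ X.X (n + 1) :=
  (HomologicalComplex.doubleXIso₀ (𝟙 G) (down_rel n)).inv ≫ φ.f (n + 1)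

theorem diskPt_comp {n : ℕ} (φ : disk G n ⟶ X) (p : X ⟶ Y) :
    diskPt (φ ≫ p) = diskPt φ ≫ p.f (n + 1) := by
  simp [diskPt]

theorem diskPt_diskDesc {n : ℕ} (x : G ⟶ X.X (n + 1)) : diskPt (diskDesc x) = x := by
  simp [diskPt, diskDesc]

theorem disk_hom_ext {n : ℕ} {φ ψ : disk G n ⟶ X} (h : diskPt φ = diskPt ψ) : φ = ψ :=
  (HomologicalComplex.evalCompCoyonedaCorepresentableByDoubleId (down_rel n) (by simp)
    G).homEquiv.injective h

/-- The map from a sphere given by a cycle. -/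
def sphereDesc {n : ℕ} (x : G ⟶ X.X n) (hx : x ≫ X.d n (n - 1) = 0) :
    (HomologicalComplex.single C (.down ℕ) n).obj G ⟶ X :=
  HomologicalComplex.mkHomFromSingle x (fun k hk => by
    obtain rfl : k + 1 = n := hk
    exact hx)

/-- The cycle given by a map from a sphere. -/
def spherePt {n : ℕ} (φ : (HomologicalComplex.single C (.down ℕ) n).obj G ⟶ X) : G ⟶ X.X n :=
  (HomologicalComplex.singleObjXSelf (.down ℕ) n G).inv ≫ φ.f n

theorem spherePt_d {n : ℕ} (φ : (HomologicalComplex.single C (.down ℕ) n).obj G ⟶ X) :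
    spherePt φ ≫ X.d n (n - 1) = 0 := by
  simp [spherePt]

theorem spherePt_comp {n : ℕ} (φ : (HomologicalComplex.single C (.down ℕ) n).obj G ⟶ X)
    (p : X ⟶ Y) : spherePt (φ ≫ p) = spherePt φ ≫ p.f n := by
  simp [spherePt]

theorem spherePt_sphereDesc {n : ℕ} (x : G ⟶ X.X n) (hx : x ≫ X.d n (n - 1) = 0) :
    spherePt (sphereDesc x hx) = x := by
  simp [spherePt, sphereDesc]

theorem sphere_hom_ext {n : ℕ} {φ ψ : (HomologicalComplex.single C (.down ℕ) n).obj G ⟶ X}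
    (h : spherePt φ = spherePt ψ) : φ = ψ :=
  HomologicalComplex.from_single_hom_ext (by simpa [spherePt] using h)

theorem spherePt_sphereToDisk_comp {n : ℕ} (φ : disk G n ⟶ X) :
    spherePt (sphereToDisk G n ≫ φ) = diskPt φ ≫ X.d (n + 1) n := by
  have := φ.comm (n + 1) n
  rw [HomologicalComplex.double_d _ _ (by simp)] at this
  rw [diskPt, Category.assoc, this]
  simp [spherePt, sphereToDisk]

/-- Maps from a disk are points in a positive degree, so the lifting property says that `p` is
surjective on `G`-points there. For a projective separator this is the same as being an epimorphism.
-/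
theorem genTrivCofibs_rlp (hG : IsSeparator G) [Projective G] : (genTrivCofibs G).rlp = fibs C := by
  ext X Y p
  constructor
  · rintro h (_ | n) hn
    · simp at hn
    refine epi_of_forall_lift_of_isSeparator hG _ fun y => ?_
    have := h (0 : 0 ⟶ disk G n) ⟨n⟩
    have sq : CommSq (0 : 0 ⟶ X) (0 : 0 ⟶ disk G n) p (diskDesc y) := ⟨by simp⟩
    exact ⟨diskPt sq.lift, by rw [← diskPt_comp, sq.fac_right, diskPt_diskDesc]⟩
  · rintro h A B _ ⟨n⟩
    refine ⟨fun {t b} sq => ?_⟩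
    have := h (n + 1) (by simp)
    refine ⟨⟨⟨diskDesc (Projective.factorThru (diskPt b) (p.f (n + 1))),
      (isZero_zero _).eq_of_src _ _, disk_hom_ext ?_⟩⟩⟩
    rw [diskPt_comp, diskPt_diskDesc, Projective.factorThru_comp]

/-- Squares from a sphere inclusion to `p` are precisely the problems in `LiftsPoints` for `G`, and
the generator out of `0` supplies its degree-zero clause. The separator property passes from `G` to
all projectives. -/
theorem genCofibs_rlp (hG : IsSeparator G) [Projective G] :
    (genCofibs G).rlp = fibs C ⊓ qis C := by
  ext X Y p
  rw [fibs_inf_qis_iff]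
  constructor
  · intro h
    suffices H : LiftsPoints p G from fun P _ => liftsPoints_of_isSeparator hG H P
    refine ⟨fun y => ?_, fun n x y hx hxy => ?_⟩
    · have := h _ (Or.inl ⟨()⟩)
      have sq : CommSq (0 : 0 ⟶ X) 0 p (sphereDesc y
        (by rw [Y.shape _ _ (by simp), comp_zero])) := ⟨by simp⟩
      exact ⟨spherePt sq.lift, by rw [← spherePt_comp, sq.fac_right, spherePt_sphereDesc]⟩
    · have := h (sphereToDisk G n) (Or.inr ⟨n⟩)
      have sq : CommSq (sphereDesc x hx) (sphereToDisk G n) p (diskDesc y) := ⟨sphere_hom_ext (by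
        rw [spherePt_comp, spherePt_sphereDesc, spherePt_sphereToDisk_comp, diskPt_diskDesc, hxy])⟩
      refine ⟨diskPt sq.lift, by rw [← diskPt_comp, sq.fac_right, diskPt_diskDesc], ?_⟩
      rw [← spherePt_sphereToDisk_comp, sq.fac_left, spherePt_sphereDesc]
  · rintro h A B _ (⟨⟨⟩⟩ | ⟨⟨n⟩⟩)
    · refine ⟨fun {t b} sq => ?_⟩
      obtain ⟨x, hx⟩ := (h G).1 (spherePt b)
      refine ⟨⟨⟨sphereDesc x (by rw [HomologicalComplex.shape _ _ _ (by simp), comp_zero]),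
        (isZero_zero _).eq_of_src _ _, sphere_hom_ext ?_⟩⟩⟩
      rw [spherePt_comp, spherePt_sphereDesc, hx]
    · refine ⟨fun {t b} sq => ?_⟩
      obtain ⟨x, hx, hx'⟩ := (h G).2 n (spherePt t) (diskPt b) (spherePt_d t) (by
        rw [← spherePt_comp, sq.w, spherePt_sphereToDisk_comp])
      refine ⟨⟨⟨diskDesc x, sphere_hom_ext ?_, disk_hom_ext ?_⟩⟩⟩
      · rw [spherePt_sphereToDisk_comp, diskPt_diskDesc, hx']
      · rw [diskPt_comp, diskPt_diskDesc, hx]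

end Generators

/-! ### Factorizations and the model structure -/

section ModelStructure

variable [IsGrothendieckAbelian.{w} C]

open ZeroObject in
theorem hasFunctorialFactorization_cofibs {G : C} (hG : IsSeparator G) [Projective G] :
    (cofibs C).HasFunctorialFactorization (fibs C ⊓ qis C) := by
  have : IsSmall.{w} (genCofibs G) := by
    have h1 := (isSmall_ofHoms.{w} (fun _ : Unit =>
      (0 : 0 ⟶ (HomologicalComplex.single C (.down ℕ) 0).obj G))).1
    have h2 := (isSmall_ofHoms.{w} (sphereToDisk G)).1
    exact ⟨@small_union.{w} _ _ _ h1 h2⟩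
  -- Generators lie in the left class they determine, which is `cofibs`, and are therefore
  -- monomorphisms.
  have h : genCofibs G ≤ monomorphisms _ := by
    have h1 := (genCofibs G).le_llp_rlp
    rw [genCofibs_rlp hG, llp_fibs_inf_qis] at h1
    intro A B i hi
    have := fun n => (h1 i hi n).1
    exact HomologicalComplex.mono_of_mono_f i this
  have := hasSmallObjectArgument_of_le_monomorphisms.{w} _ h
  rw [← llp_fibs_inf_qis, ← genCofibs_rlp hG]
  infer_instance

theorem hasFunctorialFactorization_trivCofibs {G : C} (hG : IsSeparator G) [Projective G] :
    (cofibs C ⊓ qis C).HasFunctorialFactorization (fibs C) := by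
  have : IsSmall.{w} (genTrivCofibs G) := isSmall_ofHoms.{w} _
  have h : genTrivCofibs G ≤ monomorphisms _ := by
    rintro _ _ _ ⟨n⟩
    exact (isZero_zero _).mono _
  have := hasSmallObjectArgument_of_le_monomorphisms.{w} _ h
  rw [← llp_fibs, ← genTrivCofibs_rlp hG]
  infer_instance

/-- The projective model structure on non-negatively graded chain complexes. -/
@[reducible]
def projModelCategory {G : C} (hG : IsSeparator G) [Projective G] :
    ModelCategory (ChainComplex C ℕ) :=
  letI : CategoryWithFibrations (ChainComplex C ℕ) := ⟨fibs C⟩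
  letI : CategoryWithCofibrations (ChainComplex C ℕ) := ⟨cofibs C⟩
  letI : CategoryWithWeakEquivalences (ChainComplex C ℕ) := ⟨qis C⟩
  haveI : (weakEquivalences (ChainComplex C ℕ)).HasTwoOutOfThreeProperty :=
    inferInstanceAs (qis C).HasTwoOutOfThreeProperty
  haveI := hasFunctorialFactorization_cofibs.{w} hG
  haveI := hasFunctorialFactorization_trivCofibs.{w} hG
  haveI : IsWeakFactorizationSystem (cofibrations (ChainComplex C ℕ)) (trivialFibrations _) :=
    { llp := llp_fibs_inf_qis
      rlp := by
        change (cofibs C).rlp = fibs C ⊓ qis C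
        -- The right class is already a right orthogonal, so taking orthogonals twice returns it.
        rw [← llp_fibs_inf_qis, ← genCofibs_rlp hG, rlp_llp_rlp]
      hasFactorization := inferInstanceAs ((cofibs C).HasFactorization (fibs C ⊓ qis C)) }
  haveI : IsWeakFactorizationSystem (trivialCofibrations (ChainComplex C ℕ)) (fibrations _) :=
    { llp := llp_fibs
      rlp := by
        change (cofibs C ⊓ qis C).rlp = fibs C
        rw [← llp_fibs, ← genTrivCofibs_rlp hG, rlp_llp_rlp]
      hasFactorization := inferInstanceAs ((cofibs C ⊓ qis C).HasFactorization (fibs C)) }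
  ModelCategory.mk' _

end ModelStructure

end Model

/-! ### Tensor products of complexes: colimits, closedness, homotopies -/

section Tensor

variable {C : Type u} [Category.{v} C] [Abelian C] [MonoidalCategory C] [MonoidalPreadditive C]
  [SymmetricCategory C]

attribute [local instance] chainMonoidal

/-- The inclusion of a summand of the tensor product of chain complexes. -/
def tι (K L : ChainComplex C ℕ) (p q n : ℕ) (h : p + q = n) : K.X p ⊗ L.X q ⟶ (K ⊗ L).X n :=
  HomologicalComplex.ιTensorObj K L p q n h

/-- The map from a term of the tensor product of chain complexes given by its components. -/
def tdesc {K L : ChainComplex C ℕ} {n : ℕ} {A : C}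
    (φ : ∀ p q, p + q = n → (K.X p ⊗ L.X q ⟶ A)) : (K ⊗ L).X n ⟶ A :=
  HomologicalComplex.mapBifunctorDesc φ

theorem tι_tdesc {K L : ChainComplex C ℕ} {n : ℕ} {A : C}
    (φ : ∀ p q, p + q = n → (K.X p ⊗ L.X q ⟶ A)) (p q : ℕ) (h : p + q = n) :
    tι K L p q n h ≫ tdesc φ = φ p q h :=
  HomologicalComplex.ι_mapBifunctorDesc _ _ _ _

theorem tensor_hom_ext {K L : ChainComplex C ℕ} {n : ℕ} {A : C} {φ ψ : (K ⊗ L).X n ⟶ A}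
    (h : ∀ p q (h : p + q = n), tι K L p q n h ≫ φ = tι K L p q n h ≫ ψ) : φ = ψ :=
  HomologicalComplex.mapBifunctor.hom_ext h

theorem tι_whiskerRight {K K' : ChainComplex C ℕ} (f : K ⟶ K') (L : ChainComplex C ℕ)
    (p q n : ℕ) (h : p + q = n) :
    tι K L p q n h ≫ (f ▷ L).f n = f.f p ▷ L.X q ≫ tι K' L p q n h := by
  have := HomologicalComplex.ι_mapBifunctorMap f (𝟙 L) (curriedTensor C) (.down ℕ) p q n h
  refine this.trans ?_
  change f.f p ▷ L.X q ≫ K'.X p ◁ 𝟙 _ ≫ tι K' L p q n h = _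
  simp

theorem tι_whiskerLeft (K : ChainComplex C ℕ) {L L' : ChainComplex C ℕ} (f : L ⟶ L')
    (p q n : ℕ) (h : p + q = n) :
    tι K L p q n h ≫ (K ◁ f).f n = K.X p ◁ f.f q ≫ tι K L' p q n h := by
  have := HomologicalComplex.ι_mapBifunctorMap (𝟙 K) f (curriedTensor C) (.down ℕ) p q n h
  refine this.trans ?_
  change 𝟙 _ ▷ L.X q ≫ K.X p ◁ f.f q ≫ tι K L' p q n h = _
  simp

theorem whiskerLeft_tι_comp (K : ChainComplex C ℕ) {L L' : ChainComplex C ℕ} (f : L ⟶ L')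
    (p q n : ℕ) (h : p + q = n) {A : C} (x : (K ⊗ L').X n ⟶ A) :
    K.X p ◁ f.f q ≫ tι K L' p q n h ≫ x = tι K L p q n h ≫ (K ◁ f).f n ≫ x := by
  rw [← Category.assoc, ← tι_whiskerLeft, Category.assoc]

/-- Tensoring chain complexes preserves the colimits that tensoring objects preserves. -/
theorem preservesColimitsOfShape_tensorLeft (K : ChainComplex C ℕ) (J : Type*) [Category* J]
    [HasColimitsOfShape J C] [∀ X : C, PreservesColimitsOfShape J (tensorLeft X)] :
    PreservesColimitsOfShape J (tensorLeft K) where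
  preservesColimit {F} := ⟨fun {c} hc => ⟨HomologicalComplex.isColimitOfEval _ _ fun n => by
    let hc' (p q : ℕ) : IsColimit
        ((tensorLeft (K.X p)).mapCocone ((HomologicalComplex.eval C (.down ℕ) q).mapCocone c)) :=
      isColimitOfPreserves _ (isColimitOfPreserves _ hc)
    -- A cocone under the degree `n` terms restricts, for each `p + q = n`, to a cocone under `K_p ⊗
    -- F_q`; the universal map is assembled from these summands.
    let s' (s : Cocone ((F ⋙ tensorLeft K) ⋙ HomologicalComplex.eval C (.down ℕ) n)) (p q : ℕ)
        (h : p + q = n) : Cocone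
        ((F ⋙ HomologicalComplex.eval C (.down ℕ) q) ⋙ tensorLeft (K.X p)) :=
      { pt := s.pt
        ι :=
          { app j := tι K (F.obj j) p q n h ≫ s.ι.app j
            naturality i j φ :=
              ((whiskerLeft_tι_comp K (F.map φ) p q n h (s.ι.app j)).trans
                (congrArg (fun x => tι K (F.obj i) p q n h ≫ x)
                  ((s.ι.naturality φ).trans (Category.comp_id _)))).trans
                (Category.comp_id _).symm } }
    exact
      { desc s := tdesc (K := K) (L := c.pt) (A := s.pt) fun p q h => (hc' p q).desc (s' s p q h)
        fac s j := tensor_hom_ext (K := K) (L := F.obj j) (A := s.pt) fun p q h =>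
          (whiskerLeft_tι_comp K (c.ι.app j) p q n h (A := s.pt) _).symm.trans
            ((congrArg (fun x => K.X p ◁ (c.ι.app j).f q ≫ x)
              (tι_tdesc (A := s.pt) (fun p q h => (hc' p q).desc (s' s p q h)) p q h)).trans
              ((hc' p q).fac (s' s p q h) j))
        uniq s m hm := tensor_hom_ext (K := K) (L := c.pt) (A := s.pt) fun p q h =>
          ((hc' p q).uniq (s' s p q h) (tι K c.pt p q n h ≫ m) fun j =>
            (whiskerLeft_tι_comp K (c.ι.app j) p q n h (A := s.pt) m).trans
              (congrArg (fun x => tι K (F.obj j) p q n h ≫ x) (hm j))).trans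
            (tι_tdesc (A := s.pt) (fun p q h => (hc' p q).desc (s' s p q h)) p q h).symm }⟩⟩

/-- Chain complexes form a closed monoidal category if tensoring objects preserves colimits. -/
theorem nonempty_monoidalClosed [IsGrothendieckAbelian.{v} C]
    [∀ X : C, PreservesColimitsOfSize.{v, v} (tensorLeft X)] :
    Nonempty (MonoidalClosed (ChainComplex C ℕ)) := by
  -- The special adjoint functor theorem applies, since the category of complexes has a separator.
  have (K : ChainComplex C ℕ) : (tensorLeft K).IsLeftAdjoint := by
    have : PreservesColimits (tensorLeft K) :=
      ⟨fun {J} _ => preservesColimitsOfShape_tensorLeft K J⟩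
    exact isLeftAdjoint_of_preservesColimits_of_isSeparating
      (isSeparator_separator (ChainComplex C ℕ)) _
  exact ⟨⟨fun K => ⟨_, Adjunction.ofIsLeftAdjoint (tensorLeft K)⟩⟩⟩

/-- Tensoring a homotopy equivalence with a complex. -/
def homotopyEquivWhiskerRight {K K' : ChainComplex C ℕ} (e : HomotopyEquiv K K')
    (L : ChainComplex C ℕ) : HomotopyEquiv (K ⊗ L) (K' ⊗ L) where
  hom := e.hom ▷ L
  inv := e.inv ▷ L
  homotopyHomInvId := (Homotopy.ofEq (comp_whiskerRight _ _ L).symm).trans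
    ((HomologicalComplex.mapBifunctorMapHomotopy₁ e.homotopyHomInvId (𝟙 L) (curriedTensor C)
      (.down ℕ)).trans (Homotopy.ofEq (id_whiskerRight K L)))
  homotopyInvHomId := (Homotopy.ofEq (comp_whiskerRight _ _ L).symm).trans
    ((HomologicalComplex.mapBifunctorMapHomotopy₁ e.homotopyInvHomId (𝟙 L) (curriedTensor C)
      (.down ℕ)).trans (Homotopy.ofEq (id_whiskerRight K' L)))

end Tensor

/-! ### The pushout product of cofibrations -/

section PushoutProduct

open MorphismProperty

variable {C : Type u} [Category.{v} C] [Abelian C] [MonoidalCategory C] [MonoidalPreadditive C]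
  [SymmetricCategory C]

attribute [local instance] chainMonoidal

theorem exists_splitting {T U : C} {f : T ⟶ U} (hf : Mono f ∧ Projective (cokernel f)) :
    ∃ (r : U ⟶ T) (s : cokernel f ⟶ U), f ≫ r = 𝟙 T ∧ r ≫ f + cokernel.π f ≫ s = 𝟙 U := by
  obtain ⟨_, _⟩ := hf
  let S := ShortComplex.mk f (cokernel.π f) (by simp)
  have hS : S.ShortExact := { exact := S.exact_of_g_is_cokernel (cokernelIsCokernel f) }
  have : Projective S.X₃ := inferInstanceAs (Projective (cokernel f))
  exact ⟨hS.splittingOfProjective.r, hS.splittingOfProjective.s, hS.splittingOfProjective.f_r,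
    hS.splittingOfProjective.id⟩

/-- The lifting property of a pushout product, without mention of the pushout. -/
theorem exists_lift_pushoutProduct {T U V W M N : C} {f : T ⟶ U} {g : V ⟶ W}
    (hf : Mono f ∧ Projective (cokernel f)) (hg : Mono g ∧ Projective (cokernel g))
    [Projective (cokernel f ⊗ cokernel g)] (e : M ⟶ N) [Epi e] (a : U ⊗ V ⟶ M) (b : T ⊗ W ⟶ M)
    (c : U ⊗ W ⟶ N) (hab : f ▷ V ≫ a = T ◁ g ≫ b) (ha : U ◁ g ≫ c = a ≫ e)
    (hb : f ▷ W ≫ c = b ≫ e) : ∃ l : U ⊗ W ⟶ M, U ◁ g ≫ l = a ∧ f ▷ W ≫ l = b ∧ l ≫ e = c := by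
  obtain ⟨r, s, hr, hrs⟩ := exists_splitting hf
  obtain ⟨r', s', hr', hrs'⟩ := exists_splitting hg
  -- Inclusion–exclusion with the two retractions: `l₀` extends both `a` and `b`, the subtracted
  -- term removing the part counted twice. It need not lift `c`.
  let l₀ := U ◁ r' ≫ a + r ▷ W ≫ b - (r ⊗ₘ r') ≫ f ▷ V ≫ a
  have h₁ : U ◁ g ≫ l₀ = a := by
    simp only [l₀, Preadditive.comp_add, Preadditive.comp_sub]
    rw [← whiskerLeft_comp_assoc, hr', tensorHom_def', whisker_exchange_assoc, hab,
      Category.assoc, ← whiskerLeft_comp_assoc, hr']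
    simp
  have h₂ : f ▷ W ≫ l₀ = b := by
    simp only [l₀, Preadditive.comp_add, Preadditive.comp_sub]
    rw [← comp_whiskerRight_assoc, hr, MonoidalCategory.tensorHom_def, hab, Category.assoc,
      ← comp_whiskerRight_assoc, hr, ← whisker_exchange_assoc, hab]
    simp
  let δ := c - l₀ ≫ e
  have hδ₁ : U ◁ g ≫ δ = 0 := by
    simp only [δ, Preadditive.comp_sub]
    rw [reassoc_of% h₁, ha, sub_self]
  have hδ₂ : f ▷ W ≫ δ = 0 := by
    simp only [δ, Preadditive.comp_sub]
    rw [reassoc_of% h₂, hb, sub_self]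
  -- The error `δ` vanishes on `U ⊗ V` and on `T ⊗ W`, so it factors through the tensor product of
  -- the cokernels. As this object is projective, the error lifts through `e` without disturbing the
  -- restrictions of `l₀`.
  have hδ : (cokernel.π f ⊗ₘ cokernel.π g) ≫ (s ⊗ₘ s') ≫ δ = δ := by
    have h₃ : (cokernel.π f ≫ s) ▷ W ≫ δ = δ := by
      have := congrArg (fun φ => φ ▷ W ≫ δ) hrs
      simpa [hδ₂] using this
    have h₄ : U ◁ (cokernel.π g ≫ s') ≫ δ = δ := by
      have := congrArg (fun φ => U ◁ φ ≫ δ) hrs'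
      simpa [hδ₁] using this
    rw [← Category.assoc, tensorHom_comp_tensorHom, MonoidalCategory.tensorHom_def, Category.assoc, h₄, h₃]
  let lam := Projective.factorThru ((s ⊗ₘ s') ≫ δ) e
  refine ⟨l₀ + (cokernel.π f ⊗ₘ cokernel.π g) ≫ lam, ?_, ?_, ?_⟩
  · rw [Preadditive.comp_add, h₁, ← Category.assoc, tensorHom_def', ← Category.assoc,
      ← whiskerLeft_comp, cokernel.condition]
    simp
  · rw [Preadditive.comp_add, h₂, ← Category.assoc, MonoidalCategory.tensorHom_def, ← Category.assoc,
      ← comp_whiskerRight, cokernel.condition]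
    simp
  · rw [Preadditive.add_comp, Category.assoc, Projective.factorThru_comp, hδ]
    simp [δ]

/-- If projective objects are stable under tensor products, the pushout product of two
cofibrations is a cofibration. -/
theorem cofibs_pushoutProduct
    (hP : ∀ P Q : C, Projective P → Projective Q → Projective (P ⊗ Q)) {T U V W Z : ChainComplex C ℕ} {f : T ⟶ U} {g : V ⟶ W}
    (hf : cofibs C f) (hg : cofibs C g) {i : U ⊗ V ⟶ Z} {j : T ⊗ W ⟶ Z}
    (h : IsPushout (f ▷ V) (T ◁ g) i j) (ι : Z ⟶ U ⊗ W) (hi : i ≫ ι = U ◁ g)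
    (hj : j ≫ ι = f ▷ W) : cofibs C ι := by
  rw [cofibs_iff]
  intro n M N e (he : Epi e)
  refine ⟨fun {t b} sq => ?_⟩
  -- Evaluation in degree `n` preserves the pushout, and the lifting problem then decomposes over
  -- the summands `p + q = n`.
  have hn : IsPushout ((f ▷ V).f n) ((T ◁ g).f n) (i.f n) (j.f n) :=
    h.map (HomologicalComplex.eval C (.down ℕ) n)
  have hi' : i.f n ≫ ι.f n = (U ◁ g).f n := by rw [← hi, HomologicalComplex.comp_f]
  have hj' : j.f n ≫ ι.f n = (f ▷ W).f n := by rw [← hj, HomologicalComplex.comp_f]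
  have key (p q : ℕ) (hpq : p + q = n) := by
    have := hP _ _ (hf p).2 (hg q).2
    exact exists_lift_pushoutProduct (hf p) (hg q) e (tι U V p q n hpq ≫ i.f n ≫ t)
      (tι T W p q n hpq ≫ j.f n ≫ t) (tι U W p q n hpq ≫ b)
      (by rw [← reassoc_of% tι_whiskerRight, ← reassoc_of% tι_whiskerLeft, reassoc_of% hn.w])
      (by rw [← reassoc_of% tι_whiskerLeft, ← hi', Category.assoc, Category.assoc, Category.assoc,
        sq.w])
      (by rw [← reassoc_of% tι_whiskerRight, ← hj', Category.assoc, Category.assoc, Category.assoc,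
        sq.w])
  choose l hl₁ hl₂ hl₃ using key
  refine ⟨⟨⟨tdesc l, hn.hom_ext (tensor_hom_ext fun p q hpq => ?_)
    (tensor_hom_ext fun p q hpq => ?_), tensor_hom_ext fun p q hpq => ?_⟩⟩⟩
  · rw [reassoc_of% hi', reassoc_of% tι_whiskerLeft, tι_tdesc, hl₁]
  · rw [reassoc_of% hj', reassoc_of% tι_whiskerRight, tι_tdesc, hl₂]
  · rw [reassoc_of% tι_tdesc, hl₃]

end PushoutProduct

/-! ### Short exact sequences and quasi-isomorphisms -/

section ShortExact

variable {C : Type u} [Category.{v} C] [Abelian C] {S : ShortComplex (ChainComplex C ℕ)}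

theorem quasiIso_f_of_acyclic (hS : S.ShortExact) (h : S.X₃.Acyclic) : QuasiIso S.f where
  quasiIsoAt n := by
    rw [quasiIsoAt_iff_isIso_homologyMap]
    have h' (n : ℕ) : IsZero (S.X₃.homology n) := by
      rw [← HomologicalComplex.exactAt_iff_isZero_homology]
      exact h n
    have : Mono (HomologicalComplex.homologyMap S.f n) :=
      (hS.homology_exact₁ (n + 1) n rfl).mono_g ((h' _).eq_of_src _ _)
    have : Epi (HomologicalComplex.homologyMap S.f n) :=
      (hS.homology_exact₂ n).epi_f ((h' _).eq_of_tgt _ _)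
    exact isIso_of_mono_of_epi _

theorem quasiIso_g_of_acyclic (hS : S.ShortExact) (h : S.X₁.Acyclic) : QuasiIso S.g where
  quasiIsoAt n := by
    rw [quasiIsoAt_iff_isIso_homologyMap]
    have h' (n : ℕ) : IsZero (S.X₁.homology n) := by
      rw [← HomologicalComplex.exactAt_iff_isZero_homology]
      exact h n
    have : Mono (HomologicalComplex.homologyMap S.g n) :=
      (hS.homology_exact₂ n).mono_g ((h' _).eq_of_src _ _)
    have : Epi (HomologicalComplex.homologyMap S.g n) := by
      rcases n with _ | n
      -- In degree `0` there is no connecting map to use; there an epimorphism of complexes is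
      -- directly an epimorphism on homology.
      · have := hS.epi_g
        exact HomologicalComplex.epi_homologyMap_of_epi_of_not_rel S.g 0 (by simp)
      · exact (hS.homology_exact₃ (n + 1) n rfl).epi_f ((h' _).eq_of_tgt _ _)
    exact isIso_of_mono_of_epi _

/-- Monomorphisms that are quasi-isomorphisms are stable under pushouts. -/
theorem quasiIso_inr_of_isPushout {A B A' Z : ChainComplex C ℕ} {f : A ⟶ B} {g : A ⟶ A'}
    {i : B ⟶ Z} {j : A' ⟶ Z} (h : IsPushout f g i j) [Mono f] [QuasiIso f] : QuasiIso j := by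
  let S := ShortComplex.mk f (cokernel.π f) (by simp)
  have hS : S.ShortExact := { exact := S.exact_of_g_is_cokernel (cokernelIsCokernel f) }
  have hZ : (cokernel f).Acyclic := hS.acyclic_X₃ ‹_›
  -- The pushout `j` of `f` has the same cokernel as `f`, and this cokernel is acyclic.
  let π : Z ⟶ cokernel f := h.desc (cokernel.π f) 0 (by simp)
  have hi : i ≫ π = cokernel.π f := h.inl_desc _ _ _
  have hj : j ≫ π = 0 := h.inr_desc _ _ _
  let S' := ShortComplex.mk j π hj
  have : Mono S'.f := Abelian.mono_inr_of_isColimit (s := h.cocone) f g h.isColimit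
  have : Epi S'.g := epi_of_epi_fac hi
  have hS' : S'.ShortExact :=
    { exact := S'.exact_of_g_is_cokernel (CokernelCofork.IsColimit.ofπ' π hj fun {W} k hk =>
        ⟨cokernel.desc f (i ≫ k) (by rw [h.w_assoc, hk, comp_zero]),
          h.hom_ext (by rw [reassoc_of% hi, cokernel.π_desc])
            (by rw [reassoc_of% hj, zero_comp, hk])⟩) }
  exact quasiIso_f_of_acyclic hS' hZ

end ShortExact

/-! ### Trivial cofibrations and the pushout product -/

section PushoutProductQuasiIso

open MorphismProperty

variable {C : Type u} [Category.{v} C] [Abelian C] [MonoidalCategory C] [MonoidalPreadditive C]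
  [SymmetricCategory C]

attribute [local instance] chainMonoidal

/-- The projection on a summand of the tensor product. -/
def tπ (K L : ChainComplex C ℕ) (p q n : ℕ) : (K ⊗ L).X n ⟶ K.X p ⊗ L.X q :=
  tdesc fun p' q' _ => if h : p' = p ∧ q' = q then eqToHom (by rw [h.1, h.2]) else 0

theorem tι_tπ_self (K L : ChainComplex C ℕ) (p q n : ℕ) (h : p + q = n) :
    tι K L p q n h ≫ tπ K L p q n = 𝟙 _ := by
  rw [tπ, tι_tdesc]
  simp

theorem tι_tπ_of_ne (K L : ChainComplex C ℕ) (p q n : ℕ) (h : p + q = n) {p' q' : ℕ}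
    (hp : ¬ (p = p' ∧ q = q')) : tι K L p q n h ≫ tπ K L p' q' n = 0 := by
  rw [tπ, tι_tdesc, dif_neg hp]

/-- Each term of the tensor product is a finite direct sum, so the projections are jointly monic.
Injectivity can therefore be tested summand by summand. -/
theorem sum_tπ_tι (K L : ChainComplex C ℕ) (n : ℕ) :
    ∑ x : Finset.HasAntidiagonal.antidiagonal n, tπ K L x.1.1 x.1.2 n ≫
      tι K L x.1.1 x.1.2 n (Finset.HasAntidiagonal.mem_antidiagonal.1 x.2) =
        𝟙 ((K ⊗ L).X n) := by
  refine tensor_hom_ext fun p q h => ?_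
  rw [Preadditive.comp_sum, Finset.sum_eq_single ⟨(p, q), Finset.HasAntidiagonal.mem_antidiagonal.2 h⟩]
  · rw [reassoc_of% tι_tπ_self, Category.comp_id]
  · rintro ⟨⟨p', q'⟩, _⟩ _ hne
    rw [← Category.assoc, tι_tπ_of_ne, zero_comp]
    rintro ⟨rfl, rfl⟩
    exact hne rfl
  · simp

theorem tensor_hom_ext_to {K L : ChainComplex C ℕ} {n : ℕ} {A : C} {φ ψ : A ⟶ (K ⊗ L).X n}
    (h : ∀ p q, p + q = n → φ ≫ tπ K L p q n = ψ ≫ tπ K L p q n) : φ = ψ := by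
  rw [← Category.comp_id φ, ← Category.comp_id ψ, ← sum_tπ_tι, Preadditive.comp_sum,
    Preadditive.comp_sum]
  refine Finset.sum_congr rfl fun x _ => ?_
  rw [← Category.assoc, h _ _ (Finset.HasAntidiagonal.mem_antidiagonal.1 x.2), Category.assoc]

theorem whiskerRight_f_tπ {K K' : ChainComplex C ℕ} (f : K ⟶ K') (L : ChainComplex C ℕ)
    (p q n : ℕ) : (f ▷ L).f n ≫ tπ K' L p q n = tπ K L p q n ≫ f.f p ▷ L.X q := by
  refine tensor_hom_ext fun p' q' h => ?_
  rw [reassoc_of% tι_whiskerRight]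
  by_cases hp : p' = p ∧ q' = q
  · obtain ⟨rfl, rfl⟩ := hp
    rw [tι_tπ_self, reassoc_of% tι_tπ_self, Category.comp_id]
  · rw [tι_tπ_of_ne _ _ _ _ _ _ hp, ← Category.assoc, tι_tπ_of_ne _ _ _ _ _ _ hp, zero_comp,
      comp_zero]

theorem mono_whiskerRight {K K' : ChainComplex C ℕ} (f : K ⟶ K') (L : ChainComplex C ℕ)
    (h : ∀ p q, Mono (f.f p ▷ L.X q)) : Mono (f ▷ L) := by
  refine HomologicalComplex.mono_of_mono_f _ fun n => ⟨fun x y hxy => ?_⟩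
  refine tensor_hom_ext_to fun p q _ => ?_
  have := h p q
  rw [← cancel_mono (f.f p ▷ L.X q), Category.assoc, Category.assoc, ← whiskerRight_f_tπ,
    reassoc_of% hxy]

/-- Cofibrations are degreewise split, and split monomorphisms survive tensoring with any object,
flat or not. -/
theorem mono_whiskerRight_of_cofibs {K K' : ChainComplex C ℕ} {f : K ⟶ K'} (hf : cofibs C f)
    (L : ChainComplex C ℕ) : Mono (f ▷ L) :=
  mono_whiskerRight f L fun p q => by
    obtain ⟨r, _, hr, _⟩ := exists_splitting (hf p)
    exact mono_of_mono_fac (show f.f p ▷ L.X q ≫ r ▷ L.X q = 𝟙 _ by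
      rw [← comp_whiskerRight, hr, id_whiskerRight])

variable [EnoughProjectives C]

theorem quasiIso_biprod_inl_whiskerRight (T : ChainComplex C ℕ) {G : ℕ → C} (hG : IsZero (G 0))
    (V : ChainComplex C ℕ) : QuasiIso ((biprod.inl : T ⟶ T ⊞ disks G) ▷ V) :=
  inferInstanceAs (QuasiIso (homotopyEquivWhiskerRight
    (homotopyEquivBiprod T _ (disks.homotopy hG)) V).hom)

/-- A trivial cofibration is a retract of the inclusion of `T` into its sum with contractible disks.
That inclusion is a homotopy equivalence and remains one after tensoring, so no flatness of `V` is
required. -/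
theorem quasiIso_whiskerRight_of_trivCofibs {T U : ChainComplex C ℕ} {f : T ⟶ U}
    (hf : cofibs C f) (hf' : QuasiIso f) (V : ChainComplex C ℕ) : QuasiIso (f ▷ V) := by
  have h : (fibs C).llp f := by
    rw [llp_fibs]
    exact ⟨hf, hf'⟩
  have := h _ (fibs_desc_coversπ U f)
  have : QuasiIso ((tensorRight V).map (biprod.inl : T ⟶ T ⊞ disks (covers U))) :=
    quasiIso_biprod_inl_whiskerRight T (isZero_covers U) V
  exact quasiIso_of_retractArrow ((RetractArrow.ofLeftLiftingProperty
    (biprod.inl_desc f (disks.desc (coversπ U)))).map (tensorRight V))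

attribute [local instance] chainSymmetric in
/-- Symmetry of the tensor product of chain complexes. -/
def arrowIsoWhisker {T U : ChainComplex C ℕ} (f : T ⟶ U) (V : ChainComplex C ℕ) :
    CategoryTheory.Arrow.mk (f ▷ V) ≅ CategoryTheory.Arrow.mk (V ◁ f) :=
  CategoryTheory.Arrow.isoMk (β_ T V) (β_ U V) (BraidedCategory.braiding_naturality_left f V).symm

theorem quasiIso_whiskerLeft_iff {T U : ChainComplex C ℕ} (f : T ⟶ U) (V : ChainComplex C ℕ) :
    QuasiIso (V ◁ f) ↔ QuasiIso (f ▷ V) :=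
  ((qis C).arrow_mk_iso_iff (arrowIsoWhisker f V)).symm

theorem mono_whiskerLeft_iff {T U : ChainComplex C ℕ} (f : T ⟶ U) (V : ChainComplex C ℕ) :
    Mono (V ◁ f) ↔ Mono (f ▷ V) :=
  ((monomorphisms _).arrow_mk_iso_iff (arrowIsoWhisker f V)).symm

/-- If `f` is trivial, so is `f ▷ V`, and hence its pushout `j` is a quasi-isomorphism; since `j ≫ ι
= f ▷ W` is one too, two-out-of-three applies. The case of `g` is symmetric. -/
theorem quasiIso_pushoutProduct {T U V W Z : ChainComplex C ℕ} {f : T ⟶ U} {g : V ⟶ W}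
    (hf : cofibs C f) (hg : cofibs C g) {i : U ⊗ V ⟶ Z} {j : T ⊗ W ⟶ Z}
    (h : IsPushout (f ▷ V) (T ◁ g) i j) (ι : Z ⟶ U ⊗ W) (hi : i ≫ ι = U ◁ g)
    (hj : j ≫ ι = f ▷ W) (hfg : QuasiIso f ∨ QuasiIso g) : QuasiIso ι := by
  rcases hfg with hfg | hfg
  · have := mono_whiskerRight_of_cofibs hf V
    have := quasiIso_whiskerRight_of_trivCofibs hf hfg V
    have := quasiIso_whiskerRight_of_trivCofibs hf hfg W
    have := quasiIso_inr_of_isPushout h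
    rw [← hj] at *
    exact quasiIso_of_comp_left j ι
  · have := (mono_whiskerLeft_iff g T).2 (mono_whiskerRight_of_cofibs hg T)
    have := (quasiIso_whiskerLeft_iff g T).2 (quasiIso_whiskerRight_of_trivCofibs hg hfg T)
    have := (quasiIso_whiskerLeft_iff g U).2 (quasiIso_whiskerRight_of_trivCofibs hg hfg U)
    have := quasiIso_inr_of_isPushout h.flip
    rw [← hi] at *
    exact quasiIso_of_comp_left i ι

end PushoutProductQuasiIso

/-! ### Tensoring with degreewise flat complexes -/

section Flat

variable {C : Type u} [Category.{v} C] [Abelian C] [MonoidalCategory C] [MonoidalPreadditive C]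
  [SymmetricCategory C]

attribute [local instance] chainMonoidal

instance (M : ChainComplex C ℕ) : (tensorRight M).PreservesZeroMorphisms where
  map_zero K L := by
    ext n
    refine tensor_hom_ext fun p q h => (tι_whiskerRight (0 : K ⟶ L) M p q n h).trans ?_
    simp

/-- A complex is degreewise flat. -/
def IsDegreewiseFlat (M : ChainComplex C ℕ) : Prop :=
  ∀ (q : ℕ) {A B : C} (f : A ⟶ B), Mono f → Mono (f ▷ M.X q)

theorem acyclic_disks_tensor {G : ℕ → C} (hG : IsZero (G 0)) (M : ChainComplex C ℕ) :
    (disks G ⊗ M).Acyclic := fun n => by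
  have H : Homotopy (𝟙 (disks G ⊗ M)) 0 :=
    (Homotopy.ofEq (id_whiskerRight (disks G) M).symm).trans
      ((HomologicalComplex.mapBifunctorMapHomotopy₁ (disks.homotopy hG) (𝟙 M) (curriedTensor C)
        (.down ℕ)).trans (Homotopy.ofEq ((tensorRight M).map_zero _ _)))
  rw [HomologicalComplex.exactAt_iff_isZero_homology, IsZero.iff_id_eq_zero,
    ← HomologicalComplex.homologyMap_id, H.homologyMap_eq, HomologicalComplex.homologyMap_zero]

variable [∀ X : C, PreservesFiniteColimits (tensorLeft X)]

attribute [local instance] chainSymmetric in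
theorem preservesFiniteColimits_tensorRight (M : ChainComplex C ℕ) :
    PreservesFiniteColimits (tensorRight M) :=
  ⟨fun J _ _ => by
    have := preservesColimitsOfShape_tensorLeft M J
    exact preservesColimitsOfShape_of_natIso (BraidedCategory.tensorLeftIsoTensorRight M)⟩

/-- Right exactness comes from preservation of finite colimits, and degreewise flatness supplies
injectivity on the left. -/
theorem shortExact_map_tensorRight {M : ChainComplex C ℕ} (hM : IsDegreewiseFlat M)
    {S : ShortComplex (ChainComplex C ℕ)} (hS : S.ShortExact) :
    (S.map (tensorRight M)).ShortExact := by
  have := preservesFiniteColimits_tensorRight M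
  have := hS.epi_g
  have := hS.mono_f
  have : Mono (S.map (tensorRight M)).f :=
    mono_whiskerRight S.f M fun p q => hM q _ inferInstance
  have : Epi (S.map (tensorRight M)).g := inferInstanceAs (Epi ((tensorRight M).map S.g))
  exact { exact := hS.exact.map_of_epi_of_preservesCokernel (tensorRight M) inferInstance inferInstance }

variable [EnoughProjectives C]

theorem epi_of_trivial_fibration {X Y : ChainComplex C ℕ} {p : X ⟶ Y} (hp : fibs C p)
    (hp' : QuasiIso p) : Epi p := by
  have := (fibs_inf_qis_iff p).1 ⟨hp, hp'⟩
  have (n : ℕ) : Epi (p.f n) := epi_of_forall_projective _ fun P _ => (this P).exists_lift n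
  exact HomologicalComplex.epi_of_epi_f p this

theorem shortExact_kernel {X Y : ChainComplex C ℕ} (p : X ⟶ Y) [Epi p] :
    (ShortComplex.mk (kernel.ι p) p (by simp)).ShortExact where
  exact := ShortComplex.exact_of_f_is_kernel _ (kernelIsKernel p)

/-- Dimension shifting. An acyclic `N` is the quotient of a contractible complex by an acyclic `N'`,
so the homology of `N ⊗ M` in degree `n` embeds in that of `N' ⊗ M` in degree `n - 1`. Induction
starts at degree `0`, below which there is nothing. -/
theorem exactAt_tensor {M : ChainComplex C ℕ} (hM : IsDegreewiseFlat M) (n : ℕ) :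
    ∀ N : ChainComplex C ℕ, N.Acyclic → (N ⊗ M).ExactAt n := by
  have key (N : ChainComplex C ℕ) (hN : N.Acyclic) (n : ℕ)
      (h : ∀ N' : ChainComplex C ℕ, N'.Acyclic → ∀ j, j + 1 = n → (N' ⊗ M).ExactAt j) :
      (N ⊗ M).ExactAt n := by
    let p : disks (covers N) ⟶ N := disks.desc (coversπ N)
    have hp : fibs C p := fun n hn => by
      have := fibs_desc_coversπ N (0 : N ⟶ N) n hn
      have e : biprod.desc (0 : N ⟶ N) p = biprod.snd ≫ p := biprod.hom_ext' _ _ (by simp) (by simp)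
      change Epi ((biprod.desc (0 : N ⟶ N) p).f n) at this
      rw [e, HomologicalComplex.comp_f] at this
      exact @epi_of_epi _ _ _ _ _ _ _ this
    have hp' : QuasiIso p := ⟨fun n => by
      rw [quasiIsoAt_iff_exactAt _ _ (disks.acyclic (isZero_covers N) n)]
      exact hN n⟩
    -- The disks have no generator over degree `0`, yet `p` is surjective there as well, being a
    -- fibration between acyclic complexes and hence a trivial one.
    have := epi_of_trivial_fibration hp hp'
    have hS := shortExact_kernel p
    refine (shortExact_map_tensorRight hM hS).exactAt_X₃ n ?_ fun j hj => ?_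
    · refine IsZero.epi ?_ _
      rw [← HomologicalComplex.exactAt_iff_isZero_homology]
      exact acyclic_disks_tensor (isZero_covers N) M n
    · refine IsZero.mono ?_ _
      rw [← HomologicalComplex.exactAt_iff_isZero_homology]
      exact h _ (hS.acyclic_X₁ hp') j hj
  induction n with
  | zero => exact fun N hN => key N hN 0 fun _ _ j hj => absurd hj (by simp)
  | succ n ih =>
    exact fun N hN => key N hN (n + 1) fun N' hN' j hj => Nat.succ_injective hj ▸ ih N' hN'

/-- Factor `f` as the inclusion into a sum with contractible disks followed by a surjection with
acyclic kernel. The first is a homotopy equivalence, preserved by tensoring; for the second,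
flatness keeps the kernel sequence exact and the tensored kernel is acyclic by `exactAt_tensor`. -/
theorem quasiIso_whiskerRight {M : ChainComplex C ℕ} (hM : IsDegreewiseFlat M)
    {K L : ChainComplex C ℕ} (f : K ⟶ L) (hf : QuasiIso f) : QuasiIso (f ▷ M) := by
  let p : K ⊞ disks (covers L) ⟶ L := biprod.desc f (disks.desc (coversπ L))
  have hp : fibs C p := fibs_desc_coversπ L f
  have h : biprod.inl ≫ p = f := biprod.inl_desc _ _
  have : QuasiIso (biprod.inl : K ⟶ K ⊞ disks (covers L)) :=
    inferInstanceAs (QuasiIso (homotopyEquivBiprod K _ (disks.homotopy (isZero_covers L))).hom)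
  have hp' : QuasiIso p := by
    rw [← h] at hf
    exact quasiIso_of_comp_left biprod.inl p
  have := epi_of_trivial_fibration hp hp'
  have hS := shortExact_kernel p
  have hK := hS.acyclic_X₁ hp'
  have : QuasiIso (p ▷ M) := quasiIso_g_of_acyclic (shortExact_map_tensorRight hM hS)
    fun n => exactAt_tensor hM n _ hK
  have := quasiIso_biprod_inl_whiskerRight K (isZero_covers L) M
  rw [← h, comp_whiskerRight]
  infer_instance

end Flat

/-! ### Projectivity from a filtration with projective graded pieces -/

section Filtration

open DFinsupp

variable {R : Type*} [Ring R] {E : Type*} [AddCommGroup E] [Module R E] (F : ℕ → Submodule R E)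

/-- The graded pieces of a filtration. -/
abbrev grPiece (n : ℕ) : Submodule R (E ⧸ F n) := (F (n + 1)).map (F n).mkQ

/-- The union of submodules `0 = F 0 ≤ F 1 ≤ ⋯` is projective if the graded pieces are. -/
theorem projective_of_filtration (hF : Monotone F) (h₀ : F 0 = ⊥)
    (hgr : ∀ n, Module.Projective R (grPiece F n)) {V : Type*} [AddCommGroup V] [Module R V]
    (j : V →ₗ[R] E) (hj : Function.Injective j) (hjF : ∀ x, x ∈ LinearMap.range j ↔ ∃ n, x ∈ F n) :
    Module.Projective R V := by
  have hσ (n : ℕ) : ∃ σ : grPiece F n →ₗ[R] F (n + 1), ∀ y, (F n).mkQ (σ y) = y := by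
    let π : F (n + 1) →ₗ[R] grPiece F n :=
      (F n).mkQ.restrict fun x hx => Submodule.mem_map_of_mem hx
    have hπ : Function.Surjective π := by
      rintro ⟨_, x, hx, rfl⟩
      exact ⟨⟨x, hx⟩, rfl⟩
    obtain ⟨σ, hσ⟩ := Module.projective_lifting_property π LinearMap.id hπ
    exact ⟨σ, fun y => congrArg Subtype.val (LinearMap.congr_fun hσ y)⟩
  choose σ hσ using hσ
  -- Sections of the projections to the graded pieces assemble to a map from their direct sum, which
  -- will be an isomorphism onto the union of the filtration.
  let Φ : (Π₀ n, grPiece F n) →ₗ[R] E :=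
    DFinsupp.lsum ℕ fun n => (F (n + 1)).subtype.comp (σ n)
  have hΦs (n : ℕ) (y : grPiece F n) : Φ (DFinsupp.single n y) = σ n y :=
    DFinsupp.lsum_single _ _ _ _
  have hrange (n : ℕ) : ∀ x ∈ F n, x ∈ LinearMap.range Φ := by
    induction n with
    | zero =>
      intro x hx
      rw [h₀, Submodule.mem_bot] at hx
      exact hx ▸ zero_mem _
    | succ n ih =>
      intro x hx
      let y : grPiece F n := ⟨(F n).mkQ x, Submodule.mem_map_of_mem hx⟩
      have hxy : x - σ n y ∈ F n := by
        rw [← Submodule.Quotient.eq]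
        exact (hσ n y).symm
      rw [← sub_add_cancel x (σ n y)]
      exact add_mem (ih _ hxy) ⟨DFinsupp.single n y, hΦs n y⟩
  have hmem (n : ℕ) (x : Π₀ n, grPiece F n) (hx : ∀ m, n ≤ m → x m = 0) : Φ x ∈ F n := by
    classical
    rw [← DFinsupp.sum_single (f := x), DFinsupp.sum, map_sum]
    refine Submodule.sum_mem _ fun m hm => ?_
    rw [hΦs]
    have hmn : m < n := by
      by_contra! h
      simp [hx m h] at hm
    exact hF hmn (σ m _).2
  have hbound (x : Π₀ n, grPiece F n) : ∃ n, ∀ m, n ≤ m → x m = 0 := by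
    classical
    refine ⟨x.support.sup id + 1, fun m hm => ?_⟩
    by_contra h
    have := Finset.le_sup (f := id) (DFinsupp.mem_support_iff.2 h)
    simp only [id] at this
    omega
  have hinj : Function.Injective Φ := by
    rw [injective_iff_map_eq_zero]
    -- An element of the kernel loses its top component: modulo `F n` only that component
    -- contributes to the image. Descending to bound `0` gives injectivity.
    have key (n : ℕ) : ∀ x : Π₀ n, grPiece F n, (∀ m, n ≤ m → x m = 0) → Φ x = 0 → x = 0 := by
      induction n with
      | zero =>
        intro x hx _
        ext m
        simp [hx m (Nat.zero_le m)]
      | succ n ih =>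
        intro x hx hΦ
        have he : Φ (x.erase n) ∈ F n := hmem n _ fun m hm => by
          rcases hm.eq_or_lt with rfl | hm
          · simp
          · rw [DFinsupp.erase_ne hm.ne', hx m hm]
        have hxn : x n = 0 := by
          refine Subtype.ext ?_
          rw [← hσ n (x n)]
          refine (Submodule.Quotient.mk_eq_zero _).2 ?_
          have : (σ n (x n) : E) = - Φ (x.erase n) := by
            rw [← hΦs, eq_neg_iff_add_eq_zero, ← map_add, DFinsupp.single_add_erase, hΦ]
          rw [this]
          exact neg_mem he
        refine ih x (fun m hm => ?_) hΦ
        rcases hm.eq_or_lt with rfl | hm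
        · exact hxn
        · exact hx m hm
    intro x hx
    obtain ⟨n, hn⟩ := hbound x
    exact key n x hn hx
  have hr : LinearMap.range Φ = LinearMap.range j := by
    ext x
    rw [hjF]
    refine ⟨?_, fun ⟨n, hn⟩ => hrange n x hn⟩
    rintro ⟨y, rfl⟩
    obtain ⟨n, hn⟩ := hbound y
    exact ⟨n, hmem n y hn⟩
  exact Module.Projective.of_equiv ((LinearEquiv.ofInjective Φ hinj).trans
    ((LinearEquiv.ofEq _ _ hr).trans (LinearEquiv.ofInjective j hj).symm))

end Filtration

/-! ### Differential operators are projective over functions -/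

section ProjectiveOperators

variable (k : Type v) (O : Type u) [Field k] [CommRing O] [Algebra k O]

/-- The commutator with a function. -/
def bracketOp (a : O) : Module.End k O →ₗ[O] Module.End k O where
  toFun P := P * mulOp k O a - mulOp k O a * P
  map_add' P Q := by noncomm_ring
  map_smul' c P := by
    ext f
    simp
    ring_nf

variable {k O} in
/-- Composition with a vector field. -/
def mulDer (θ : Derivation k O O) : Module.End k O →ₗ[O] Module.End k O where
  toFun P := P * (θ : O →ₗ[k] O)
  map_add' P Q := add_mul _ _ _
  map_smul' c P := by
    ext f
    simp

/-- Evaluation of an operator at `1`. -/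
def evalOne : Module.End k O →ₗ[O] O where
  toFun P := P 1
  map_add' _ _ := rfl
  map_smul' _ _ := rfl

/-- An operator that commutes with all functions is multiplication by its value at `1`, so
evaluation at `1` splits this piece off `O`. -/
theorem projective_grPiece_zero : Module.Projective O (grPiece (orderLT k O) 0) := by
  let i : grPiece (orderLT k O) 0 →ₗ[O] O :=
    ((orderLT k O 0).liftQ (evalOne k O) (fun P hP => by
        obtain rfl : P = 0 := hP
        exact map_zero _)).comp (Submodule.subtype _)
  let s : O →ₗ[O] grPiece (orderLT k O) 0 := LinearMap.toSpanSingleton O _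
    ⟨(orderLT k O 0).mkQ (mulOp k O 1), Submodule.mem_map_of_mem (mulOp_mem_orderLT 1)⟩
  refine Module.Projective.of_split i s (LinearMap.ext ?_)
  rintro ⟨_, P, hP, rfl⟩
  refine Subtype.ext ?_
  change (P 1) • (orderLT k O 0).mkQ (mulOp k O 1) = (orderLT k O 0).mkQ P
  rw [← map_smul]
  congr 1
  ext a
  have h : P * mulOp k O a - mulOp k O a * P = 0 := hP a
  have := LinearMap.congr_fun (sub_eq_zero.1 h) 1
  simp only [Module.End.mul_apply, mulOp_apply, mul_one] at this
  simp [this, mul_comm]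

variable [CharZero k]

/-- The symbol is sent to its brackets with the coordinates `x`, and it is recovered as the sum of
the `[P, x] ∂_x` divided by `n + 1`, by the Euler identity. This realizes the piece as a direct
summand of finitely many copies of the preceding one; characteristic zero permits the division. -/
theorem projective_grPiece_succ {S : Finset O} {p : O → Derivation k O O}
    (h : ∀ a : O, KaehlerDifferential.D k O a = ∑ x ∈ S, p x a • KaehlerDifferential.D k O x)
    (n : ℕ) [Module.Projective O (grPiece (orderLT k O) n)] :
    Module.Projective O (grPiece (orderLT k O) (n + 1)) := by
  have : Module.Projective O (S → grPiece (orderLT k O) n) :=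
    Module.Projective.of_equiv DFinsupp.linearEquivFunOnFintype
  let i : grPiece (orderLT k O) (n + 1) →ₗ[O] (S → grPiece (orderLT k O) n) :=
    LinearMap.pi fun x => ((orderLT k O (n + 1)).mapQ (orderLT k O n) (bracketOp k O x)
      (fun P hP => hP x)).restrict (by
        rintro _ ⟨P, hP, rfl⟩
        exact ⟨bracketOp k O x P, hP x, rfl⟩)
  let s : (S → grPiece (orderLT k O) n) →ₗ[O] grPiece (orderLT k O) (n + 1) :=
    algebraMap k O ((n + 1 : ℕ) : k)⁻¹ • ∑ x : S,
      (((orderLT k O n).mapQ (orderLT k O (n + 1)) (mulDer (p x)) (fun P hP => by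
        -- `mul_mem_orderLT` speaks of operators of order below a successor; below order `0` only
        -- the zero operator occurs.
        rcases n with _ | n
        · obtain rfl : P = 0 := hP
          exact zero_mem _
        · exact mul_mem_orderLT n 1 hP (derivation_mem_orderLT (p x)))).restrict (by
        rintro _ ⟨P, hP, rfl⟩
        exact ⟨mulDer (p x) P, mul_mem_orderLT n 1 hP (derivation_mem_orderLT (p x)), rfl⟩)).comp
        (LinearMap.proj x)
  refine Module.Projective.of_split i s (LinearMap.ext ?_)
  rintro ⟨_, P, hP, rfl⟩
  refine Subtype.ext ?_
  have hE := euler_orderLT h (n + 1) P hP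
  rw [← Submodule.Quotient.eq] at hE
  have e : ((s (i ⟨_, P, hP, rfl⟩) : grPiece (orderLT k O) (n + 1)) :
      Module.End k O ⧸ orderLT k O (n + 1)) = algebraMap k O ((n + 1 : ℕ) : k)⁻¹ •
        (orderLT k O (n + 1)).mkQ
          (∑ x ∈ S, (P * mulOp k O x - mulOp k O x * P) * (p x : O →ₗ[k] O)) := by
    rw [map_sum, ← Finset.sum_coe_sort S]
    simp only [s, LinearMap.smul_apply, LinearMap.sum_apply, Submodule.coe_smul,
      Submodule.coe_sum]
    rfl
  rw [LinearMap.comp_apply, e, Submodule.mkQ_apply, hE, ← Submodule.mkQ_apply, map_nsmul,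
    ← Nat.cast_smul_eq_nsmul O, smul_smul, ← map_natCast (algebraMap k O), ← map_mul,
    inv_mul_cancel₀ (Nat.cast_ne_zero.2 n.succ_ne_zero), map_one, one_smul]
  rfl

variable [Algebra.Smooth k O]

theorem projective_grPiece (n : ℕ) : Module.Projective O (grPiece (orderLT k O) n) := by
  obtain ⟨S, p, h⟩ := exists_coords k O
  induction n with
  | zero => exact projective_grPiece_zero k O
  | succ n ih => exact projective_grPiece_succ k O h n

/-- Differential operators form a projective module over functions. -/
theorem projective_toO_diffOp :
    Module.Projective O ((toO k O).obj (ModuleCat.of (DiffOp k O) (DiffOp k O))) := by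
  let j : (toO k O).obj (ModuleCat.of (DiffOp k O) (DiffOp k O)) →ₗ[O] Module.End k O :=
    { toFun := fun P : DiffOp k O => (P : Module.End k O)
      map_add' := fun _ _ => rfl
      map_smul' := fun a (P : DiffOp k O) => mulOp_mul a (P : Module.End k O) }
  refine projective_of_filtration (orderLT k O) orderLT_mono rfl (projective_grPiece k O) j
    Subtype.val_injective fun P => ⟨?_, fun hP => ⟨(⟨P, hP⟩ : DiffOp k O), rfl⟩⟩
  rintro ⟨Q, rfl⟩
  exact (show DiffOp k O from Q).2

end ProjectiveOperators

/-! ### Projectivity, flatness and internal Hom for `D`-modules -/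

section DModules

open TensorProduct

variable {k : Type v} {O : Type u} [Field k] [CommRing O] [Algebra k O]
  [CharZero k] [Algebra.Smooth k O]

/-- Coextension is the functor of `O`-linear maps out of `D`, and `D` is `O`-projective. As it is
right adjoint to the forgetful functor, the latter preserves projectives. -/
instance : (ModuleCat.coextendScalars.{u, u, u} (ofFun k O)).PreservesEpimorphisms where
  preserves {M N} g hg := by
    rw [ModuleCat.epi_iff_surjective] at hg ⊢
    intro ψ
    have := projective_toO_diffOp k O
    obtain ⟨φ, hφ⟩ := Module.projective_lifting_property g.hom
      (show (toO k O).obj (ModuleCat.of (DiffOp k O) (DiffOp k O)) →ₗ[O] N from ψ) hg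
    exact ⟨φ, hφ⟩

/-- Projective `D`-modules are projective over functions. -/
theorem projective_toO_obj (P : DModCat k O) [Projective P] :
    Module.Projective O ((toO k O).obj P) := by
  rw [IsProjective.iff_projective]
  exact (ModuleCat.restrictCoextendScalarsAdj (ofFun k O)).map_projective P inferInstance

/-- A projective `D`-module is projective, hence flat, over `O`; the tensor product is formed over
`O` and the forgetful functor reflects monomorphisms. -/
theorem mono_whiskerRight_of_projective (P : DModCat k O) [Projective P] {A B : DModCat k O}
    (f : A ⟶ B) [Mono f] : Mono (f ▷ P) := by
  have := projective_toO_obj P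
  refine (toO k O).mono_of_mono_map ?_
  have e : (toO k O).map (f ▷ P) = (muIso A P).inv ≫ ((toO k O).map f ▷ (toO k O).obj P) ≫
      (muIso B P).hom := inducingData.whiskerRight_eq f P
  rw [e]
  have : Mono ((toO k O).map f ▷ (toO k O).obj P) := by
    rw [ModuleCat.mono_iff_injective]
    exact Module.Flat.rTensor_preserves_injective_linearMap ((toO k O).map f).hom
      ((ModuleCat.mono_iff_injective _).1 inferInstance)
  infer_instance

/-- The forgetful functor to `O`-modules has a right adjoint and reflects isomorphisms, so it
preserves and reflects colimits. The claim reduces to the tensor product of `O`-modules. -/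
theorem preservesColimits_tensorLeft (M : DModCat k O) :
    PreservesColimitsOfSize.{u, u} (tensorLeft M) := by
  let e : tensorLeft M ⋙ toO k O ≅ toO k O ⋙ tensorLeft ((toO k O).obj M) :=
    NatIso.ofComponents (fun N => (muIso M N).symm) (fun {N N'} f => by
      have : (toO k O).map (M ◁ f) = (muIso M N).inv ≫ ((toO k O).obj M ◁ (toO k O).map f) ≫
        (muIso M N').hom := inducingData.whiskerLeft_eq M f
      dsimp
      rw [this]
      simp)
  have : PreservesColimitsOfSize.{u, u} (toO k O) :=
    (ModuleCat.restrictCoextendScalarsAdj.{u, u, u} (ofFun k O)).leftAdjoint_preservesColimits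
  have : PreservesColimitsOfSize.{u, u} (tensorLeft M ⋙ toO k O) :=
    preservesColimits_of_natIso e.symm
  have : ReflectsColimitsOfSize.{u, u} (toO k O) := reflectsColimits_of_reflectsIsomorphisms
  exact preservesColimits_of_reflects_of_preserves _ (toO k O)

namespace FlatConnection

variable {V W : Type u} [AddCommGroup V] [Module O V] [AddCommGroup W] [Module O W]

/-- The flat connection on linear maps, `(θ g) v = θ (g v) - g (θ v)`. -/
def ihom (c : FlatConnection k O V) (d : FlatConnection k O W) :
    FlatConnection k O (V →ₗ[O] W) where
  nabla θ := AddMonoidHom.mk' (fun g =>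
      { toFun := fun v => d.nabla θ (g v) - g (c.nabla θ v)
        map_add' := fun v w => by simp only [map_add]; abel
        map_smul' := fun a v => by
          simp only [map_smul, leibniz, map_add, RingHom.id_apply, smul_sub]
          abel }) (fun g g' => by
        ext v
        simp only [LinearMap.coe_mk, AddHom.coe_mk, LinearMap.add_apply, map_add]
        abel)
  nabla_add θ η g := by
    ext v
    simp only [AddMonoidHom.mk'_apply, LinearMap.coe_mk, AddHom.coe_mk, LinearMap.add_apply,
      nabla_add, map_add]
    abel
  nabla_smul a θ g := by
    ext v
    simp only [AddMonoidHom.mk'_apply, LinearMap.coe_mk, AddHom.coe_mk, LinearMap.smul_apply,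
      nabla_smul, map_smul, smul_sub]
  leibniz θ a g := by
    ext v
    simp only [AddMonoidHom.mk'_apply, LinearMap.coe_mk, AddHom.coe_mk, LinearMap.smul_apply,
      LinearMap.add_apply, leibniz, smul_sub]
    abel
  nabla_lie θ η g := by
    ext v
    simp only [AddMonoidHom.mk'_apply, LinearMap.coe_mk, AddHom.coe_mk, LinearMap.sub_apply,
      nabla_lie, map_sub]
    abel

end FlatConnection

/-- The `O`-linear maps between two `D`-modules. -/
def IhomCarrier (M N : DModCat k O) : Type u := (toO k O).obj M →ₗ[O] (toO k O).obj N

instance (M N : DModCat k O) : AddCommGroup (IhomCarrier M N) :=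
  inferInstanceAs (AddCommGroup ((toO k O).obj M →ₗ[O] (toO k O).obj N))

/-- `D` acts on `O`-linear maps between `D`-modules through the connection. -/
@[reducible]
def ihomModule (M N : DModCat k O) :
    Module (DiffOp k O) ((toO k O).obj M →ₗ[O] (toO k O).obj N) :=
  Module.compHom _ ((conn M).ihom (conn N)).act

instance (M N : DModCat k O) : Module (DiffOp k O) (IhomCarrier M N) := ihomModule M N

/-- The `D`-module of `O`-linear maps between two `D`-modules. -/
def ihomDMod (M N : DModCat k O) : DModCat k O := ModuleCat.of _ (IhomCarrier M N)

/-- The `O`-module underlying `ihomDMod`. -/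
def ihomEquiv (M N : DModCat k O) :
    ((toO k O).obj M →ₗ[O] (toO k O).obj N) ≃ₗ[O] (toO k O).obj (ihomDMod M N) where
  toFun x := x
  invFun x := x
  left_inv _ := rfl
  right_inv _ := rfl
  map_add' _ _ := rfl
  map_smul' a x := (((conn M).ihom (conn N)).act_ofFun a x).symm

theorem ihomEquiv_nabla (M N : DModCat k O) (θ : Derivation k O O)
    (g : (toO k O).obj M →ₗ[O] (toO k O).obj N) :
    (conn (ihomDMod M N)).nabla θ (ihomEquiv M N g) =
      ihomEquiv M N (((conn M).ihom (conn N)).nabla θ g) :=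
  ((conn M).ihom (conn N)).act_ofDer θ g

/-- Composition with a morphism of `D`-modules. -/
def ihomMap (Q : DModCat k O) {M N : DModCat k O} (e : M ⟶ N) : ihomDMod Q M ⟶ ihomDMod Q N :=
  homMk (ModuleCat.ofHom ((ihomEquiv Q N).toLinearMap ∘ₗ
    LinearMap.compRight O ((toO k O).map e).hom ∘ₗ (ihomEquiv Q M).symm.toLinearMap) :) (by
    intro θ g
    obtain ⟨g, rfl⟩ := (ihomEquiv Q M).surjective g
    rw [ihomEquiv_nabla]
    refine Eq.trans ?_ (ihomEquiv_nabla Q N θ (((toO k O).map e).hom ∘ₗ g)).symm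
    refine congrArg (ihomEquiv Q N) (LinearMap.ext fun q => ?_)
    change (toO k O).map e ((conn M).nabla θ (g q) - g ((conn Q).nabla θ q)) =
      (conn N).nabla θ ((toO k O).map e (g q)) - (toO k O).map e (g ((conn Q).nabla θ q))
    rw [map_sub, conn_map])

/-- Surjectivity concerns only the underlying `O`-linear maps, and `Q` is projective over `O`. -/
theorem epi_ihomMap (Q : DModCat k O) [Projective Q] {M N : DModCat k O} (e : M ⟶ N) [Epi e] :
    Epi (ihomMap Q e) := by
  have := projective_toO_obj Q
  rw [ModuleCat.epi_iff_surjective]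
  intro ψ
  obtain ⟨φ, hφ⟩ := Module.projective_lifting_property ((toO k O).map e).hom
    ((ihomEquiv Q N).symm ψ) ((ModuleCat.epi_iff_surjective _).1 inferInstance)
  exact ⟨ihomEquiv Q M φ, congrArg (ihomEquiv Q N) hφ⟩

/-- Currying. -/
def curryDMod {P Q N : DModCat k O} (b : P ⊗ Q ⟶ N) : P ⟶ ihomDMod Q N :=
  homMk (ModuleCat.ofHom ((ihomEquiv Q N).toLinearMap ∘ₗ
    TensorProduct.curry ((muIso P Q).hom ≫ (toO k O).map b).hom) :) (by
    intro θ p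
    refine Eq.trans ?_ (ihomEquiv_nabla Q N θ _).symm
    refine congrArg (ihomEquiv Q N) (LinearMap.ext fun q => ?_)
    change (toO k O).map b ((muIso P Q).hom ((conn P).nabla θ p ⊗ₜ[O] q)) =
      (conn N).nabla θ ((toO k O).map b ((muIso P Q).hom (p ⊗ₜ[O] q))) -
        (toO k O).map b ((muIso P Q).hom (p ⊗ₜ[O] (conn Q).nabla θ q))
    rw [← conn_map, eq_sub_iff_add_eq, ← map_add]
    exact congrArg ((toO k O).map b) (muIso_tmul_nabla P Q θ p q).symm)

/-- Uncurrying. -/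
def uncurryDMod {P Q M : DModCat k O} (l : P ⟶ ihomDMod Q M) : P ⊗ Q ⟶ M :=
  homMk ((muIso P Q).inv ≫ (ModuleCat.ofHom (TensorProduct.lift
    ((ihomEquiv Q M).symm.toLinearMap ∘ₗ ((toO k O).map l).hom)) :)) (by
    intro θ x
    induction x using muIso_induction with
    | h p q =>
      refine (congrArg _ (muIso_tmul_nabla P Q θ p q)).trans ?_
      rw [map_add]
      change (ihomEquiv Q M).symm ((toO k O).map l ((conn P).nabla θ p)) q +
        (ihomEquiv Q M).symm ((toO k O).map l p) ((conn Q).nabla θ q) =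
        (conn M).nabla θ ((ihomEquiv Q M).symm ((toO k O).map l p) q)
      obtain ⟨g, hg⟩ := (ihomEquiv Q M).surjective ((toO k O).map l p)
      rw [conn_map, ← hg, ihomEquiv_nabla, LinearEquiv.symm_apply_apply,
        LinearEquiv.symm_apply_apply]
      exact sub_add_cancel _ _
    | hadd x y hx hy => simp only [map_add, hx, hy])

/-- The tensor product of projective `D`-modules is projective. -/
theorem projective_tensor (P Q : DModCat k O) (_ : Projective P) (_ : Projective Q) :
    Projective (P ⊗ Q) where
  factors {M N} b e _ := by
    -- After currying, lifting a map on `P ⊗ Q` through `e` becomes lifting a map on `P` through the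
    -- epimorphism `ihomMap Q e`.
    have := epi_ihomMap Q e
    let l := Projective.factorThru (curryDMod b) (ihomMap Q e)
    have hl : l ≫ ihomMap Q e = curryDMod b := Projective.factorThru_comp _ _
    refine ⟨uncurryDMod l, (toO k O).map_injective ?_⟩
    ext x
    induction x using muIso_induction with
    | h p q =>
      have := congrArg (fun φ => (ihomEquiv Q N).symm ((toO k O).map φ p) q) hl
      exact this
    | hadd x y hx hy => simp only [map_add, hx, hy]

end DModules

/-! ### Cofibrant complexes -/

section Cofibrant

variable {C : Type u} [Category.{v} C] [Abelian C]

/-- The initial complex is zero, so the degreewise cokernel of the map from it is the term of `M`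
itself. -/
theorem projective_X_of_cofibs_initial {M : ChainComplex C ℕ} (h : cofibs C (initial.to M))
    (n : ℕ) : Projective (M.X n) := by
  have hz : IsZero (⊥_ ChainComplex C ℕ) := (isZero_zero _).of_iso
    (initialIsInitial.uniqueUpToIso HasZeroObject.zeroIsInitial)
  have h0 : (initial.to M).f n = 0 := by
    rw [hz.eq_of_src (initial.to M) 0, HomologicalComplex.zero_f]
  have := (h n).2
  have e : cokernel ((initial.to M).f n) ≅ M.X n :=
    cokernelIsoOfEq h0 ≪≫ cokernelZeroIsoTarget
  exact Projective.of_iso e this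

end Cofibrant

end DMod

end

/-! ### The model structure on complexes of `D`-modules -/

theorem mainTheorem1 (k : Type v) (O : Type u) [Field k] [IsAlgClosed k] [CharZero k]
    [CommRing O] [Algebra k O] [Algebra.Smooth k O] :
    ∃ _ : ModelCategory (DGDM k O),
      weakEquivalences (DGDM k O) = quasiIsos k O ∧
      fibrations (DGDM k O) = projFibrations k O ∧
      cofibrations (DGDM k O) = projCofibrations k O ∧
      IsSymmetricMonoidalModelCategory (DGDM k O) ∧
      ∀ (M : DGDM k O), IsCofibrant M →
        ∀ {K L : DGDM k O} (f : K ⟶ L), QuasiIso f → QuasiIso (f ▷ M) := by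
  -- The separator used is `D` as a module over itself, in its `Shrink` form; it is free on one
  -- generator, hence projective.
  have hP : Projective (ModuleCat.of (DiffOp k O) (Shrink.{u} (DiffOp k O))) :=
    ModuleCat.projective_of_free ((Module.Basis.singleton Unit (DiffOp k O)).map
      (Shrink.linearEquiv (DiffOp k O) (DiffOp k O)).symm)
  have hG := ModuleCat.isSeparator.{u} (DiffOp k O)
  have := preservesColimits_tensorLeft (k := k) (O := O)
  let _ := projModelCategory.{u} hG
  -- Cofibrant complexes have projective terms, and these are flat for the tensor product over `O`.
  have hcof (M : DGDM k O) (hM : IsCofibrant M) : IsDegreewiseFlat M := fun q _ _ f _ => by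
    have := projective_X_of_cofibs_initial ((cofibration_iff _).1 hM) q
    exact mono_whiskerRight_of_projective (M.X q) f
  have hflat (M : DGDM k O) (hM : IsCofibrant M) {K L : DGDM k O} (f : K ⟶ L) (hf : QuasiIso f) :
      QuasiIso (f ▷ M) := quasiIso_whiskerRight (hcof M hM) f hf
  refine ⟨inferInstance, rfl, rfl, rfl, ?_, hflat⟩
  exact
    { hasLimits := inferInstance
      hasColimits := inferInstance
      functorialFactorization_cof_trivFib := hasFunctorialFactorization_cofibs.{u} hG
      functorialFactorization_trivCof_fib := hasFunctorialFactorization_trivCofibs.{u} hG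
      closed := nonempty_monoidalClosed
      pushoutProduct_cofibration := fun f g hf hg => (cofibration_iff _).2
        (cofibs_pushoutProduct projective_tensor ((cofibration_iff _).1 hf)
          ((cofibration_iff _).1 hg) (IsPushout.of_hasPushout (f ▷ _) (_ ◁ g)) _
          (pushout.inl_desc _ _ _) (pushout.inr_desc _ _ _))
      pushoutProduct_weakEquivalence := fun f g hf hg h => (weakEquivalence_iff _).2
        (quasiIso_pushoutProduct ((cofibration_iff _).1 hf)
          ((cofibration_iff _).1 hg) (IsPushout.of_hasPushout (f ▷ _) (_ ◁ g)) _
          (pushout.inl_desc _ _ _) (pushout.inr_desc _ _ _)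
          (h.imp (weakEquivalence_iff _).1 (weakEquivalence_iff _).1))
      -- The unit axiom is a case of the preservation of quasi-isomorphisms by a cofibrant factor.
      unit_weakEquivalence := fun q _ _ hq' X hX => (weakEquivalence_iff _).2
        (hflat X hX q ((weakEquivalence_iff _).1 hq')) }
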